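/- Let $F^n=(M^n,L)$ be a Finsler space: $M^n$ is a smooth $n$-manifold and $L$ is a smooth, positive, positively $1$-homogeneous function on an open cone $D\subset TM^n\setminus 0$ of supporting elements $(x,y)$ with positive definite metric tensor $g_{ij}=\tfrac12\dot\partial_i\dot\partial_jL^2$, where $\dot\partial_i=\partial/\partial y^i$, $\partial_i=\partial/\partial x^i$. Put $h_{ij}=L\,\dot\partial_i\dot\partial_jL$, $C_{ijk}=\tfrac12\dot\partial_kg_{ij}$, $C^i_{jk}=g^{ir}C_{rjk}$. The Cartan connection is $(F^i_{jk},G^i_j,C^i_{jk})$ with $G^i_j=\dot\partial_jG^i$, where $G^i=\tfrac12\gamma^i_{jk}y^jy^k$ and $\gamma^i_{jk}=\tfrac12g^{ir}(\partial_jg_{rk}+\partial_kg_{rj}-\partial_rg_{jk})$, and $F^i_{jk}=\tfrac12g^{ir}(\delta_jg_{rk}+\delta_kg_{rj}-\delta_rg_{jk})$, where $\delta_j=\partial_j-G^h_j\dot\partial_h$. Its $h$- and $v$-covariant derivatives are denoted by ${}_{|j}$ and $|_j$; for instance $X_{i|j}=\delta_jX_i-F^r_{ij}X_r$ and $X_i|_j=\dot\partial_jX_i-C^r_{ij}X_r$.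 Let $b_i(x,y)$ be an $h$-vector of $F^n$, i.e. a smooth covector field on $D$ with $b_i|_j=0$ and $L\,C^h_{ij}b_h=\rho\,h_{ij}$ for some nowhere zero scalar $\rho$. Suppose that the Kropina change $^*L=L^2/(b_iy^i)$ is also a Finsler metric function on $D$, and let $^*F^n=(M^n,{}^*L)$. Let $M^{n-1}$ be an immersed hypersurface $x^i=x^i(u^\alpha)$ of $M^n$, with $B^i_\alpha=\partial x^i/\partial u^\alpha$, $B^i_{\alpha\beta}=\partial^2x^i/\partial u^\alpha\partial u^\beta$, and supporting elements $(u,v)$, $y^i=B^i_\alpha v^\alpha$, such that $(x(u),y)\in D$. Let $F^{n-1}$ and $^*F^{n-1}$ be $M^{n-1}$ with the metric functions induced by $L$ and $^*L$. Let $N^i(u,v)$ be the unit normal of $F^{n-1}$ ($g_{ij}B^i_\alpha N^j=0$, $g_{ij}N^iN^j=1$), $N_i=g_{ij}N^j$, $g_{\alpha\beta}$ the metric tensor of $F^{n-1}$, $B^\alpha_i=g^{\alpha\beta}g_{ij}B^j_\beta$, $M_{\alpha\beta}=C_{ijk}B^i_\alpha B^j_\beta N^k$, $M^\alpha_\beta=g^{\alpha\delta}M_{\delta\beta}$,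 $B^i_{0\alpha}=B^i_{\beta\alpha}v^\beta$ and $H_\alpha=N_i(B^i_{0\alpha}+G^i_jB^j_\alpha)$. The induced Cartan connection on $F^{n-1}$ has the coefficients $G^\alpha_\beta=B^\alpha_i(B^i_{0\beta}+G^i_jB^j_\beta)$ and $F^\alpha_{\beta\gamma}=B^\alpha_i(B^i_{\beta\gamma}+F^i_{jk}B^j_\beta B^k_\gamma)+M^\alpha_\beta H_\gamma$. An $h$-path is a curve $(x(t),y(t))$ of supporting elements with $\ddot x^i+F^i_{jk}\dot x^j\dot x^k=0$ and $\dot y^i+G^i_j\dot x^j=0$, the coefficients being taken at $(x(t),y(t))$ (similarly on $F^{n-1}$, for the induced connection). $F^{n-1}$ is a *hyperplane of the second kind* if each $h$-path of $F^{n-1}$ with respect to the induced connection is an $h$-path of $F^n$. It is a *hyperplane of the third kind* if the unit normal is parallel along each curve $(u(t),v(t))$ of $F^{n-1}$, i.e. $\dot N^i+F^i_{jk}N^j\dot x^k+C^i_{jk}N^j(\dot y^k+G^k_l\dot x^l)=0$. The same definitions are used for $^*F^{n-1}$ in $^*F^n$. **Theorem.** Suppose that $b_i$ is gradient ($b_{i|j}=b_{j|i}$),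 that $b_i$ is tangential to $F^{n-1}$ ($b_iN^i=0$), and that $F^n$ is a Landsberg space ($P^r_{ij}=C^r_{ij|k}y^k=0$). Then: 1. $^*F^{n-1}$ is a hyperplane of the second kind if $F^{n-1}$ is a hyperplane of the second kind and $M_{\alpha\beta}=0$. 2. $^*F^{n-1}$ is a hyperplane of the third kind if $F^{n-1}$ is a hyperplane of the third kind. -/

import Mathlib

open scoped Manifold ContDiff

noncomputable section

namespace FinslerHyp

/-- Coordinate space `ℝⁿ`. -/
abbrev Vec (n : ℕ) := EuclideanSpace ℝ (Fin n)

/-- The `i`-th standard basis vector of `ℝⁿ`. -/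
def basisVec {n : ℕ} (i : Fin n) : Vec n := EuclideanSpace.single i (1 : ℝ)

/-! ### Finsler geometry in one coordinate system

A function `f (x, y)` of a point `x` and a supporting element `y` is written `f x y`. -/

section Coordinates

variable {n : ℕ}

/-- `∂_i f = ∂f/∂xⁱ`. -/
def dX (i : Fin n) (f : Vec n → Vec n → ℝ) (x y : Vec n) : ℝ :=
  fderiv ℝ (fun x' => f x' y) x (basisVec i)

/-- `∂̇_i f = ∂f/∂yⁱ`. -/
def dY (i : Fin n) (f : Vec n → Vec n → ℝ) (x y : Vec n) : ℝ :=
  fderiv ℝ (fun y' => f x y') y (basisVec i)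

/-- The metric tensor `g_ij = ½ ∂̇_i ∂̇_j L²`. -/
def metric (L : Vec n → Vec n → ℝ) (x y : Vec n) : Matrix (Fin n) (Fin n) ℝ :=
  Matrix.of fun i j => (1 / 2 : ℝ) * dY i (dY j fun x' y' => L x' y' ^ 2) x y

/-- The inverse metric `g^ij`. -/
def metricInv (L : Vec n → Vec n → ℝ) (x y : Vec n) : Matrix (Fin n) (Fin n) ℝ :=
  (metric L x y)⁻¹

/-- The angular metric tensor `h_ij = L ∂̇_i ∂̇_j L`. -/
def angular (L : Vec n → Vec n → ℝ) (i j : Fin n) (x y : Vec n) : ℝ :=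
  L x y * dY i (dY j L) x y

/-- The Cartan tensor `C_ijk = ½ ∂̇_k g_ij`. -/
def cartan (L : Vec n → Vec n → ℝ) (i j k : Fin n) (x y : Vec n) : ℝ :=
  (1 / 2 : ℝ) * dY k (fun x' y' => metric L x' y' i j) x y

/-- `C^i_jk = g^ir C_rjk`. -/
def cartanUp (L : Vec n → Vec n → ℝ) (i j k : Fin n) (x y : Vec n) : ℝ :=
  ∑ r, metricInv L x y i r * cartan L r j k x y

/-- The spray coefficients `G^i = ½ γ^i_jk y^j y^k`, where `γ^i_jk` are the Christoffel symbols
formed from `g_ij` by means of `∂_i`. -/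
def spray (L : Vec n → Vec n → ℝ) (i : Fin n) (x y : Vec n) : ℝ :=
  (1 / 2 : ℝ) * ∑ j, ∑ k, (∑ r, metricInv L x y i r * ((1 / 2 : ℝ) *
    (dX j (fun x' y' => metric L x' y' r k) x y + dX k (fun x' y' => metric L x' y' r j) x y
      - dX r (fun x' y' => metric L x' y' j k) x y))) * y j * y k

/-- The nonlinear connection `G^i_j = ∂̇_j G^i`. -/
def nonlin (L : Vec n → Vec n → ℝ) (i j : Fin n) (x y : Vec n) : ℝ :=
  dY j (spray L i) x y

/-- `δ_j f = ∂_j f - G^h_j ∂̇_h f`. -/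
def delta (L : Vec n → Vec n → ℝ) (j : Fin n) (f : Vec n → Vec n → ℝ) (x y : Vec n) : ℝ :=
  dX j f x y - ∑ h, nonlin L h j x y * dY h f x y

/-- The horizontal coefficients
`F^i_jk = ½ g^ir (δ_j g_rk + δ_k g_rj - δ_r g_jk)` of the Cartan connection. -/
def cartanF (L : Vec n → Vec n → ℝ) (i j k : Fin n) (x y : Vec n) : ℝ :=
  ∑ r, metricInv L x y i r * ((1 / 2 : ℝ) *
    (delta L j (fun x' y' => metric L x' y' r k) x y
      + delta L k (fun x' y' => metric L x' y' r j) x y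
      - delta L r (fun x' y' => metric L x' y' j k) x y))

/-- The `h`-covariant derivative `X_{i|j}` of a covariant vector. -/
def hCov (L : Vec n → Vec n → ℝ) (X : Fin n → Vec n → Vec n → ℝ) (i j : Fin n)
    (x y : Vec n) : ℝ :=
  delta L j (X i) x y - ∑ r, cartanF L r i j x y * X r x y

/-- The `v`-covariant derivative `X_i|_j` of a covariant vector. -/
def vCov (L : Vec n → Vec n → ℝ) (X : Fin n → Vec n → Vec n → ℝ) (i j : Fin n)
    (x y : Vec n) : ℝ :=
  dY j (X i) x y - ∑ r, cartanUp L r i j x y * X r x y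

/-- The `h`-covariant derivative `C^r_{ij|k}`. -/
def hCovCartan (L : Vec n → Vec n → ℝ) (r i j k : Fin n) (x y : Vec n) : ℝ :=
  delta L k (cartanUp L r i j) x y
    + ∑ s, cartanF L r s k x y * cartanUp L s i j x y
    - ∑ s, cartanF L s i k x y * cartanUp L r s j x y
    - ∑ s, cartanF L s j k x y * cartanUp L r i s x y

/-- The `(v)hv`-torsion tensor `P^r_ij = C^r_{ij|k} y^k`. -/
def torsionP (L : Vec n → Vec n → ℝ) (r i j : Fin n) (x y : Vec n) : ℝ :=
  ∑ k, hCovCartan L r i j k x y * y k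

/-- A curve `(x(t), y(t))`, `t ∈ J`, of supporting elements is an `h`-path of a connection with
coefficients `F^i_jk`, `G^i_j` if
`d²xⁱ/dt² + F^i_jk(x,y) dx^j/dt dx^k/dt = 0` and `dyⁱ/dt + G^i_j(x,y) dx^j/dt = 0`. -/
def IsHPath (F : Fin n → Fin n → Fin n → Vec n → Vec n → ℝ)
    (G : Fin n → Fin n → Vec n → Vec n → ℝ) (x y : ℝ → Vec n) (J : Set ℝ) : Prop :=
  ∀ t ∈ J, DifferentiableAt ℝ x t ∧ DifferentiableAt ℝ (deriv x) t ∧ DifferentiableAt ℝ y t ∧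
    (∀ i, deriv (deriv x) t i
      + ∑ j, ∑ k, F i j k (x t) (y t) * deriv x t j * deriv x t k = 0) ∧
    (∀ i, deriv y t i + ∑ j, G i j (x t) (y t) * deriv x t j = 0)

end Coordinates

/-! ### Hypersurfaces in coordinates: `xⁱ = Xⁱ(u)`, `yⁱ = B^i_α(u) v^α` -/

section Hypersurface

variable {m n : ℕ}

/-- The supporting element `yⁱ = B^i_α(u) v^α`. -/
def push (X : Vec m → Vec n) (u v : Vec m) : Vec n := fderiv ℝ X u v

/-- The projection factors `B^i_α = ∂xⁱ/∂u^α`. -/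
def projB (X : Vec m → Vec n) (i : Fin n) (α : Fin m) (u : Vec m) : ℝ :=
  fderiv ℝ X u (basisVec α) i

/-- `B^i_αβ = ∂²xⁱ/∂u^α∂u^β`. -/
def projB2 (X : Vec m → Vec n) (i : Fin n) (α β : Fin m) (u : Vec m) : ℝ :=
  fderiv ℝ (projB X i α) u (basisVec β)

/-- The induced metric function `L̲(u,v) = L(x(u), y(u,v))`. -/
def inducedL (L : Vec n → Vec n → ℝ) (X : Vec m → Vec n) (u v : Vec m) : ℝ :=
  L (X u) (push X u v)

/-- `g_ij B^i_α N^j = 0` and `g_ij N^i N^j = 1` at `(u,v)`. -/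
def IsUnitNormal (L : Vec n → Vec n → ℝ) (X : Vec m → Vec n) (u v : Vec m) (N : Vec n) : Prop :=
  (∀ α, ∑ i, ∑ j, metric L (X u) (push X u v) i j * projB X i α u * N j = 0) ∧
    ∑ i, ∑ j, metric L (X u) (push X u v) i j * N i * N j = 1

open Classical in
/-- A unit normal vector `N(u,v)`. In codimension one it is determined up to its sign, on which
none of the conditions below depends. -/
def unitNormal (L : Vec n → Vec n → ℝ) (X : Vec m → Vec n) (u v : Vec m) : Vec n :=
  if h : ∃ N, IsUnitNormal L X u v N then h.choose else 0

/-- `N_i = g_ij N^j`. -/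
def normalCo (L : Vec n → Vec n → ℝ) (X : Vec m → Vec n) (i : Fin n) (u v : Vec m) : ℝ :=
  ∑ j, metric L (X u) (push X u v) i j * unitNormal L X u v j

/-- The inverse projection factors `B^α_i = g^αβ g_ij B^j_β`. -/
def projInv (L : Vec n → Vec n → ℝ) (X : Vec m → Vec n) (α : Fin m) (i : Fin n)
    (u v : Vec m) : ℝ :=
  ∑ β, ∑ j, metricInv (inducedL L X) u v α β * metric L (X u) (push X u v) i j * projB X j β u

/-- The second fundamental `v`-tensor `M_αβ = C_ijk B^i_α B^j_β N^k`. -/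
def secondV (L : Vec n → Vec n → ℝ) (X : Vec m → Vec n) (α β : Fin m) (u v : Vec m) : ℝ :=
  ∑ i, ∑ j, ∑ k, cartan L i j k (X u) (push X u v)
    * projB X i α u * projB X j β u * unitNormal L X u v k

/-- `B^i_0β + G^i_j B^j_β`, where `B^i_0β = B^i_αβ v^α`. -/
def dSupport (L : Vec n → Vec n → ℝ) (X : Vec m → Vec n) (i : Fin n) (β : Fin m)
    (u v : Vec m) : ℝ :=
  ∑ α, projB2 X i α β u * v α + ∑ j, nonlin L i j (X u) (push X u v) * projB X j β u

/-- The normal curvature vector `H_α = N_i (B^i_0α + G^i_j B^j_α)`. -/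
def normalCurv (L : Vec n → Vec n → ℝ) (X : Vec m → Vec n) (α : Fin m) (u v : Vec m) : ℝ :=
  ∑ i, normalCo L X i u v * dSupport L X i α u v

/-- The nonlinear part `G^α_β = B^α_i (B^i_0β + G^i_j B^j_β)` of the induced Cartan connection. -/
def inducedG (L : Vec n → Vec n → ℝ) (X : Vec m → Vec n) (α β : Fin m) (u v : Vec m) : ℝ :=
  ∑ i, projInv L X α i u v * dSupport L X i β u v

/-- The horizontal part
`F^α_βγ = B^α_i (B^i_βγ + F^i_jk B^j_β B^k_γ) + M^α_β H_γ` of the induced Cartan connection,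
where `M^α_β = g^αδ M_δβ`. -/
def inducedF (L : Vec n → Vec n → ℝ) (X : Vec m → Vec n) (α β γ : Fin m) (u v : Vec m) : ℝ :=
  ∑ i, projInv L X α i u v * (projB2 X i β γ u
      + ∑ j, ∑ k, cartanF L i j k (X u) (push X u v) * projB X j β u * projB X k γ u)
    + (∑ δ, metricInv (inducedL L X) u v α δ * secondV L X δ β u v) * normalCurv L X γ u v

/-- Every `h`-path of the hypersurface (with supporting elements in `Ω`) with respect to the
induced Cartan connection is an `h`-path of the ambient space with respect to the Cartan
connection. -/
def HPathsAreHPaths (L : Vec n → Vec n → ℝ) (X : Vec m → Vec n) (Ω : Set (Vec m × Vec m)) :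
    Prop :=
  ∀ (a b : ℝ) (u v : ℝ → Vec m), (∀ t ∈ Set.Ioo a b, (u t, v t) ∈ Ω) →
    IsHPath (inducedF L X) (inducedG L X) u v (Set.Ioo a b) →
    IsHPath (cartanF L) (nonlin L) (fun t => X (u t)) (fun t => push X (u t) (v t)) (Set.Ioo a b)

/-- The unit normal vector is parallel with respect to the Cartan connection,
`dNⁱ/dt + F^i_jk N^j dx^k/dt + C^i_jk N^j (dy^k/dt + G^k_l dx^l/dt) = 0`,
along every differentiable curve `(u(t), v(t))` of supporting elements of the hypersurface
in `Ω`. -/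
def NormalIsParallel (L : Vec n → Vec n → ℝ) (X : Vec m → Vec n) (Ω : Set (Vec m × Vec m)) :
    Prop :=
  ∀ (a b : ℝ) (u v : ℝ → Vec m) (N : ℝ → Vec n),
    (∀ t ∈ Set.Ioo a b, (u t, v t) ∈ Ω ∧ IsUnitNormal L X (u t) (v t) (N t) ∧
      DifferentiableAt ℝ u t ∧ DifferentiableAt ℝ v t ∧ DifferentiableAt ℝ N t) →
    ∀ t ∈ Set.Ioo a b, ∀ i,
      deriv N t i
        + ∑ j, ∑ k, cartanF L i j k (X (u t)) (push X (u t) (v t)) * N t j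
            * deriv (fun s => X (u s)) t k
        + ∑ j, ∑ k, cartanUp L i j k (X (u t)) (push X (u t) (v t)) * N t j
            * (deriv (fun s => push X (u s) (v s)) t k
              + ∑ l, nonlin L k l (X (u t)) (push X (u t) (v t))
                  * deriv (fun s => X (u s)) t l) = 0

end Hypersurface

/-! ### Finsler spaces on manifolds

The geometric conditions are imposed in every coordinate system of the smooth structure. -/

section Manifold

variable {m n : ℕ}
  {M : Type*} [TopologicalSpace M] [ChartedSpace (Vec n) M]
  {S : Type*} [TopologicalSpace S] [ChartedSpace (Vec m) S]

/-- The tangent vector with coordinates `(x, y)` in the chart `φ`. -/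
def coordPoint (φ : OpenPartialHomeomorph M (Vec n)) (x y : Vec n) : TangentBundle (𝓡 n) M :=
  ⟨φ.symm x, mfderiv (𝓡 n) (𝓡 n) φ.symm x y⟩

/-- The coordinate expression of a function on the tangent bundle. -/
def coordFun (φ : OpenPartialHomeomorph M (Vec n)) (f : TangentBundle (𝓡 n) M → ℝ)
    (x y : Vec n) : ℝ :=
  f (coordPoint φ x y)

/-- The components `b_i(x,y)` of a covector field depending on the supporting element. -/
def coordCov (φ : OpenPartialHomeomorph M (Vec n))
    (b : (p : TangentBundle (𝓡 n) M) → TangentSpace (𝓡 n) p.proj →L[ℝ] ℝ)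
    (i : Fin n) (x y : Vec n) : ℝ :=
  b (coordPoint φ x y) (mfderiv (𝓡 n) (𝓡 n) φ.symm x (basisVec i))

/-- The coordinate expression of a set `D` of tangent vectors. -/
def coordDomain (φ : OpenPartialHomeomorph M (Vec n)) (D : Set (TangentBundle (𝓡 n) M)) :
    Set (Vec n × Vec n) :=
  {p | p.1 ∈ φ.target ∧ coordPoint φ p.1 p.2 ∈ D}

/-- `L` is a Finsler metric function with domain `D`: `D` is an open cone in the slit tangent
bundle, and on `D` the function `L` is positive, positively homogeneous of degree one, smooth,
and has a positive definite metric tensor. -/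
structure IsFinslerMetric [IsManifold (𝓡 n) ∞ M] (D : Set (TangentBundle (𝓡 n) M)) (L : TangentBundle (𝓡 n) M → ℝ) :
    Prop where
  isOpen : IsOpen D
  ne_zero : ∀ p ∈ D, p.snd ≠ 0
  cone : ∀ p ∈ D, ∀ c : ℝ, 0 < c → (⟨p.proj, c • p.snd⟩ : TangentBundle (𝓡 n) M) ∈ D
  pos : ∀ p ∈ D, 0 < L p
  homog : ∀ p ∈ D, ∀ c : ℝ, 0 < c → L ⟨p.proj, c • p.snd⟩ = c * L p
  smooth : ∀ φ ∈ IsManifold.maximalAtlas (𝓡 n) ∞ M,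
    ContDiffOn ℝ ∞ (fun p : Vec n × Vec n => coordFun φ L p.1 p.2) (coordDomain φ D)
  posDef : ∀ φ ∈ IsManifold.maximalAtlas (𝓡 n) ∞ M, ∀ x y, (x, y) ∈ coordDomain φ D →
    (metric (coordFun φ L) x y).PosDef

/-- `b` is an `h`-vector of `(M, L)`: a smooth covector field with `b_i|_j = 0` and
`L C^h_ij b_h = ρ h_ij` for a nowhere vanishing scalar `ρ`. -/
structure IsHVector (D : Set (TangentBundle (𝓡 n) M)) (L : TangentBundle (𝓡 n) M → ℝ)
    (b : (p : TangentBundle (𝓡 n) M) → TangentSpace (𝓡 n) p.proj →L[ℝ] ℝ) : Prop where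
  smooth : ∀ φ ∈ IsManifold.maximalAtlas (𝓡 n) ∞ M, ∀ i,
    ContDiffOn ℝ ∞ (fun p : Vec n × Vec n => coordCov φ b i p.1 p.2) (coordDomain φ D)
  vCov_eq_zero : ∀ φ ∈ IsManifold.maximalAtlas (𝓡 n) ∞ M, ∀ x y, (x, y) ∈ coordDomain φ D →
    ∀ i j, vCov (coordFun φ L) (coordCov φ b) i j x y = 0
  exists_scalar : ∃ ρ : TangentBundle (𝓡 n) M → ℝ, (∀ p ∈ D, ρ p ≠ 0) ∧
    ∀ φ ∈ IsManifold.maximalAtlas (𝓡 n) ∞ M, ∀ x y, (x, y) ∈ coordDomain φ D → ∀ i j,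
      coordFun φ L x y * ∑ h, cartanUp (coordFun φ L) h i j x y * coordCov φ b h x y
        = coordFun φ ρ x y * angular (coordFun φ L) i j x y

/-- `b` is gradient: `b_{i|j} = b_{j|i}`. -/
def IsGradient (D : Set (TangentBundle (𝓡 n) M)) (L : TangentBundle (𝓡 n) M → ℝ)
    (b : (p : TangentBundle (𝓡 n) M) → TangentSpace (𝓡 n) p.proj →L[ℝ] ℝ) : Prop :=
  ∀ φ ∈ IsManifold.maximalAtlas (𝓡 n) ∞ M, ∀ x y, (x, y) ∈ coordDomain φ D → ∀ i j,
    hCov (coordFun φ L) (coordCov φ b) i j x y = hCov (coordFun φ L) (coordCov φ b) j i x y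

/-- `(M, L)` is a Landsberg space: `P^r_ij = 0`. -/
def IsLandsberg (D : Set (TangentBundle (𝓡 n) M)) (L : TangentBundle (𝓡 n) M → ℝ) : Prop :=
  ∀ φ ∈ IsManifold.maximalAtlas (𝓡 n) ∞ M, ∀ x y, (x, y) ∈ coordDomain φ D → ∀ r i j,
    torsionP (coordFun φ L) r i j x y = 0

/-- The Kropina change `*L = L² / β`, where `β = b_i(x,y) yⁱ`. -/
def kropina (L : TangentBundle (𝓡 n) M → ℝ)
    (b : (p : TangentBundle (𝓡 n) M) → TangentSpace (𝓡 n) p.proj →L[ℝ] ℝ)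
    (p : TangentBundle (𝓡 n) M) : ℝ :=
  L p ^ 2 / b p p.snd

/-- The coordinate expression `x(u)` of the map `ι`. -/
def coordMap (φ : OpenPartialHomeomorph M (Vec n)) (ψ : OpenPartialHomeomorph S (Vec m))
    (ι : S → M) (u : Vec m) : Vec n :=
  φ (ι (ψ.symm u))

/-- The coordinates `(u, v)` of the supporting elements of the hypersurface that lie in `D`. -/
def hypDomain (φ : OpenPartialHomeomorph M (Vec n)) (ψ : OpenPartialHomeomorph S (Vec m))
    (D : Set (TangentBundle (𝓡 n) M)) (ι : S → M) : Set (Vec m × Vec m) :=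
  {p | p.1 ∈ ψ.target ∧ ι (ψ.symm p.1) ∈ φ.source ∧
    (coordMap φ ψ ι p.1, push (coordMap φ ψ ι) p.1 p.2) ∈ coordDomain φ D}

/-- `b` is tangential to the hypersurface: `b_i Nⁱ = 0`. -/
def IsTangential (D : Set (TangentBundle (𝓡 n) M)) (L : TangentBundle (𝓡 n) M → ℝ) (ι : S → M)
    (b : (p : TangentBundle (𝓡 n) M) → TangentSpace (𝓡 n) p.proj →L[ℝ] ℝ) : Prop :=
  ∀ φ ∈ IsManifold.maximalAtlas (𝓡 n) ∞ M, ∀ ψ ∈ IsManifold.maximalAtlas (𝓡 m) ∞ S,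
    ∀ u v, (u, v) ∈ hypDomain φ ψ D ι →
      ∑ i, coordCov φ b i (coordMap φ ψ ι u) (push (coordMap φ ψ ι) u v)
        * unitNormal (coordFun φ L) (coordMap φ ψ ι) u v i = 0

/-- `M_αβ = 0`. -/
def SecondVVanishes (D : Set (TangentBundle (𝓡 n) M)) (L : TangentBundle (𝓡 n) M → ℝ)
    (ι : S → M) : Prop :=
  ∀ φ ∈ IsManifold.maximalAtlas (𝓡 n) ∞ M, ∀ ψ ∈ IsManifold.maximalAtlas (𝓡 m) ∞ S,
    ∀ u v, (u, v) ∈ hypDomain φ ψ D ι → ∀ α β,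
      secondV (coordFun φ L) (coordMap φ ψ ι) α β u v = 0

/-- Hyperplane of the second kind: each `h`-path of the hypersurface with respect to the induced
Cartan connection is an `h`-path of the ambient Finsler space. -/
def IsHyperplaneSecondKind (D : Set (TangentBundle (𝓡 n) M)) (L : TangentBundle (𝓡 n) M → ℝ)
    (ι : S → M) : Prop :=
  ∀ φ ∈ IsManifold.maximalAtlas (𝓡 n) ∞ M, ∀ ψ ∈ IsManifold.maximalAtlas (𝓡 m) ∞ S,
    HPathsAreHPaths (coordFun φ L) (coordMap φ ψ ι) (hypDomain φ ψ D ι)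

/-- Hyperplane of the third kind: the unit normal vector is parallel along each curve of the
hypersurface. -/
def IsHyperplaneThirdKind (D : Set (TangentBundle (𝓡 n) M)) (L : TangentBundle (𝓡 n) M → ℝ)
    (ι : S → M) : Prop :=
  ∀ φ ∈ IsManifold.maximalAtlas (𝓡 n) ∞ M, ∀ ψ ∈ IsManifold.maximalAtlas (𝓡 m) ∞ S,
    NormalIsParallel (coordFun φ L) (coordMap φ ψ ι) (hypDomain φ ψ D ι)

end Manifold

end FinslerHyp

end

open Filter Topology

noncomputable section

set_option maxSynthPendingDepth 2

namespace FinslerHyp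

/-! ### Iterated derivatives on a product space -/

section Calculus

variable {P Q : Type*} [NormedAddCommGroup P] [NormedSpace ℝ P]
  [NormedAddCommGroup Q] [NormedSpace ℝ Q]

/-! Write `E = L²/2`, so that `g = ∂̇∂̇E`. Both kinds of hyperplane are governed by two conditions
on the hypersurface: `H_α = 0`, meaning that `B_0α + G_α` is tangential, and `M_αβ = 0`.

If both hold, differentiating `H = 0` along the fibres makes `B_αβ` plus the Berwald coefficients
tangential. Berwald and Cartan coefficients differ by the derivative of the Cartan tensor along the
spray (`berwald_sub_cartan`). The spray is tangent to the hypersurface because `H = 0`, so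
differentiating `M = 0` along it annihilates the normal component of this difference. Hence `B_αβ +
F(B_α, B_β)` is tangential too (`second_add_cartan_mem_range`). It follows that `h`-paths of the
hypersurface are ambient `h`-paths and that unit normals are parallel (`hPathsAreHPaths`,
`normalIsParallel`).

Conversely, parallel normals force `H = 0` and `M = 0` (`vanishes_of_normalIsParallel`). The second
kind forces `H = 0`, because an induced `h`-path starts at every supporting element in every
direction (`normalCurvatureVanishes_of_hPaths`); there `M = 0` is a hypothesis. It remains to carry
`H = 0` and `M = 0` from `L` to `K = L²/β`.

Let `N` be normal. Then `∂̇L(N) = 0`, and `∂̇β(N) = b_i Nⁱ = 0` by tangentiality. The `h`-vector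
conditions give `∂̇∂̇β = ρ ∂̇∂̇L`. Differentiating `Kβ = L²` twice shows that the metrics of `K` and
`L` are proportional on pairs of which one member is `N`, so the normals agree. The gradient
condition says that `β` satisfies the Euler-Lagrange equations along the spray of `L`. In the
direction `N` so does `K`, and therefore the two sprays differ by a tangential vector
(`kropina_normal`). Fibre derivatives of these two facts transfer `H = 0` and `M = 0`.

Most identities are obtained by differentiating an identity valid on an open set
(`fderiv_unique_of_eqOn`). The geometry is done without coordinates on `V × V`; index formulas are
translated into this form afterwards. -/

theorem contDiffOn_fderiv {f : P → Q} {U : Set P} (hf : ContDiffOn ℝ ∞ f U) (hU : IsOpen U) :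
    ContDiffOn ℝ ∞ (fderiv ℝ f) U :=
  hf.fderiv_of_isOpen hU (by simp)

theorem hasFDerivAt_of_contDiffOn {f : P → Q} {U : Set P} (hf : ContDiffOn ℝ ∞ f U)
    (hU : IsOpen U) {p : P} (hp : p ∈ U) : HasFDerivAt f (fderiv ℝ f p) p :=
  ((hf.contDiffAt (hU.mem_nhds hp)).differentiableAt (by simp)).hasFDerivAt

theorem fderiv_fderiv_comm {f : P → Q} {U : Set P} (hf : ContDiffOn ℝ ∞ f U) (hU : IsOpen U)
    {p : P} (hp : p ∈ U) (ξ η : P) :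
    fderiv ℝ (fderiv ℝ f) p ξ η = fderiv ℝ (fderiv ℝ f) p η ξ :=
  ((hf.contDiffAt (hU.mem_nhds hp)).isSymmSndFDerivAt
    (by simpa using WithTop.coe_le_coe.2 (le_top : (2 : ℕ∞) ≤ ⊤))).eq ξ η

/-- Two functions that agree on an open set have the same derivative there. -/
theorem fderiv_unique_of_eqOn {f h : P → Q} {U : Set P} (hU : IsOpen U) {p : P} (hp : p ∈ U)
    {f' h' : P →L[ℝ] Q} (hf : HasFDerivAt f f' p) (hh : HasFDerivAt h h' p)
    (hfh : ∀ q ∈ U, f q = h q) : f' = h' :=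
  hf.unique (hh.congr_of_eventuallyEq (eventually_of_mem (hU.mem_nhds hp) hfh))

end Calculus

/-! ### Energy functions, sprays and the Cartan connection without coordinates. -/

section Finsler

variable {V : Type*} [NormedAddCommGroup V] [NormedSpace ℝ V]

variable (V) in
/-- The space `V × V` of the pairs `(x, y)`, as a normed space. -/
def TS : Type _ := V × V

instance : NormedAddCommGroup (TS V) := inferInstanceAs (NormedAddCommGroup (V × V))

instance : NormedSpace ℝ (TS V) := inferInstanceAs (NormedSpace ℝ (V × V))

variable (V) in
/-- The identity, as an isometry of `V × V` with `TS V`. -/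
def toTS : V × V ≃ₗᵢ[ℝ] TS V where
  toFun p := p
  invFun p := p
  map_add' _ _ := rfl
  map_smul' _ _ := rfl
  left_inv _ := rfl
  right_inv _ := rfl
  norm_map' _ := rfl

/-- The tangent vector `(a, 0)` of `V × V`. -/
def hor : V →L[ℝ] TS V := (toTS V).toContinuousLinearEquiv.toContinuousLinearMap.comp
  (ContinuousLinearMap.inl ℝ V V)

/-- The tangent vector `(0, a)` of `V × V`. -/
def ver : V →L[ℝ] TS V := (toTS V).toContinuousLinearEquiv.toContinuousLinearMap.comp
  (ContinuousLinearMap.inr ℝ V V)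

variable (V) in
/-- The projection `(x, y) ↦ y`. -/
def sndTS : TS V →L[ℝ] V := (ContinuousLinearMap.snd ℝ V V).comp
  (toTS V).symm.toContinuousLinearEquiv.toContinuousLinearMap

@[simp] theorem sndTS_hor (a : V) : sndTS V (hor a) = 0 := rfl
@[simp] theorem sndTS_ver (a : V) : sndTS V (ver a) = a := rfl

section Derivatives

variable (E : TS V → ℝ)

/-- The first derivative. -/
def d1 (p : TS V) : TS V →L[ℝ] ℝ := fderiv ℝ E p

/-- The second derivative. -/
def d2 (p : TS V) : TS V →L[ℝ] TS V →L[ℝ] ℝ := fderiv ℝ (d1 E) p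

/-- The third derivative. -/
def d3 (p : TS V) : TS V →L[ℝ] TS V →L[ℝ] TS V →L[ℝ] ℝ := fderiv ℝ (d2 E) p

/-- The fourth derivative. -/
def d4 (p : TS V) : TS V →L[ℝ] TS V →L[ℝ] TS V →L[ℝ] TS V →L[ℝ] ℝ := fderiv ℝ (d3 E) p

variable {E} {U : Set (TS V)} (hE : ContDiffOn ℝ ∞ E U) (hU : IsOpen U)

include hE hU

theorem contDiffOn_d1 : ContDiffOn ℝ ∞ (d1 E) U := contDiffOn_fderiv hE hU
theorem contDiffOn_d2 : ContDiffOn ℝ ∞ (d2 E) U := contDiffOn_fderiv (contDiffOn_d1 hE hU) hU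
theorem contDiffOn_d3 : ContDiffOn ℝ ∞ (d3 E) U := contDiffOn_fderiv (contDiffOn_d2 hE hU) hU

variable {p : TS V} (hp : p ∈ U)

include hp

theorem hasFDerivAt_d0 : HasFDerivAt E (d1 E p) p := hasFDerivAt_of_contDiffOn hE hU hp
theorem hasFDerivAt_d1 : HasFDerivAt (d1 E) (d2 E p) p :=
  hasFDerivAt_of_contDiffOn (contDiffOn_d1 hE hU) hU hp
theorem hasFDerivAt_d2 : HasFDerivAt (d2 E) (d3 E p) p :=
  hasFDerivAt_of_contDiffOn (contDiffOn_d2 hE hU) hU hp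
theorem hasFDerivAt_d3 : HasFDerivAt (d3 E) (d4 E p) p :=
  hasFDerivAt_of_contDiffOn (contDiffOn_d3 hE hU) hU hp

theorem d2_comm (ξ η : TS V) : d2 E p ξ η = d2 E p η ξ := fderiv_fderiv_comm hE hU hp ξ η

theorem d3_comm (ξ η ζ : TS V) : d3 E p ξ η ζ = d3 E p η ξ ζ :=
  DFunLike.congr_fun (fderiv_fderiv_comm (contDiffOn_d1 hE hU) hU hp ξ η) ζ

theorem d4_comm (ξ η ζ θ : TS V) : d4 E p ξ η ζ θ = d4 E p η ξ ζ θ :=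
  DFunLike.congr_fun
    (DFunLike.congr_fun (fderiv_fderiv_comm (contDiffOn_d2 hE hU) hU hp ξ η) ζ) θ

/-- The derivative of the symmetry of `d2`. With `d3_comm` it generates all permutations of the
arguments. -/
theorem d3_comm_last (ξ η ζ : TS V) : d3 E p ξ η ζ = d3 E p ξ ζ η := by
  have h (η ζ : TS V) := ((hasFDerivAt_d2 hE hU hp).clm_apply
    (hasFDerivAt_const η p)).clm_apply (hasFDerivAt_const ζ p)
  have := DFunLike.congr_fun (fderiv_unique_of_eqOn hU hp (h η ζ) (h ζ η)
    fun q hq => d2_comm hE hU hq η ζ) ξ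
  simpa using this

theorem d4_comm_mid (ξ η ζ θ : TS V) : d4 E p ξ η ζ θ = d4 E p ξ ζ η θ := by
  have h (η ζ : TS V) := (((hasFDerivAt_d3 hE hU hp).clm_apply
    (hasFDerivAt_const η p)).clm_apply (hasFDerivAt_const ζ p)).clm_apply (hasFDerivAt_const θ p)
  have := DFunLike.congr_fun (fderiv_unique_of_eqOn hU hp (h η ζ) (h ζ η)
    fun q hq => d3_comm hE hU hq η ζ θ) ξ
  simpa using this

theorem d4_comm_last (ξ η ζ θ : TS V) : d4 E p ξ η ζ θ = d4 E p ξ η θ ζ := by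
  have h (ζ θ : TS V) := (((hasFDerivAt_d3 hE hU hp).clm_apply
    (hasFDerivAt_const η p)).clm_apply (hasFDerivAt_const ζ p)).clm_apply (hasFDerivAt_const θ p)
  have := DFunLike.congr_fun (fderiv_unique_of_eqOn hU hp (h ζ θ) (h θ ζ)
    fun q hq => d3_comm_last hE hU hq η ζ θ) ξ
  simpa using this

end Derivatives

/-- An energy function `E = L² / 2` on an open set `U` of supporting elements. -/
structure IsEnergy (E : TS V → ℝ) (U : Set (TS V)) : Prop where
  isOpen : IsOpen U
  smooth : ContDiffOn ℝ ∞ E U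
  homog : ∀ p ∈ U, d1 E p (ver (sndTS V p)) = 2 * E p
  posDef : ∀ p ∈ U, ∀ a : V, a ≠ 0 → 0 < d2 E p (ver a) (ver a)

namespace IsEnergy

variable {E : TS V → ℝ} {U : Set (TS V)} (h : IsEnergy E U) {p : TS V} (hp : p ∈ U)

include h hp

/-- Nondegeneracy of the metric. Identities between vectors are proved by lowering the index, so no
inverse metric enters the coordinate-free part. -/
theorem eq_of_metric_eq {a b : V}
    (hab : ∀ c, d2 E p (ver c) (ver a) = d2 E p (ver c) (ver b)) : a = b := by
  by_contra hne
  have h1 := h.posDef p hp (a - b) (sub_ne_zero.2 hne)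
  have h2 := hab (a - b)
  rw [map_sub ver a b, map_sub (d2 E p (ver a - ver b)), ← map_sub ver a b, h2] at h1
  simp at h1

/-- The derivative of Euler's relation. The last term appears because the argument `y` itself moves
with the point. -/
theorem d2_ver_self (ξ : TS V) :
    d2 E p ξ (ver (sndTS V p)) = 2 * d1 E p ξ - d1 E p (ver (sndTS V ξ)) := by
  have hl : HasFDerivAt (fun q : TS V => ver (sndTS V q)) (ver.comp (sndTS V)) p :=
    (ver.comp (sndTS V)).hasFDerivAt
  have h1 := (hasFDerivAt_d1 h.smooth h.isOpen hp).clm_apply hl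
  have h2 := (hasFDerivAt_d0 h.smooth h.isOpen hp).const_mul 2
  have := DFunLike.congr_fun (fderiv_unique_of_eqOn h.isOpen hp h1 h2 h.homog) ξ
  simp at this
  linarith

theorem d2_ver_ver_self (a : V) : d2 E p (ver a) (ver (sndTS V p)) = d1 E p (ver a) := by
  rw [h.d2_ver_self hp]; simp; ring

theorem d2_hor_ver_self (a : V) : d2 E p (hor a) (ver (sndTS V p)) = 2 * d1 E p (hor a) := by
  rw [h.d2_ver_self hp]; simp

/-- Euler's relation for `∂̇E`, differentiated once more. Its vertical case is `C_ijk y^k = 0`. -/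
theorem d3_ver_self (ξ : TS V) (a : V) :
    d3 E p ξ (ver a) (ver (sndTS V p)) = d2 E p ξ (ver a) - d2 E p (ver a) (ver (sndTS V ξ)) := by
  have hl : HasFDerivAt (fun q : TS V => ver (sndTS V q)) (ver.comp (sndTS V)) p :=
    (ver.comp (sndTS V)).hasFDerivAt
  have h1 := ((hasFDerivAt_d2 h.smooth h.isOpen hp).clm_apply
    (hasFDerivAt_const (ver a) p)).clm_apply hl
  have h2 := (hasFDerivAt_d1 h.smooth h.isOpen hp).clm_apply (hasFDerivAt_const (ver a) p)
  have := DFunLike.congr_fun (fderiv_unique_of_eqOn h.isOpen hp h1 h2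
    fun q hq => h.d2_ver_ver_self hq a) ξ
  simp at this
  linarith

theorem d3_ver_ver_self (a b : V) : d3 E p (ver a) (ver b) (ver (sndTS V p)) = 0 := by
  rw [h.d3_ver_self hp, d2_comm h.smooth h.isOpen hp]; simp

theorem d3_hor_ver_self (a b : V) :
    d3 E p (hor a) (ver b) (ver (sndTS V p)) = d2 E p (hor a) (ver b) := by
  rw [h.d3_ver_self hp]; simp

end IsEnergy

/-- An energy function `E = L² / 2`, its spray `G` and the horizontal coefficients `F` of its
Cartan connection on an open set `U`, without coordinates. -/
structure IsCartanSpray (E : TS V → ℝ) (U : Set (TS V)) (G : TS V → V)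
    (F : TS V → V → V → V) : Prop extends IsEnergy E U where
  smooth_spray : ContDiffOn ℝ ∞ G U
  -- The Euler-Lagrange form of the spray. By homogeneity it agrees with the contracted Christoffel
  -- symbols, but it needs only two derivatives of `E`.
  spray_eq : ∀ p ∈ U, ∀ a : V,
    2 * d2 E p (ver a) (ver (G p)) = d2 E p (hor (sndTS V p)) (ver a) - d1 E p (hor a)
  -- The Christoffel formula with lowered index; `hor b - ver (fderiv ℝ G p (ver b))` is the
  -- direction of `δ_b`.
  cartan_eq : ∀ p ∈ U, ∀ a b c : V,
    2 * d2 E p (ver a) (ver (F p b c)) =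
      d3 E p (hor b - ver (fderiv ℝ G p (ver b))) (ver a) (ver c)
        + d3 E p (hor c - ver (fderiv ℝ G p (ver c))) (ver a) (ver b)
        - d3 E p (hor a - ver (fderiv ℝ G p (ver a))) (ver b) (ver c)

namespace IsCartanSpray

variable {E : TS V → ℝ} {U : Set (TS V)} {G : TS V → V} {F : TS V → V → V → V}
  (h : IsCartanSpray E U G F) {p : TS V} (hp : p ∈ U)

include h hp

theorem hasFDerivAt_spray : HasFDerivAt G (fderiv ℝ G p) p :=
  hasFDerivAt_of_contDiffOn h.smooth_spray h.isOpen hp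

theorem hasFDerivAt_fderiv_spray : HasFDerivAt (fderiv ℝ G) (fderiv ℝ (fderiv ℝ G) p) p :=
  hasFDerivAt_of_contDiffOn (contDiffOn_fderiv h.smooth_spray h.isOpen) h.isOpen hp

/-- The derivative of the spray equation. -/
theorem spray_eq_deriv (a c : V) :
    2 * (d3 E p (ver c) (ver a) (ver (G p)) + d2 E p (ver a) (ver (fderiv ℝ G p (ver c)))) =
      d3 E p (ver c) (hor (sndTS V p)) (ver a) + d2 E p (hor c) (ver a) - d2 E p (ver c) (hor a) := by
  have hl : HasFDerivAt (fun q : TS V => hor (sndTS V q)) (hor.comp (sndTS V)) p :=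
    (hor.comp (sndTS V)).hasFDerivAt
  have hG : HasFDerivAt (fun q => ver (G q)) (ver.comp (fderiv ℝ G p)) p :=
    (ver (V := V)).hasFDerivAt.comp p (h.hasFDerivAt_spray hp)
  have k1 := hasFDerivAt_d1 h.smooth h.isOpen hp
  have k2 := hasFDerivAt_d2 h.smooth h.isOpen hp
  have h1 := ((k2.clm_apply (hasFDerivAt_const (ver a) p)).clm_apply hG).const_mul 2
  have h2 := ((k2.clm_apply hl).clm_apply (hasFDerivAt_const (ver a) p)).sub
    (k1.clm_apply (hasFDerivAt_const (hor a) p))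
  have := DFunLike.congr_fun (fderiv_unique_of_eqOn h.isOpen hp h1 h2
    fun q hq => h.spray_eq q hq a) (ver c)
  simp at this
  linarith

/-- The second derivative of the spray equation. -/
theorem spray_eq_deriv₂ (a b c : V) :
    2 * (d4 E p (ver b) (ver c) (ver a) (ver (G p))
        + d3 E p (ver c) (ver a) (ver (fderiv ℝ G p (ver b)))
        + d3 E p (ver b) (ver a) (ver (fderiv ℝ G p (ver c)))
        + d2 E p (ver a) (ver (fderiv ℝ (fderiv ℝ G) p (ver b) (ver c)))) =
      d4 E p (ver b) (ver c) (hor (sndTS V p)) (ver a) + d3 E p (ver c) (hor b) (ver a)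
        + d3 E p (ver b) (hor c) (ver a) - d3 E p (ver b) (ver c) (hor a) := by
  have hl : HasFDerivAt (fun q : TS V => hor (sndTS V q)) (hor.comp (sndTS V)) p :=
    (hor.comp (sndTS V)).hasFDerivAt
  have hG : HasFDerivAt (fun q => ver (G q)) (ver.comp (fderiv ℝ G p)) p :=
    (ver (V := V)).hasFDerivAt.comp p (h.hasFDerivAt_spray hp)
  have hG1 := (ver (V := V)).hasFDerivAt.comp p ((h.hasFDerivAt_fderiv_spray hp).clm_apply
    (hasFDerivAt_const (ver c) p))
  have k2 := hasFDerivAt_d2 h.smooth h.isOpen hp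
  have k3 := hasFDerivAt_d3 h.smooth h.isOpen hp
  have h1 := ((((k3.clm_apply (hasFDerivAt_const (ver c) p)).clm_apply
    (hasFDerivAt_const (ver a) p)).clm_apply hG).add
    ((k2.clm_apply (hasFDerivAt_const (ver a) p)).clm_apply hG1)).const_mul 2
  have h2 := ((((k3.clm_apply (hasFDerivAt_const (ver c) p)).clm_apply hl).clm_apply
    (hasFDerivAt_const (ver a) p)).add ((k2.clm_apply (hasFDerivAt_const (hor c) p)).clm_apply
    (hasFDerivAt_const (ver a) p))).sub ((k2.clm_apply (hasFDerivAt_const (ver c) p)).clm_apply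
    (hasFDerivAt_const (hor a) p))
  have := DFunLike.congr_fun (fderiv_unique_of_eqOn h.isOpen hp h1 h2
    fun q hq => h.spray_eq_deriv hq a c) (ver b)
  simp at this
  linarith

/-- `G^i_j y^j = 2 G^i`. -/
theorem fderiv_spray_self : fderiv ℝ G p (ver (sndTS V p)) = (2 : ℝ) • G p := by
  refine h.eq_of_metric_eq hp fun a => ?_
  have h1 := h.spray_eq_deriv hp a (sndTS V p)
  have h2 := h.spray_eq p hp a
  rw [d3_comm h.smooth h.isOpen hp, d3_comm_last h.smooth h.isOpen hp,
    h.d3_ver_ver_self hp,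
    d3_comm h.smooth h.isOpen hp, d3_comm_last h.smooth h.isOpen hp, h.d3_hor_ver_self hp,
    d2_comm h.smooth h.isOpen hp (ver (sndTS V p)), h.d2_hor_ver_self hp] at h1
  simp at h1 ⊢
  linarith

theorem cartan_symm (b c : V) : F p b c = F p c b := by
  refine h.eq_of_metric_eq hp fun a => ?_
  have h1 := h.cartan_eq p hp a b c
  have h2 := h.cartan_eq p hp a c b
  rw [d3_comm_last h.smooth h.isOpen hp _ (ver c) (ver b)] at h2
  linarith

/-- `F^i_jk y^j = G^i_k`. -/
theorem cartan_self (c : V) : F p (sndTS V p) c = fderiv ℝ G p (ver c) := by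
  refine h.eq_of_metric_eq hp fun a => ?_
  have h1 := h.cartan_eq p hp a (sndTS V p) c
  have h2 := h.spray_eq_deriv hp a c
  rw [h.fderiv_spray_self hp] at h1
  rw [d3_comm_last h.smooth h.isOpen hp _ (ver (sndTS V p)) (ver c), h.d3_ver_self hp,
    h.d3_ver_self hp] at h1
  rw [d3_comm h.smooth h.isOpen hp (ver c) (hor (sndTS V p)), d3_comm h.smooth h.isOpen hp (ver c) (ver a),
    d3_comm_last h.smooth h.isOpen hp (ver a), d3_comm h.smooth h.isOpen hp (ver a),
    d3_comm_last h.smooth h.isOpen hp (hor (sndTS V p)) (ver c), d2_comm h.smooth h.isOpen hp (ver c)] at h2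
  simp at h1 h2
  rw [d2_comm h.smooth h.isOpen hp (ver (fderiv ℝ G p (ver c))) (ver a),
    d2_comm h.smooth h.isOpen hp (ver (fderiv ℝ G p (ver a))) (ver c)] at h1
  linarith

/-- The Cartan connection is metrical along horizontal directions. -/
theorem metric_compat (a b c : V) :
    d3 E p (hor b - ver (fderiv ℝ G p (ver b))) (ver a) (ver c) =
      d2 E p (ver c) (ver (F p a b)) + d2 E p (ver a) (ver (F p c b)) := by
  have h1 := h.cartan_eq p hp a c b
  have h2 := h.cartan_eq p hp c a b
  rw [d3_comm_last h.smooth h.isOpen hp _ (ver c) (ver a)] at h2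
  linarith

/-- The metric tensor is parallel along the spray. -/
theorem metric_compat_spray (a b : V) :
    d3 E p (hor (sndTS V p) - (2 : ℝ) • ver (G p)) (ver a) (ver b) =
      d2 E p (ver b) (ver (fderiv ℝ G p (ver a))) + d2 E p (ver a) (ver (fderiv ℝ G p (ver b))) := by
  rw [← map_smul, ← h.fderiv_spray_self hp, h.metric_compat hp, h.cartan_symm hp a,
    h.cartan_symm hp b, h.cartan_self hp, h.cartan_self hp]

/-- The difference of the Berwald and the Cartan connection is the covariant derivative of the
Cartan tensor along the spray. -/
theorem berwald_sub_cartan (a b c : V) :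
    2 * (d2 E p (ver a) (ver (fderiv ℝ (fderiv ℝ G) p (ver b) (ver c)))
        - d2 E p (ver a) (ver (F p b c))) =
      d4 E p (hor (sndTS V p) - (2 : ℝ) • ver (G p)) (ver a) (ver b) (ver c)
        - d3 E p (ver (fderiv ℝ G p (ver a))) (ver b) (ver c)
        - d3 E p (ver a) (ver (fderiv ℝ G p (ver b))) (ver c)
        - d3 E p (ver a) (ver b) (ver (fderiv ℝ G p (ver c))) := by
  -- The horizontal derivatives of the metric in the twice differentiated spray equation are those
  -- in the formula for `F`, so they cancel. The fourth derivatives and the Cartan tensor terms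
  -- remain.
  have s := h.smooth
  have o := h.isOpen
  have h1 := h.cartan_eq p hp a b c
  have h2 := h.spray_eq_deriv₂ hp a b c
  have e1 (ξ : TS V) : d4 E p (ver b) (ver c) ξ (ver a) = d4 E p ξ (ver a) (ver b) (ver c) := by
    rw [d4_comm_mid s o hp, d4_comm s o hp, d4_comm_last s o hp, d4_comm_mid s o hp]
  rw [d4_comm_last s o hp, e1, e1, d3_comm s o hp (ver c) (hor b), d3_comm s o hp (ver b) (hor c),
    d3_comm_last s o hp (ver b) (ver c) (hor a), d3_comm s o hp (ver b) (hor a),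
    d3_comm_last s o hp (hor b) (ver c), d3_comm_last s o hp (hor c) (ver b),
    d3_comm s o hp (ver c) (ver a)] at h2
  rw [d3_comm s o hp (ver b) (ver a)] at h2
  rw [d3_comm s o hp (ver a) (ver (fderiv ℝ G p (ver b))),
    d3_comm_last s o hp (ver a) (ver b), d3_comm s o hp (ver a) (ver (fderiv ℝ G p (ver c)))]
  rw [d3_comm_last s o hp (ver a) (ver c), d3_comm s o hp (ver a) (ver (fderiv ℝ G p (ver b))),
    d3_comm_last s o hp (ver a) (ver b), d3_comm s o hp (ver a) (ver (fderiv ℝ G p (ver c)))] at h2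
  simp at h1 h2 ⊢
  linarith

end IsCartanSpray

end Finsler

/-! ### Hypersurfaces: consequences of vanishing normal curvature and second `v`-tensor. -/

section Hypersurfaces

variable {V : Type*} [NormedAddCommGroup V] [NormedSpace ℝ V]
  {W : Type*} [NormedAddCommGroup W] [NormedSpace ℝ W]

/-- A finite-dimensional subspace is closed and contains the difference quotients. This is used to
differentiate tangentiality along a fibre, where the tangent space is fixed. -/
theorem mem_of_hasDerivAt_of_eventually_mem [FiniteDimensional ℝ V] (K : Submodule ℝ V)
    {f : ℝ → V} {f' : V} {t : ℝ} (hf : HasDerivAt f f' t) (hK : ∀ᶠ s in 𝓝 t, f s ∈ K) :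
    f' ∈ K := by
  refine K.closed_of_finiteDimensional.mem_of_tendsto (hasDerivAt_iff_tendsto_slope.1 hf) ?_
  filter_upwards [nhdsWithin_le_nhds hK] with s hs
  exact K.smul_mem _ (K.sub_mem hs hK.self_of_nhds)

theorem deriv_eq_zero_of_eventually_const {f : ℝ → ℝ} {f' c : ℝ} {t : ℝ} (hf : HasDerivAt f f' t)
    (hc : ∀ᶠ s in 𝓝 t, f s = c) : f' = 0 :=
  hf.unique ((hasDerivAt_const t c).congr_of_eventuallyEq hc)

theorem hasDerivAt_comp_apply {P Q R : Type*} [NormedAddCommGroup P] [NormedSpace ℝ P]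
    [NormedAddCommGroup Q] [NormedSpace ℝ Q] [NormedAddCommGroup R] [NormedSpace ℝ R]
    {f : P → Q →L[ℝ] R} {f' : P →L[ℝ] Q →L[ℝ] R} {γ : ℝ → P} {γ' : P} {c : ℝ → Q} {c' : Q} {t : ℝ}
    (hf : HasFDerivAt f f' (γ t)) (hγ : HasDerivAt γ γ' t) (hc : HasDerivAt c c' t) :
    HasDerivAt (fun s => f (γ s) (c s)) (f' γ' (c t) + f (γ t) c') t :=
  (hf.comp_hasDerivAt t hγ).clm_apply hc

theorem hasDerivAt_clm_apply {Q R : Type*}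
    [NormedAddCommGroup Q] [NormedSpace ℝ Q] [NormedAddCommGroup R] [NormedSpace ℝ R]
    {f : ℝ → Q →L[ℝ] R} {f' : Q →L[ℝ] R} {c : ℝ → Q} {c' : Q} {t : ℝ}
    (hf : HasDerivAt f f' t) (hc : HasDerivAt c c' t) :
    HasDerivAt (fun s => f s (c s)) (f' (c t) + f t c') t :=
  hf.clm_apply hc

theorem hasDerivAt_comp_apply₃ {P Q R S T : Type*} [NormedAddCommGroup P] [NormedSpace ℝ P]
    [NormedAddCommGroup Q] [NormedSpace ℝ Q] [NormedAddCommGroup R] [NormedSpace ℝ R]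
    [NormedAddCommGroup S] [NormedSpace ℝ S] [NormedAddCommGroup T] [NormedSpace ℝ T]
    {f : P → Q →L[ℝ] R →L[ℝ] S →L[ℝ] T} {f' : P →L[ℝ] Q →L[ℝ] R →L[ℝ] S →L[ℝ] T}
    {γ : ℝ → P} {γ' : P} {a : ℝ → Q} {a' : Q} {b : ℝ → R} {b' : R} {c : ℝ → S} {c' : S} {t : ℝ}
    (hf : HasFDerivAt f f' (γ t)) (hγ : HasDerivAt γ γ' t)
    (ha : HasDerivAt a a' t) (hb : HasDerivAt b b' t) (hc : HasDerivAt c c' t) :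
    HasDerivAt (fun s => f (γ s) (a s) (b s) (c s)) (f' γ' (a t) (b t) (c t)
      + f (γ t) a' (b t) (c t) + f (γ t) (a t) b' (c t) + f (γ t) (a t) (b t) c') t := by
  have h1 := hasDerivAt_comp_apply hf hγ ha
  have h2 := hasDerivAt_clm_apply h1 hb
  have h3 := hasDerivAt_clm_apply h2 hc
  exact h3

theorem exists_curve (a b : W) : ∃ u : ℝ → W, u 0 = a ∧ HasDerivAt u b 0 :=
  ⟨fun s => a + s • b, by simp, by
    simpa using ((hasDerivAt_id (0 : ℝ)).smul_const b).const_add a⟩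

/-- The map `(u, v) ↦ (x(u), B(u) v)` of supporting elements. -/
def liftMap (X : W → V) (q : W × W) : TS V :=
  hor (X q.1) + ver (fderiv ℝ X q.1 q.2)

@[simp] theorem sndTS_liftMap (X : W → V) (q : W × W) :
    sndTS V (liftMap X q) = fderiv ℝ X q.1 q.2 := by
  simp [liftMap]

/-- The supporting elements of the hypersurface `X` that lie in `U`. -/
def liftDomain (U : Set (TS V)) (X : W → V) (O : Set W) : Set (W × W) :=
  {q | q.1 ∈ O ∧ liftMap X q ∈ U}

/-- `N` is orthogonal to the hypersurface with respect to the metric tensor. -/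
def IsNormal (E : TS V → ℝ) (X : W → V) (q : W × W) (N : V) : Prop :=
  ∀ a, d2 E (liftMap X q) (ver N) (ver (fderiv ℝ X q.1 a)) = 0

/-- An immersed hypersurface in coordinates. -/
structure IsImmersedHypersurface (X : W → V) (O : Set W) : Prop where
  isOpen : IsOpen O
  smooth : ContDiffOn ℝ ∞ X O
  injective : ∀ u ∈ O, Function.Injective (fderiv ℝ X u)
  finrank_eq : Module.finrank ℝ V = Module.finrank ℝ W + 1

/-- The normal curvature vector vanishes. -/
def NormalCurvatureVanishes (U : Set (TS V)) (G : TS V → V) (X : W → V) (O : Set W) : Prop :=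
  -- Stated as tangency, which avoids choosing a unit normal.
  ∀ q ∈ liftDomain U X O, ∀ a,
    fderiv ℝ (fderiv ℝ X) q.1 a q.2 + fderiv ℝ G (liftMap X q) (ver (fderiv ℝ X q.1 a)) ∈
      LinearMap.range (fderiv ℝ X q.1 : W →ₗ[ℝ] V)

/-- The second fundamental `v`-tensor vanishes. -/
def SecondVTensorVanishes (E : TS V → ℝ) (U : Set (TS V)) (X : W → V) (O : Set W) : Prop :=
  ∀ q ∈ liftDomain U X O, ∀ N, IsNormal E X q N → ∀ a b,
    d3 E (liftMap X q) (ver N) (ver (fderiv ℝ X q.1 a)) (ver (fderiv ℝ X q.1 b)) = 0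

/-- Every normal vector extends to a smooth local normal field. -/
def HasNormalFields (E : TS V → ℝ) (U : Set (TS V)) (X : W → V) (O : Set W) : Prop :=
  ∀ q ∈ liftDomain U X O, ∀ N, IsNormal E X q N → ∃ N' : W × W → V,
    ContDiffAt ℝ ∞ N' q ∧ (∀ᶠ r in 𝓝 q, IsNormal E X r (N' r)) ∧ N' q = N

namespace IsImmersedHypersurface

variable {X : W → V} {O : Set W} (i : IsImmersedHypersurface X O) {U : Set (TS V)}

include i

theorem hasFDerivAt {u : W} (hu : u ∈ O) : HasFDerivAt X (fderiv ℝ X u) u :=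
  hasFDerivAt_of_contDiffOn i.smooth i.isOpen hu

theorem hasFDerivAt_fderiv {u : W} (hu : u ∈ O) :
    HasFDerivAt (fderiv ℝ X) (fderiv ℝ (fderiv ℝ X) u) u :=
  hasFDerivAt_of_contDiffOn (contDiffOn_fderiv i.smooth i.isOpen) i.isOpen hu

theorem second_comm {u : W} (hu : u ∈ O) (a b : W) :
    fderiv ℝ (fderiv ℝ X) u a b = fderiv ℝ (fderiv ℝ X) u b a :=
  fderiv_fderiv_comm i.smooth i.isOpen hu a b

theorem contDiffOn_liftMap : ContDiffOn ℝ ∞ (liftMap X) (O ×ˢ Set.univ) := by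
  have h1 : ContDiffOn ℝ ∞ (fun q : W × W => X q.1) (O ×ˢ Set.univ) :=
    i.smooth.comp contDiffOn_fst fun q hq => hq.1
  have h2 : ContDiffOn ℝ ∞ (fun q : W × W => fderiv ℝ X q.1) (O ×ˢ Set.univ) :=
    (contDiffOn_fderiv i.smooth i.isOpen).comp contDiffOn_fst fun q hq => hq.1
  exact (hor.contDiff.comp_contDiffOn h1).add
    (ver.contDiff.comp_contDiffOn (h2.clm_apply contDiffOn_snd))

theorem isOpen_liftDomain (hU : IsOpen U) : IsOpen (liftDomain U X O) := by
  have e : liftDomain U X O = O ×ˢ Set.univ ∩ liftMap X ⁻¹' U := by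
    ext q
    simp [liftDomain]
  rw [e]
  exact i.contDiffOn_liftMap.continuousOn.isOpen_inter_preimage (i.isOpen.prod isOpen_univ) hU

theorem hasDerivAt_comp {u : ℝ → W} {t : ℝ} {u' : W} (hu : u t ∈ O) (h : HasDerivAt u u' t) :
    HasDerivAt (fun s => X (u s)) (fderiv ℝ X (u t) u') t :=
  (i.hasFDerivAt hu).comp_hasDerivAt t h

theorem hasDerivAt_fderiv_comp {u : ℝ → W} {t : ℝ} {u' : W} (hu : u t ∈ O)
    (h : HasDerivAt u u' t) :
    HasDerivAt (fun s => fderiv ℝ X (u s)) (fderiv ℝ (fderiv ℝ X) (u t) u') t :=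
  (i.hasFDerivAt_fderiv hu).comp_hasDerivAt t h

theorem hasDerivAt_push {u v : ℝ → W} {t : ℝ} {u' v' : W} (hu : u t ∈ O)
    (h : HasDerivAt u u' t) (h' : HasDerivAt v v' t) :
    HasDerivAt (fun s => fderiv ℝ X (u s) (v s))
      (fderiv ℝ (fderiv ℝ X) (u t) u' (v t) + fderiv ℝ X (u t) v') t :=
  (i.hasDerivAt_fderiv_comp hu h).clm_apply h'

theorem hasDerivAt_liftMap {u v : ℝ → W} {t : ℝ} {u' v' : W} (hu : u t ∈ O)
    (h : HasDerivAt u u' t) (h' : HasDerivAt v v' t) :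
    HasDerivAt (fun s => liftMap X (u s, v s))
      (hor (fderiv ℝ X (u t) u')
        + ver (fderiv ℝ (fderiv ℝ X) (u t) u' (v t) + fderiv ℝ X (u t) v')) t := by
  exact (hor.hasFDerivAt.comp_hasDerivAt t (i.hasDerivAt_comp hu h)).add
    (ver.hasFDerivAt.comp_hasDerivAt t (i.hasDerivAt_push hu h h'))

end IsImmersedHypersurface

variable {E : TS V → ℝ} {U : Set (TS V)} {G : TS V → V} {F : TS V → V → V → V}
  {X : W → V} {O : Set W}

section LinearAlgebra

variable [FiniteDimensional ℝ V] [FiniteDimensional ℝ W] (h : IsCartanSpray E U G F)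
  (i : IsImmersedHypersurface X O) {q : W × W} (hq : q ∈ liftDomain U X O)

include h i hq

omit h hq in
-- A dimension count: `N ↦ g(N, B ·)` maps `V` to the dual of `W`, whose dimension is smaller by
-- one. Positivity of the metric plays no role.
theorem exists_isNormal_ne_zero : ∃ N, N ≠ 0 ∧ IsNormal E X q N := by
  let T : V →ₗ[ℝ] W →ₗ[ℝ] ℝ := LinearMap.mk₂ ℝ
    (fun N a => d2 E (liftMap X q) (ver N) (ver (fderiv ℝ X q.1 a)))
    (by intros; simp) (by intros; simp) (by intros; simp) (by intros; simp)
  have hT : LinearMap.ker T ≠ ⊥ := by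
    apply LinearMap.ker_ne_bot_of_finrank_lt
    rw [show Module.finrank ℝ (W →ₗ[ℝ] ℝ) = Module.finrank ℝ W from
      Subspace.dual_finrank_eq, i.finrank_eq]
    omega
  obtain ⟨N, hN, hN0⟩ := (Submodule.ne_bot_iff _).1 hT
  exact ⟨N, hN0, fun a => DFunLike.congr_fun (LinearMap.mem_ker.1 hN) a⟩

omit [FiniteDimensional ℝ W] in
/-- A vector orthogonal to a nonzero normal vector is tangential. -/
theorem IsNormal.mem_range {N t : V} (hN : IsNormal E X q N) (hN0 : N ≠ 0)
    (ht : d2 E (liftMap X q) (ver N) (ver t) = 0) :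
    t ∈ LinearMap.range (fderiv ℝ X q.1 : W →ₗ[ℝ] V) := by
  let f : V →ₗ[ℝ] ℝ := ((d2 E (liftMap X q) (ver N)).comp ver : V →L[ℝ] ℝ)
  have hf : f ≠ 0 := fun h0 => by
    have h1 := h.posDef _ hq.2 N hN0
    have h2 : f N = 0 := by rw [h0]; rfl
    exact h1.ne' h2
  have hle : LinearMap.range (fderiv ℝ X q.1 : W →ₗ[ℝ] V) ≤ LinearMap.ker f := by
    rintro _ ⟨a, rfl⟩
    exact hN a
  have hr : Module.finrank ℝ (LinearMap.range (fderiv ℝ X q.1 : W →ₗ[ℝ] V))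
      = Module.finrank ℝ W := LinearMap.finrank_range_of_inj (i.injective _ hq.1)
  have hk := Module.Dual.finrank_ker_add_one_of_ne_zero hf
  -- The tangent space lies in the orthogonal complement of `N`, and both have codimension one.
  have := Submodule.eq_of_le_of_finrank_eq hle (by have := i.finrank_eq; omega)
  rw [this]
  exact ht

omit [FiniteDimensional ℝ W] in
-- Subtract from `N'` its projection to `N`. The rest is orthogonal to `N`, hence tangential; it is
-- also normal, hence orthogonal to itself.
theorem IsNormal.exists_smul_eq {N N' : V} (hN : IsNormal E X q N) (hN0 : N ≠ 0)
    (hN' : IsNormal E X q N') : ∃ c : ℝ, N' = c • N := by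
  have hpos := h.posDef _ hq.2 N hN0
  refine ⟨d2 E (liftMap X q) (ver N) (ver N') / d2 E (liftMap X q) (ver N) (ver N), ?_⟩
  set c := d2 E (liftMap X q) (ver N) (ver N') / d2 E (liftMap X q) (ver N) (ver N) with hc
  by_contra hne
  obtain ⟨a, ha⟩ := hN.mem_range h i hq hN0 (t := N' - c • N) (by
    simp [hc, hpos.ne'])
  have := h.posDef _ hq.2 (N' - c • N) (sub_ne_zero.2 hne)
  have h1 := hN a
  have h2 := hN' a
  rw [← ha] at this
  change d2 E (liftMap X q) (ver ((fderiv ℝ X q.1) a)) (ver ((fderiv ℝ X q.1) a)) > 0 at this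
  have ha' : (fderiv ℝ X q.1) a = N' - c • N := ha
  nth_rewrite 1 [ha'] at this
  simp [h1, h2] at this

end LinearAlgebra

section Curves

variable [FiniteDimensional ℝ V] [FiniteDimensional ℝ W] (h : IsCartanSpray E U G F)
  (i : IsImmersedHypersurface X O)

include h i

omit [FiniteDimensional ℝ V] [FiniteDimensional ℝ W] in
theorem hasDerivAt_metric {u v : ℝ → W} {a b : ℝ → V} {t : ℝ} {u' v' : W} {a' b' : V}
    (hq : (u t, v t) ∈ liftDomain U X O)
    (hu : HasDerivAt u u' t) (hv : HasDerivAt v v' t)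
    (ha : HasDerivAt a a' t) (hb : HasDerivAt b b' t) :
    HasDerivAt (fun s => d2 E (liftMap X (u s, v s)) (ver (a s)) (ver (b s)))
      (d3 E (liftMap X (u t, v t)) (hor (fderiv ℝ X (u t) u')
        + ver (fderiv ℝ (fderiv ℝ X) (u t) u' (v t) + fderiv ℝ X (u t) v')) (ver (a t)) (ver (b t))
        + d2 E (liftMap X (u t, v t)) (ver a') (ver (b t))
        + d2 E (liftMap X (u t, v t)) (ver (a t)) (ver b')) t := by
  have hl := i.hasDerivAt_liftMap hq.1 hu hv
  have h2 := (hasFDerivAt_d2 h.smooth h.isOpen hq.2).comp_hasDerivAt t hl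
  have := (h2.clm_apply (ver.hasFDerivAt.comp_hasDerivAt t ha)).clm_apply
    (ver.hasFDerivAt.comp_hasDerivAt t hb)
  simpa using this

omit [FiniteDimensional ℝ V] [FiniteDimensional ℝ W] in
/-- The derivative of `g(N, B d) = 0` along a curve of supporting elements. -/
theorem normal_deriv {u v : ℝ → W} {N : ℝ → V} {t : ℝ} {u' v' : W} {N' : V}
    (hq : (u t, v t) ∈ liftDomain U X O) (hu : HasDerivAt u u' t) (hv : HasDerivAt v v' t)
    (hN : HasDerivAt N N' t) (hn : ∀ᶠ s in 𝓝 t, IsNormal E X (u s, v s) (N s)) (d : W) :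
    d2 E (liftMap X (u t, v t)) (ver (N' + F (liftMap X (u t, v t)) (N t) (fderiv ℝ X (u t) u')))
        (ver (fderiv ℝ X (u t) d))
      + d2 E (liftMap X (u t, v t)) (ver (N t)) (ver (fderiv ℝ (fderiv ℝ X) (u t) u' d
        + F (liftMap X (u t, v t)) (fderiv ℝ X (u t) d) (fderiv ℝ X (u t) u')))
      + d3 E (liftMap X (u t, v t)) (ver (fderiv ℝ (fderiv ℝ X) (u t) u' (v t)
        + fderiv ℝ X (u t) v' + fderiv ℝ G (liftMap X (u t, v t)) (ver (fderiv ℝ X (u t) u'))))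
        (ver (N t)) (ver (fderiv ℝ X (u t) d)) = 0 := by
  have hB := (i.hasDerivAt_fderiv_comp hq.1 hu).clm_apply (hasDerivAt_const t d)
  have h1 := deriv_eq_zero_of_eventually_const (hasDerivAt_metric h i hq hu hv hN hB)
    (hn.mono fun s hs => hs d)
  -- The velocity of the lifted curve splits into a `δ`-direction and the vertical vector `ẏ +
  -- G(ẋ)`. Metric compatibility turns the first part into the `F`-terms; the second gives the
  -- Cartan tensor term.
  have h2 := h.metric_compat hq.2 (N t) (fderiv ℝ X (u t) u') (fderiv ℝ X (u t) d)
  rw [d2_comm h.smooth h.isOpen hq.2] at h2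
  simp at h1 h2 ⊢
  linarith

omit [FiniteDimensional ℝ V] [FiniteDimensional ℝ W] in
/-- The derivative of `g(N, N) = 1` along a curve of supporting elements. -/
theorem unit_deriv {u v : ℝ → W} {N : ℝ → V} {t : ℝ} {u' v' : W} {N' : V}
    (hq : (u t, v t) ∈ liftDomain U X O) (hu : HasDerivAt u u' t) (hv : HasDerivAt v v' t)
    (hN : HasDerivAt N N' t)
    (hn : ∀ᶠ s in 𝓝 t, d2 E (liftMap X (u s, v s)) (ver (N s)) (ver (N s)) = 1) :
    2 * d2 E (liftMap X (u t, v t)) (ver (N t))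
        (ver (N' + F (liftMap X (u t, v t)) (N t) (fderiv ℝ X (u t) u')))
      + d3 E (liftMap X (u t, v t)) (ver (fderiv ℝ (fderiv ℝ X) (u t) u' (v t)
        + fderiv ℝ X (u t) v' + fderiv ℝ G (liftMap X (u t, v t)) (ver (fderiv ℝ X (u t) u'))))
        (ver (N t)) (ver (N t)) = 0 := by
  have h1 := deriv_eq_zero_of_eventually_const (hasDerivAt_metric h i hq hu hv hN hN) hn
  have h2 := h.metric_compat hq.2 (N t) (fderiv ℝ X (u t) u') (N t)
  rw [d2_comm h.smooth h.isOpen hq.2 (ver N')] at h1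
  simp at h1 h2 ⊢
  linarith

variable (n : HasNormalFields E U X O) (H : NormalCurvatureVanishes U G X O)
  (M : SecondVTensorVanishes E U X O)

include H

omit [FiniteDimensional ℝ W] in
/-- The derivative of the vanishing of the normal curvature in the direction of the fibres. -/
theorem second_add_berwald_mem_range {q : W × W} (hq : q ∈ liftDomain U X O) (a b : W) :
    fderiv ℝ (fderiv ℝ X) q.1 a b + fderiv ℝ (fderiv ℝ G) (liftMap X q)
      (ver (fderiv ℝ X q.1 b)) (ver (fderiv ℝ X q.1 a)) ∈
      LinearMap.range (fderiv ℝ X q.1 : W →ₗ[ℝ] V) := by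
  obtain ⟨q₁, q₂⟩ := q
  obtain ⟨v, rfl, hv⟩ := exists_curve q₂ b
  -- Only the supporting element moves, so the tangent space is constant along the curve.
  have hl := i.hasDerivAt_liftMap hq.1 (hasDerivAt_const (0 : ℝ) q₁) hv
  have hG := h.hasFDerivAt_fderiv_spray hq.2
  have h1 := hasDerivAt_comp_apply hG hl (hasDerivAt_const (0 : ℝ) (ver (fderiv ℝ X q₁ a)))
  have h2 := (hasDerivAt_const (0 : ℝ) (fderiv ℝ (fderiv ℝ X) q₁ a)).clm_apply hv
  have hc : ContinuousAt (fun s : ℝ => (q₁, v s)) 0 := continuousAt_const.prodMk hv.continuousAt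
  have h3 := mem_of_hasDerivAt_of_eventually_mem
    (LinearMap.range (fderiv ℝ X q₁ : W →ₗ[ℝ] V)) (h2.add h1) <| by
      filter_upwards [hc.preimage_mem_nhds ((i.isOpen_liftDomain h.isOpen).mem_nhds hq)] with s hs
      exact H _ hs a
  simpa using h3

include M n

set_option maxHeartbeats 400000 in
/-- If the normal curvature vector and the second fundamental `v`-tensor vanish, the second
fundamental `h`-tensor vanishes. -/
theorem second_add_cartan_mem_range {q : W × W} (hq : q ∈ liftDomain U X O) (a b : W) :
    fderiv ℝ (fderiv ℝ X) q.1 a b + F (liftMap X q) (fderiv ℝ X q.1 a) (fderiv ℝ X q.1 b) ∈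
      LinearMap.range (fderiv ℝ X q.1 : W →ₗ[ℝ] V) := by
  obtain ⟨N, hN0, hN⟩ := exists_isNormal_ne_zero (E := E) i (q := q)
  refine hN.mem_range h i hq hN0 ?_
  have s := h.smooth
  have o := h.isOpen
  obtain ⟨Nf, hNf, hNn, rfl⟩ := n q hq N hN
  -- The direction of the spray is tangential.
  obtain ⟨w, hw⟩ : ∃ w, fderiv ℝ (fderiv ℝ X) q.1 q.2 q.2 + fderiv ℝ X q.1 w
      = - (2 : ℝ) • G (liftMap X q) := by
    obtain ⟨c, hc⟩ := H q hq q.2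
    refine ⟨-c, ?_⟩
    have h1 := h.fderiv_spray_self hq.2
    have hc' : fderiv ℝ X q.1 c = _ := hc
    rw [sndTS_liftMap] at h1
    rw [map_neg, hc', h1]
    module
  obtain ⟨q₁, q₂⟩ := q
  obtain ⟨u, hu0, hu⟩ := exists_curve q₁ q₂
  obtain ⟨v, hv0, hv⟩ := exists_curve q₂ w
  subst hu0 hv0
  dsimp only at hw ⊢
  have hqd := hu.prodMk hv
  have hev : ∀ᶠ s in 𝓝 (0 : ℝ), (u s, v s) ∈ liftDomain U X O :=
    hqd.continuousAt.preimage_mem_nhds ((i.isOpen_liftDomain o).mem_nhds hq)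
  have hev' : ∀ᶠ s in 𝓝 (0 : ℝ), IsNormal E X (u s, v s) (Nf (u s, v s)) :=
    hqd.continuousAt.eventually (p := fun r => IsNormal E X r (Nf r)) hNn
  obtain ⟨N', hNd⟩ : ∃ N', HasDerivAt (fun s : ℝ => Nf (u s, v s)) N' 0 :=
    ⟨_, (hNf.differentiableAt (by simp)).hasFDerivAt.comp_hasDerivAt (0 : ℝ) hqd⟩
  have hB (d : W) := (i.hasDerivAt_fderiv_comp hq.1 hu).clm_apply (hasDerivAt_const (0 : ℝ) d)
  have hl := i.hasDerivAt_liftMap hq.1 hu hv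
  -- Along the spray, `H = 0` says that the derivative of `B d` is `-G(B d)` up to a tangential
  -- vector.
  have ht (d : W) : ∃ e, fderiv ℝ (fderiv ℝ X) (u 0) (v 0) d
      = fderiv ℝ X (u 0) e - fderiv ℝ G (liftMap X (u 0, v 0)) (ver (fderiv ℝ X (u 0) d)) := by
    obtain ⟨e, he⟩ := H _ hq d
    refine ⟨e, ?_⟩
    have he' : fderiv ℝ X (u 0) e = _ := he
    rw [he', i.second_comm hq.1]
    abel
  have hy := sndTS_liftMap X (u 0, v 0)
  -- The covariant derivative along the spray of a normal field is again normal, since metric and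
  -- tangent spaces are preserved.
  have hperp : IsNormal E X (u 0, v 0)
      (N' + fderiv ℝ G (liftMap X (u 0, v 0)) (ver (Nf (u 0, v 0)))) := by
    intro d
    have h1 := deriv_eq_zero_of_eventually_const (hasDerivAt_metric h i hq hu hv hNd (hB d))
      (hev'.mono fun s hs => hs d)
    have h2 := h.metric_compat_spray hq.2 (Nf (u 0, v 0)) (fderiv ℝ X (u 0) d)
    obtain ⟨e, he⟩ := ht d
    have h3 := hN e
    rw [d2_comm s o hq.2] at h2
    rw [hy] at h2
    simp [hw, he] at h1 h2 ⊢
    linarith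
  have hd3 := hasFDerivAt_d3 s o hq.2
  have hcN := ver.hasFDerivAt.comp_hasDerivAt (0 : ℝ) hNd
  have hca := ver.hasFDerivAt.comp_hasDerivAt (0 : ℝ) (hB a)
  have hcb := ver.hasFDerivAt.comp_hasDerivAt (0 : ℝ) (hB b)
  -- Differentiate `M = 0` along the spray. By `hperp` and `ht` the derivatives of the three
  -- arguments can be replaced by `-G` of them, because the remainders are annihilated by `M = 0`.
  -- What is left is the right-hand side of `berwald_sub_cartan`.
  have h4 := hasDerivAt_comp_apply₃ hd3 hl hcN hca hcb
  have h5 := deriv_eq_zero_of_eventually_const h4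
    ((hev.and hev').mono fun s hs => M _ hs.1 _ hs.2 a b)
  obtain ⟨ea, hea⟩ := ht a
  obtain ⟨eb, heb⟩ := ht b
  have h6 := M _ hq _ hperp a b
  have h7 := M _ hq _ hN ea b
  have h8 := M _ hq _ hN a eb
  have h9 := h.berwald_sub_cartan hq.2 (Nf (u 0, v 0)) (fderiv ℝ X (u 0) a) (fderiv ℝ X (u 0) b)
  obtain ⟨c, hc⟩ := second_add_berwald_mem_range h i H hq b a
  have h10 := hN c
  have hc' : fderiv ℝ X (u 0) c = _ := hc
  rw [hc', i.second_comm hq.1] at h10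
  rw [hy] at h9
  simp [hw, hea, heb] at h5 h6 h7 h8 h9 h10 ⊢
  linarith

/-- If the normal curvature vector and the second fundamental `v`-tensor vanish, a unit normal
vector field is parallel along every curve. -/
theorem normal_parallel {u v : ℝ → W} {N : ℝ → V} {t : ℝ} {u' v' : W} {N' Z : V}
    (hq : (u t, v t) ∈ liftDomain U X O) (hu : HasDerivAt u u' t) (hv : HasDerivAt v v' t)
    (hN : HasDerivAt N N' t)
    (hn : ∀ᶠ s in 𝓝 t, IsNormal E X (u s, v s) (N s) ∧
      d2 E (liftMap X (u s, v s)) (ver (N s)) (ver (N s)) = 1)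
    (hZ : ∀ a, 2 * d2 E (liftMap X (u t, v t)) (ver a) (ver Z) =
      d3 E (liftMap X (u t, v t)) (ver a) (ver (N t)) (ver (fderiv ℝ (fderiv ℝ X) (u t) u' (v t)
        + fderiv ℝ X (u t) v' + fderiv ℝ G (liftMap X (u t, v t)) (ver (fderiv ℝ X (u t) u'))))) :
    N' + F (liftMap X (u t, v t)) (N t) (fderiv ℝ X (u t) u') + Z = 0 := by
  have s := h.smooth
  have o := h.isOpen
  have hnt := hn.self_of_nhds
  have hN0 : N t ≠ 0 := fun h0 => by simpa [h0] using hnt.2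
  set p := liftMap X (u t, v t) with hp
  set Y := fderiv ℝ (fderiv ℝ X) (u t) u' (v t)
    + fderiv ℝ X (u t) v' + fderiv ℝ G p (ver (fderiv ℝ X (u t) u')) with hY
  obtain ⟨y, hy⟩ : ∃ y, fderiv ℝ X (u t) y = Y := by
    obtain ⟨c, hc⟩ := H _ hq u'
    have hc' : fderiv ℝ X (u t) c = _ := hc
    exact ⟨c + v', by rw [map_add, hc', hY]; abel⟩
  have hNN := unit_deriv (F := F) h i hq hu hv hN (hn.mono fun _ hs => hs.2)
  rw [← hp, ← hY] at hNN
  -- The tangential component: the second fundamental `h`-tensor vanishes, and both Cartan terms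
  -- vanish because `Y` is tangential and `M = 0`.
  have htan : ∀ d, d2 E p (ver (N' + F p (N t) (fderiv ℝ X (u t) u') + Z))
      (ver (fderiv ℝ X (u t) d)) = 0 := by
    intro d
    have h1 := normal_deriv (F := F) h i hq hu hv hN (hn.mono fun _ hs => hs.1) d
    rw [← hp, ← hY] at h1
    obtain ⟨c, hc⟩ := second_add_cartan_mem_range h i n H M hq u' d
    have hc' : fderiv ℝ X (u t) c = _ := hc
    have h2 := hnt.1 c
    simp only [hc'] at h2
    rw [h.cartan_symm hq.2] at h2
    have h3 := M _ hq _ hnt.1 y d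
    simp only [hy] at h3
    rw [d3_comm s o hq.2] at h3
    have h4 := hZ (fderiv ℝ X (u t) d)
    rw [d3_comm_last s o hq.2, d3_comm s o hq.2, d3_comm_last s o hq.2, d2_comm s o hq.2] at h4
    simp only [← hp] at h2 h3 h4
    rw [map_add ver _ Z, map_add, add_apply]
    linarith
  -- The normal component vanishes by `hNN`, so the vector is tangential. By `htan` it is orthogonal
  -- to itself.
  by_contra hne
  obtain ⟨c, hc⟩ := hnt.1.mem_range h i hq hN0
    (t := N' + F p (N t) (fderiv ℝ X (u t) u') + Z) (by
      have h1 := hZ (N t)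
      rw [d3_comm_last s o hq.2, d3_comm s o hq.2] at h1
      simp only [← hp] at h1 ⊢
      rw [map_add ver _ Z, map_add]
      linarith)
  have hc' : fderiv ℝ X (u t) c = _ := hc
  have h1 := htan c
  rw [hc'] at h1
  exact (h.posDef _ hq.2 _ hne).ne' h1

end Curves

end Hypersurfaces

/-! ### Necessary conditions for parallel normals, and comparison of two metrics. -/

section Hypersurfaces

variable {V : Type*} [NormedAddCommGroup V] [NormedSpace ℝ V]
  {W : Type*} [NormedAddCommGroup W] [NormedSpace ℝ W]
  {E : TS V → ℝ} {U : Set (TS V)} {G : TS V → V} {F : TS V → V → V → V}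
  {X : W → V} {O : Set W} [FiniteDimensional ℝ V]

section Parallel

variable (h : IsCartanSpray E U G F) (i : IsImmersedHypersurface X O)

include h i

/-- Normal vectors are multiples of unit normal vectors. -/
theorem exists_unit_isNormal {q : W × W} (hq : q ∈ liftDomain U X O) [FiniteDimensional ℝ W] :
    ∃ N, IsNormal E X q N ∧ d2 E (liftMap X q) (ver N) (ver N) = 1 := by
  obtain ⟨N, hN0, hN⟩ := exists_isNormal_ne_zero (E := E) i (q := q)
  have hpos := h.posDef _ hq.2 N hN0
  set c := d2 E (liftMap X q) (ver N) (ver N)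
  refine ⟨(√c)⁻¹ • N, fun a => by simp [hN a], ?_⟩
  have : √c * √c = c := Real.mul_self_sqrt hpos.le
  have h0 : √c ≠ 0 := (Real.sqrt_pos.2 hpos).ne'
  simp only [map_smul, smul_apply, smul_eq_mul]
  change (√c)⁻¹ * ((√c)⁻¹ * c) = 1
  field_simp
  rw [sq, this]

omit [FiniteDimensional ℝ V] in
/-- A unit normal vector extends to a unit normal field along some curve in every direction. -/
theorem exists_unit_normal_curve (n : HasNormalFields E U X O) {q : W × W}
    (hq : q ∈ liftDomain U X O) {N : V} (hN : IsNormal E X q N)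
    (hN1 : d2 E (liftMap X q) (ver N) (ver N) = 1) (a c : W) :
    ∃ (u v : ℝ → W) (Nc : ℝ → V), (u 0, v 0) = q ∧ Nc 0 = N ∧ HasDerivAt u a 0 ∧
      HasDerivAt v c 0 ∧ ∀ᶠ s in 𝓝 (0 : ℝ), (u s, v s) ∈ liftDomain U X O ∧
        IsNormal E X (u s, v s) (Nc s) ∧
        d2 E (liftMap X (u s, v s)) (ver (Nc s)) (ver (Nc s)) = 1 ∧
        DifferentiableAt ℝ u s ∧ DifferentiableAt ℝ v s ∧ DifferentiableAt ℝ Nc s := by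
  obtain ⟨Nf, hNf, hNn, rfl⟩ := n q hq N hN
  obtain ⟨q₁, q₂⟩ := q
  let u : ℝ → W := fun s => q₁ + s • a
  let v : ℝ → W := fun s => q₂ + s • c
  have hu (s : ℝ) : HasDerivAt u a s := by
    simpa [u] using ((hasDerivAt_id s).smul_const a).const_add q₁
  have hv (s : ℝ) : HasDerivAt v c s := by
    simpa [v] using ((hasDerivAt_id s).smul_const c).const_add q₂
  have hq0 : (u 0, v 0) = (q₁, q₂) := by simp [u, v]
  have hc : ContinuousAt (fun s => (u s, v s)) 0 := ((hu 0).prodMk (hv 0)).continuousAt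
  let k : ℝ → ℝ := fun s => d2 E (liftMap X (u s, v s)) (ver (Nf (u s, v s)))
    (ver (Nf (u s, v s)))
  have hd : ∀ᶠ s in 𝓝 (0 : ℝ), (u s, v s) ∈ liftDomain U X O :=
    hc.preimage_mem_nhds ((i.isOpen_liftDomain h.isOpen).mem_nhds (by rwa [hq0]))
  have hn : ∀ᶠ s in 𝓝 (0 : ℝ), IsNormal E X (u s, v s) (Nf (u s, v s)) := by
    have hNn' : ∀ᶠ r in 𝓝 (u 0, v 0), IsNormal E X r (Nf r) := by rwa [hq0]
    exact hc.eventually (p := fun r => IsNormal E X r (Nf r)) hNn'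
  have hdN : ∀ᶠ s in 𝓝 (0 : ℝ), DifferentiableAt ℝ Nf (u s, v s) := by
    have h1 : ∀ᶠ r in 𝓝 (u 0, v 0), DifferentiableAt ℝ Nf r := by
      rw [hq0]
      filter_upwards [(hNf.of_le (m := 1) (by simp)).eventually (by simp)] with r hr
      exact hr.differentiableAt (by simp)
    exact hc.eventually (p := fun r => DifferentiableAt ℝ Nf r) h1
  have hk : ∀ᶠ s in 𝓝 (0 : ℝ), DifferentiableAt ℝ k s := by
    filter_upwards [hd, hdN] with s hs hs'
    have hNs := hs'.hasFDerivAt.comp_hasDerivAt s ((hu s).prodMk (hv s))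
    exact (hasDerivAt_metric h i hs (hu s) (hv s) hNs hNs).differentiableAt
  have hk0 : k 0 = 1 := by
    change d2 E (liftMap X (u 0, v 0)) (ver (Nf (u 0, v 0))) (ver (Nf (u 0, v 0))) = 1
    rwa [hq0]
  have hkpos : ∀ᶠ s in 𝓝 (0 : ℝ), 0 < k s :=
    hk.self_of_nhds.continuousAt.eventually (lt_mem_nhds (by rw [hk0]; exact one_pos))
  refine ⟨u, v, fun s => (√(k s))⁻¹ • Nf (u s, v s), hq0, by simp [hk0, hq0], hu 0, hv 0, ?_⟩
  filter_upwards [hd, hn, hdN, hk, hkpos] with s h1 h2 h3 h4 h5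
  refine ⟨h1, fun d => by simp [h2 d], ?_, (hu s).differentiableAt, (hv s).differentiableAt, ?_⟩
  · have : √(k s) * √(k s) = k s := Real.mul_self_sqrt h5.le
    have h0 : √(k s) ≠ 0 := (Real.sqrt_pos.2 h5).ne'
    simp only [map_smul, smul_apply, smul_eq_mul]
    change (√(k s))⁻¹ * ((√(k s))⁻¹ * k s) = 1
    field_simp
    rw [sq, this]
  · have hNs := (h3.hasFDerivAt.comp_hasDerivAt s ((hu s).prodMk (hv s))).differentiableAt
    exact ((h4.sqrt h5.ne').inv (Real.sqrt_pos.2 h5).ne').smul hNs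

/-- If unit normal vectors are parallel along curves in every direction, the normal curvature
vector and the second fundamental `v`-tensor vanish. -/
theorem curvature_vanishes_of_parallel [FiniteDimensional ℝ W]
    (hpar : ∀ q ∈ liftDomain U X O, ∀ N, IsNormal E X q N →
      d2 E (liftMap X q) (ver N) (ver N) = 1 → ∀ a c, ∃ (u v : ℝ → W) (Nc : ℝ → V) (N' Z : V),
        (u 0, v 0) = q ∧ Nc 0 = N ∧ HasDerivAt u a 0 ∧ HasDerivAt v c 0 ∧ HasDerivAt Nc N' 0 ∧
        (∀ᶠ s in 𝓝 (0 : ℝ), IsNormal E X (u s, v s) (Nc s)) ∧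
        (∀ d, 2 * d2 E (liftMap X q) (ver d) (ver Z) =
          d3 E (liftMap X q) (ver d) (ver N) (ver (fderiv ℝ (fderiv ℝ X) q.1 a q.2
            + fderiv ℝ X q.1 c + fderiv ℝ G (liftMap X q) (ver (fderiv ℝ X q.1 a))))) ∧
        N' + F (liftMap X q) N (fderiv ℝ X q.1 a) + Z = 0) :
    NormalCurvatureVanishes U G X O ∧ SecondVTensorVanishes E U X O := by
  have s := h.smooth
  have o := h.isOpen
  -- Pair the equation of parallelism with a tangent vector. The vector `Z` carries half of the
  -- Cartan term in `normal_deriv`, so the other half survives.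
  have key : ∀ q ∈ liftDomain U X O, ∀ N, IsNormal E X q N →
      d2 E (liftMap X q) (ver N) (ver N) = 1 → ∀ a c d,
      2 * d2 E (liftMap X q) (ver N) (ver (fderiv ℝ (fderiv ℝ X) q.1 a d
        + F (liftMap X q) (fderiv ℝ X q.1 d) (fderiv ℝ X q.1 a)))
      + d3 E (liftMap X q) (ver (fderiv ℝ (fderiv ℝ X) q.1 a q.2
        + fderiv ℝ X q.1 c + fderiv ℝ G (liftMap X q) (ver (fderiv ℝ X q.1 a))))
        (ver N) (ver (fderiv ℝ X q.1 d)) = 0 := by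
    intro q hq N hN hN1 a c d
    obtain ⟨u, v, Nc, N', Z, rfl, rfl, hu, hv, hNc, hn, hZ, hp⟩ := hpar q hq N hN hN1 a c
    have h1 := normal_deriv (F := F) h i hq hu hv hNc hn d
    have h2 := hZ (fderiv ℝ X (u 0) d)
    rw [d3_comm_last s o hq.2, d3_comm s o hq.2, d3_comm_last s o hq.2, d2_comm s o hq.2] at h2
    rw [eq_neg_of_add_eq_zero_left hp, map_neg, map_neg, neg_apply] at h1
    dsimp only at h1 h2 ⊢
    linarith
  have M : SecondVTensorVanishes E U X O := by
    intro q hq N hN a b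
    obtain ⟨N₁, hN₁, hN₁1⟩ := exists_unit_isNormal h i hq
    have hN0 : N₁ ≠ 0 := fun h0 => by simp [h0] at hN₁1
    obtain ⟨c, rfl⟩ := hN₁.exists_smul_eq h i hq hN0 hN
    have h1 := key q hq N₁ hN₁ hN₁1 0 a b
    -- A purely vertical curve isolates `M`. Since `F` is not assumed linear, its value at a zero
    -- argument is removed by the instance with zero fibre velocity.
    have h2 := key q hq N₁ hN₁ hN₁1 0 0 b
    rw [d3_comm s o hq.2]
    simp at h1 h2 ⊢
    right
    linarith
  refine ⟨fun q hq a => ?_, M⟩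
  obtain ⟨N, hN, hN1⟩ := exists_unit_isNormal h i hq
  have hN0 : N ≠ 0 := fun h0 => by simp [h0] at hN1
  refine hN.mem_range h i hq hN0 ?_
  -- With the supporting element as tangent vector, the Cartan tensor drops out and `F(y, ·) = G`,
  -- which leaves the normal curvature.
  have h1 := key q hq N hN hN1 a 0 q.2
  rw [← sndTS_liftMap, h.d3_ver_ver_self hq.2, sndTS_liftMap, ← sndTS_liftMap,
    h.cartan_self hq.2] at h1
  linarith

end Parallel

section Transfer

variable {E' : TS V → ℝ} {G' : TS V → V} {F' : TS V → V → V → V}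
  (h : IsCartanSpray E U G F) (h' : IsCartanSpray E' U G' F')
  (i : IsImmersedHypersurface X O)

include h h' i

/-- If the difference of two sprays is tangential, the normal curvature vectors vanish
simultaneously. -/
theorem NormalCurvatureVanishes.transfer [FiniteDimensional ℝ W]
    (hD : ∀ q ∈ liftDomain U X O, ∀ N, IsNormal E X q N →
      d2 E (liftMap X q) (ver N) (ver (G' (liftMap X q) - G (liftMap X q))) = 0)
    (H : NormalCurvatureVanishes U G X O) : NormalCurvatureVanishes U G' X O := by
  have hR : ∀ q ∈ liftDomain U X O, G' (liftMap X q) - G (liftMap X q) ∈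
      LinearMap.range (fderiv ℝ X q.1 : W →ₗ[ℝ] V) := by
    intro q hq
    obtain ⟨N, hN0, hN⟩ := exists_isNormal_ne_zero (E := E) i (q := q)
    exact hN.mem_range h i hq hN0 (hD q hq N hN)
  rintro ⟨q₁, q₂⟩ hq a
  obtain ⟨v, rfl, hv⟩ := exists_curve q₂ a
  have hl := i.hasDerivAt_liftMap hq.1 (hasDerivAt_const (0 : ℝ) q₁) hv
  have h1 := ((h'.hasFDerivAt_spray hq.2).comp_hasDerivAt (0 : ℝ) hl).sub
    ((h.hasFDerivAt_spray hq.2).comp_hasDerivAt (0 : ℝ) hl)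
  have hc : ContinuousAt (fun s : ℝ => (q₁, v s)) 0 := continuousAt_const.prodMk hv.continuousAt
  have h2 := mem_of_hasDerivAt_of_eventually_mem
    (LinearMap.range (fderiv ℝ X q₁ : W →ₗ[ℝ] V)) h1 <| by
      filter_upwards [hc.preimage_mem_nhds ((i.isOpen_liftDomain h.isOpen).mem_nhds hq)] with s hs
      exact hR _ hs
  -- The fibre derivative of `G' - G` is `G'_a - G_a`, which is the change of the curvature vector.
  have h3 := Submodule.add_mem _ (H _ hq a) h2
  simpa using h3

/-- If two metrics have the same normal vectors, their second fundamental `v`-tensors vanish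
simultaneously. -/
theorem SecondVTensorVanishes.transfer [FiniteDimensional ℝ W] (n : HasNormalFields E U X O)
    (hn : ∀ q ∈ liftDomain U X O, ∀ N, IsNormal E X q N → IsNormal E' X q N)
    (M : SecondVTensorVanishes E U X O) : SecondVTensorVanishes E' U X O := by
  intro q hq N hN' a b
  have s := h.smooth
  have o := h.isOpen
  obtain ⟨N₁, hN₁0, hN₁⟩ := exists_isNormal_ne_zero (E := E) i (q := q)
  obtain ⟨c, rfl⟩ := (hn q hq _ hN₁).exists_smul_eq h' i hq hN₁0 hN'
  obtain ⟨Nf, hNf, hNn, rfl⟩ := n q hq N₁ hN₁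
  obtain ⟨q₁, q₂⟩ := q
  obtain ⟨v, rfl, hv⟩ := exists_curve q₂ a
  have hu := hasDerivAt_const (0 : ℝ) q₁
  have hqd := hu.prodMk hv
  have hev : ∀ᶠ s in 𝓝 (0 : ℝ), (q₁, v s) ∈ liftDomain U X O :=
    hqd.continuousAt.preimage_mem_nhds ((i.isOpen_liftDomain o).mem_nhds hq)
  have hev' : ∀ᶠ s in 𝓝 (0 : ℝ), IsNormal E X (q₁, v s) (Nf (q₁, v s)) :=
    hqd.continuousAt.eventually (p := fun r => IsNormal E X r (Nf r)) hNn
  obtain ⟨N', hNd⟩ : ∃ N', HasDerivAt (fun s : ℝ => Nf (q₁, v s)) N' 0 :=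
    ⟨_, (hNf.differentiableAt (by simp)).hasFDerivAt.comp_hasDerivAt (0 : ℝ) hqd⟩
  have hd (d : W) := deriv_eq_zero_of_eventually_const
    (hasDerivAt_metric h i hq hu hv hNd (hasDerivAt_const (0 : ℝ) (fderiv ℝ X q₁ d)))
    (hev'.mono fun s hs => hs d)
  have hd' := deriv_eq_zero_of_eventually_const
    (hasDerivAt_metric h' i hq hu hv hNd (hasDerivAt_const (0 : ℝ) (fderiv ℝ X q₁ b)))
    ((hev.and hev').mono fun s hs => hn _ hs.1 _ hs.2 b)
  -- Differentiating `g(N, B d) = 0` along the fibre gives `g(N', B d) = 0` because `M = 0`. So `N'`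
  -- is also normal for `E'`, and the same differentiation with `E'` leaves only its Cartan term.
  have hperp : IsNormal E X (q₁, v 0) N' := by
    intro d
    have h1 := hd d
    have h2 := M _ hq _ hN₁ a d
    rw [d3_comm s o hq.2] at h2
    simp at h1 h2 ⊢
    linarith
  have h3 := hn _ hq _ hperp b
  rw [d3_comm h'.smooth o hq.2]
  simp at hd' h3 ⊢
  right
  linarith

end Transfer

end Hypersurfaces

/-! ### The Kropina change in normal directions. -/

section Kropina

variable {V : Type*} [NormedAddCommGroup V] [NormedSpace ℝ V] {U : Set (TS V)}

theorem d1_congr {f g : TS V → ℝ} (hU : IsOpen U) (hfg : ∀ p ∈ U, f p = g p) {p : TS V}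
    (hp : p ∈ U) : d1 f p = d1 g p :=
  Filter.EventuallyEq.fderiv_eq (eventually_of_mem (hU.mem_nhds hp) hfg)

theorem d2_congr {f g : TS V → ℝ} (hU : IsOpen U) (hfg : ∀ p ∈ U, f p = g p) {p : TS V}
    (hp : p ∈ U) : d2 f p = d2 g p :=
  Filter.EventuallyEq.fderiv_eq
    (eventually_of_mem (hU.mem_nhds hp) fun _ hq => d1_congr hU hfg hq)

section Product

variable {f g : TS V → ℝ} (hU : IsOpen U) (hf : ContDiffOn ℝ ∞ f U) (hg : ContDiffOn ℝ ∞ g U)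

include hU hf hg

theorem d1_mul {p : TS V} (hp : p ∈ U) (ξ : TS V) :
    d1 (fun q => f q * g q) p ξ = d1 f p ξ * g p + f p * d1 g p ξ := by
  have h1 := (hasFDerivAt_d0 hf hU hp).mul (hasFDerivAt_d0 hg hU hp)
  have h2 : d1 (fun q => f q * g q) p = _ := h1.fderiv
  rw [h2]
  simp
  ring

theorem d2_mul {p : TS V} (hp : p ∈ U) (ξ η : TS V) :
    d2 (fun q => f q * g q) p ξ η =
      d2 f p ξ η * g p + d1 f p η * d1 g p ξ + d1 f p ξ * d1 g p η + f p * d2 g p ξ η := by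
  have k := (hasFDerivAt_d1 (hf.mul hg) hU hp).clm_apply (hasFDerivAt_const η p)
  have h1 := (((hasFDerivAt_d1 hf hU hp).clm_apply (hasFDerivAt_const η p)).mul
    (hasFDerivAt_d0 hg hU hp)).add ((hasFDerivAt_d0 hf hU hp).mul
    ((hasFDerivAt_d1 hg hU hp).clm_apply (hasFDerivAt_const η p)))
  have := DFunLike.congr_fun (fderiv_unique_of_eqOn hU hp k h1 fun q hq => d1_mul hU hf hg hq η) ξ
  simp at this
  change d2 (fun q => f q * g q) p ξ η = _ at this
  rw [this]
  ring

end Product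

section Energy

variable {f E : TS V → ℝ} (hU : IsOpen U) (hf : ContDiffOn ℝ ∞ f U)
  (hE : ∀ p ∈ U, E p + E p = f p * f p)

include hU hf hE

theorem d1_energy {p : TS V} (hp : p ∈ U) (ξ : TS V) : d1 E p ξ = f p * d1 f p ξ := by
  have hE' : ∀ p ∈ U, E p = (fun _ => (1 / 2 : ℝ)) p * (f p * f p) := fun p hp => by
    rw [← hE p hp]; ring
  rw [d1_congr hU hE' hp, d1_mul hU contDiffOn_const (hf.mul hf) hp]
  have h0 : d1 (fun _ : TS V => (1 / 2 : ℝ)) p = 0 := (hasFDerivAt_const _ p).fderiv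
  rw [h0]
  change _ + 1 / 2 * d1 (fun q => f q * f q) p ξ = _
  rw [d1_mul hU hf hf hp]
  simp
  ring

theorem d2_energy {p : TS V} (hp : p ∈ U) (ξ η : TS V) :
    d2 E p ξ η = d1 f p ξ * d1 f p η + f p * d2 f p ξ η := by
  have k1 : ContDiffOn ℝ ∞ E U := by
    refine ((hf.mul hf).const_smul (1 / 2 : ℝ)).congr fun p hp => ?_
    simp only [smul_eq_mul]
    have := hE p hp
    linarith
  have k := (hasFDerivAt_d1 k1 hU hp).clm_apply (hasFDerivAt_const η p)
  have h1 := (hasFDerivAt_d0 hf hU hp).mul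
    ((hasFDerivAt_d1 hf hU hp).clm_apply (hasFDerivAt_const η p))
  have := DFunLike.congr_fun (fderiv_unique_of_eqOn hU hp k h1
    fun q hq => d1_energy hU hf hE hq η) ξ
  simp at this
  rw [this]
  ring

end Energy

variable {W : Type*} [NormedAddCommGroup W] [NormedSpace ℝ W]
  {ℓ β r K E E' : TS V → ℝ} {G G' : TS V → V} {F F' : TS V → V → V → V}
  {X : W → V} {O : Set W}

/-- The second derivatives of `K = ℓ² / β` in the direction of a vector that is tangential to the
level sets of `ℓ` and `β`. -/
theorem d2_kropina (hU : IsOpen U) (hℓ : ContDiffOn ℝ ∞ ℓ U) (hβ : ContDiffOn ℝ ∞ β U)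
    (hK : ContDiffOn ℝ ∞ K U) (hKβ : ∀ p ∈ U, K p * β p = ℓ p * ℓ p) {p : TS V} (hp : p ∈ U)
    (hβ0 : β p ≠ 0) {η : TS V} (h1 : d1 ℓ p η = 0) (h2 : d1 β p η = 0) :
    d1 K p η = 0 ∧ ∀ ξ, d2 K p ξ η * β p = 2 * ℓ p * d2 ℓ p ξ η - K p * d2 β p ξ η := by
  have e1 : d1 K p η = 0 := by
    have := DFunLike.congr_fun (d1_congr hU hKβ hp) η
    rw [d1_mul hU hK hβ hp, d1_mul hU hℓ hℓ hp, h1, h2] at this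
    simpa [hβ0] using this
  refine ⟨e1, fun ξ => ?_⟩
  have := DFunLike.congr_fun (DFunLike.congr_fun (d2_congr hU hKβ hp) ξ) η
  rw [d2_mul hU hK hβ hp, d2_mul hU hℓ hℓ hp, h1, h2, e1] at this
  linarith

/-- The Kropina change `K = ℓ² / β` does not change the normal vectors of a hypersurface to which
`β` is tangential, and it changes the spray in tangential directions only, provided that
`∂̇∂̇β` is proportional to `∂̇∂̇ℓ` and `β` satisfies the Euler-Lagrange equations along the spray. -/
theorem kropina_normal (h : IsCartanSpray E U G F) (h' : IsCartanSpray E' U G' F')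
    (hℓ : ContDiffOn ℝ ∞ ℓ U) (hβ : ContDiffOn ℝ ∞ β U) (hK : ContDiffOn ℝ ∞ K U)
    (hℓ0 : ∀ p ∈ U, 0 < ℓ p) (hβ0 : ∀ p ∈ U, 0 < β p) (hKβ : ∀ p ∈ U, K p * β p = ℓ p * ℓ p)
    (hE : ∀ p ∈ U, E p + E p = ℓ p * ℓ p) (hE' : ∀ p ∈ U, E' p + E' p = K p * K p)
    (hr : ∀ p ∈ U, ∀ a c, d2 β p (ver a) (ver c) = r p * d2 ℓ p (ver a) (ver c))
    (hEL : ∀ p ∈ U, ∀ a, 2 * d2 β p (ver a) (ver (G p)) =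
      d2 β p (hor (sndTS V p)) (ver a) - d1 β p (hor a))
    {q : W × W} (hq : q ∈ liftDomain U X O) {N : V} (hN : IsNormal E X q N)
    (hβN : d1 β (liftMap X q) (ver N) = 0) :
    IsNormal E' X q N ∧
      d2 E (liftMap X q) (ver N) (ver (G' (liftMap X q) - G (liftMap X q))) = 0 := by
  have o := h.isOpen
  set p := liftMap X q with hpdef
  have hp : p ∈ U := hq.2
  -- The supporting element is tangential, and `g(y, N) = ℓ ∂̇ℓ(N)`.
  have hℓN : d1 ℓ p (ver N) = 0 := by
    have h1 := hN q.2
    rw [← hpdef, ← sndTS_liftMap, ← hpdef, h.d2_ver_ver_self hp, d1_energy o hℓ hE hp] at h1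
    exact (mul_eq_zero.1 h1).resolve_left (hℓ0 p hp).ne'
  obtain ⟨hKN, hK2⟩ := d2_kropina o hℓ hβ hK hKβ hp (hβ0 p hp).ne' hℓN hβN
  have hK0 : K p ≠ 0 := fun h0 => by
    have := hKβ p hp
    rw [h0, zero_mul] at this
    exact (mul_pos (hℓ0 p hp) (hℓ0 p hp)).ne this
  have eE (ξ : TS V) : d2 E p ξ (ver N) = ℓ p * d2 ℓ p ξ (ver N) := by
    rw [d2_energy o hℓ hE hp, hℓN]; ring
  have eE' (ξ : TS V) : d2 E' p ξ (ver N) = K p * d2 K p ξ (ver N) := by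
    rw [d2_energy o hK hE' hp, hKN]; ring
  -- The two metric tensors are proportional on pairs of which one is normal.
  have hprop (c : V) : d2 E' p (ver c) (ver N) * (β p * ℓ p) =
      K p * (2 * ℓ p - K p * r p) * d2 E p (ver c) (ver N) := by
    have h1 := hK2 (ver c)
    rw [hr p hp] at h1
    rw [eE, eE', mul_left_comm _ (β p), ← mul_assoc, ← mul_assoc]
    linear_combination K p * ℓ p * h1
  constructor
  · intro a
    have h1 := hprop (fderiv ℝ X q.1 a)
    have h2 : d2 E p (ver (fderiv ℝ X q.1 a)) (ver N) = 0 := by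
      rw [d2_comm h.smooth o hp]; exact hN a
    rw [h2, mul_zero] at h1
    rw [← hpdef, d2_comm h'.smooth o hp]
    exact (mul_eq_zero.1 h1).resolve_right (mul_pos (hβ0 p hp) (hℓ0 p hp)).ne'
  · rcases eq_or_ne N 0 with rfl | hN0
    · simp
    have s1 := h.spray_eq p hp N
    have s2 := h'.spray_eq p hp N
    have s3 := hEL p hp N
    rw [d2_comm h.smooth o hp, eE, eE, d1_energy o hℓ hE hp] at s1
    rw [d2_comm h'.smooth o hp, eE', eE', d1_energy o hK hE' hp] at s2
    rw [d2_comm hβ o hp] at s3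
    -- In the direction `N` the Euler-Lagrange equations of `E` reduce to those of `ℓ`, because
    -- `∂̇ℓ(N) = 0`; likewise for `E'` and `K` below.
    have s1' : 2 * d2 ℓ p (ver (G p)) (ver N) =
        d2 ℓ p (hor (sndTS V p)) (ver N) - d1 ℓ p (hor N) :=
      mul_left_cancel₀ (hℓ0 p hp).ne' (by linear_combination s1)
    have s2' : 2 * d2 K p (ver (G' p)) (ver N) =
        d2 K p (hor (sndTS V p)) (ver N) - d1 K p (hor N) :=
      mul_left_cancel₀ hK0 (by linear_combination s2)
    have hK1 : d1 K p (hor N) * β p + K p * d1 β p (hor N) = 2 * ℓ p * d1 ℓ p (hor N) := by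
      have := DFunLike.congr_fun (d1_congr o hKβ hp) (hor N)
      rw [d1_mul o hK hβ hp, d1_mul o hℓ hℓ hp] at this
      linear_combination this
    -- By `Kβ = ℓ²` the equations of `ℓ` and `β` along `G` combine to that of `K`. Thus `G` and `G'`
    -- satisfy the same equation in the direction `N`.
    have hKG : d2 K p (ver (G' p)) (ver N) = d2 K p (ver (G p)) (ver N) := by
      refine mul_right_cancel₀ (hβ0 p hp).ne' ?_
      have k1 := hK2 (hor (sndTS V p))
      have k2 := hK2 (ver (G p))
      linear_combination (1 / 2) * β p * s2' + (1 / 2) * k1 - (1 / 2) * hK1 - k2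
        - ℓ p * s1' + (1 / 2) * K p * s3
    have hpos := h'.posDef p hp N hN0
    -- The factor of proportionality cannot vanish, since the metric of `K` is positive on `N`.
    have hκ : K p * (2 * ℓ p - K p * r p) ≠ 0 := fun h0 => by
      have := hprop N
      rw [h0, zero_mul] at this
      exact (mul_pos hpos (mul_pos (hβ0 p hp) (hℓ0 p hp))).ne' this
    have h1 := hprop (G' p - G p)
    rw [eE', map_sub ver, map_sub, sub_apply, hKG, sub_self, mul_zero, zero_mul] at h1
    rw [d2_comm h.smooth o hp, map_sub ver]
    exact (mul_eq_zero.1 h1.symm).resolve_left hκ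

end Kropina

/-! ### Smoothness of the inverse matrix. -/

section MatrixInverse

variable {P : Type*} [NormedAddCommGroup P] [NormedSpace ℝ P] {ι : Type*} [Fintype ι]
  [DecidableEq ι] {M : P → Matrix ι ι ℝ} {U : Set P}

theorem contDiffOn_det (hM : ∀ i j, ContDiffOn ℝ ∞ (fun p => M p i j) U) :
    ContDiffOn ℝ ∞ (fun p => (M p).det) U := by
  simp only [Matrix.det_apply']
  exact ContDiffOn.sum fun σ _ => contDiffOn_const.mul (contDiffOn_prod fun i _ => hM _ _)

/-- Cramer's rule: the entries are quotients of determinants. -/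
theorem contDiffOn_matrix_inv (hM : ∀ i j, ContDiffOn ℝ ∞ (fun p => M p i j) U)
    (hU : ∀ p ∈ U, IsUnit (M p)) (i j : ι) : ContDiffOn ℝ ∞ (fun p => (M p)⁻¹ i j) U := by
  simp only [Matrix.inv_def, Ring.inverse_eq_inv', Matrix.smul_apply, smul_eq_mul,
    Matrix.adjugate_apply]
  refine ((contDiffOn_det hM).inv fun p hp => ?_).mul (contDiffOn_det fun k l => ?_)
  · exact ((Matrix.isUnit_iff_isUnit_det _).1 (hU p hp)).ne_zero
  · simp only [Matrix.updateRow_apply]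
    split_ifs
    · exact contDiffOn_const
    · exact hM k l

end MatrixInverse

/-! ### Translation of the coordinate formulas of Finsler geometry. -/

section Coordinates

variable {n : ℕ}

theorem sum_smul_basisVec (a : Vec n) : ∑ i, a i • basisVec i = a := by
  ext j
  simp [basisVec, Pi.single_apply]

theorem clm_apply_eq_sum {Q : Type*} [NormedAddCommGroup Q] [NormedSpace ℝ Q]
    (T : Vec n →L[ℝ] Q) (a : Vec n) : T a = ∑ i, a i • T (basisVec i) := by
  conv_lhs => rw [← sum_smul_basisVec a]
  simp [map_sum]

theorem clm_ext_basis {T T' : Vec n →L[ℝ] ℝ} (h : ∀ i, T (basisVec i) = T' (basisVec i)) :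
    T = T' := by
  ext a
  rw [clm_apply_eq_sum, clm_apply_eq_sum T']
  simp [h]

variable {P : Type*} [NormedAddCommGroup P] [NormedSpace ℝ P]

theorem bilin_eq_sum (T : P →L[ℝ] P →L[ℝ] ℝ) (A B : Vec n →L[ℝ] P) (a b : Vec n) :
    T (A a) (B b) = ∑ i, ∑ j, T (A (basisVec i)) (B (basisVec j)) * a i * b j := by
  rw [clm_apply_eq_sum A a, map_sum, sum_apply]
  refine Finset.sum_congr rfl fun i _ => ?_
  rw [clm_apply_eq_sum B b]
  simp only [map_smul, map_sum, smul_apply, smul_eq_mul]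
  exact Finset.sum_congr rfl fun j _ => by ring

theorem trilin_eq_sum (T : P →L[ℝ] P →L[ℝ] P →L[ℝ] ℝ) (A B C : Vec n →L[ℝ] P) (a b c : Vec n) :
    T (A a) (B b) (C c) = ∑ i, ∑ j, ∑ k,
      T (A (basisVec i)) (B (basisVec j)) (C (basisVec k)) * a i * b j * c k := by
  rw [clm_apply_eq_sum A a, map_sum, sum_apply, sum_apply]
  refine Finset.sum_congr rfl fun i _ => ?_
  rw [map_smul, smul_apply, smul_apply, bilin_eq_sum _ B C b c]
  simp only [smul_eq_mul, Finset.mul_sum]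
  exact Finset.sum_congr rfl fun j _ => Finset.sum_congr rfl fun k _ => by ring

theorem trilin_eq_sum_mid (T : P →L[ℝ] P →L[ℝ] P →L[ℝ] ℝ) (A C : Vec n →L[ℝ] P) (a c : Vec n)
    (ξ : P) : T (A a) ξ (C c) =
      ∑ i, ∑ k, T (A (basisVec i)) ξ (C (basisVec k)) * a i * c k := by
  rw [clm_apply_eq_sum A a, map_sum, sum_apply, sum_apply]
  refine Finset.sum_congr rfl fun i _ => ?_
  rw [clm_apply_eq_sum C c]
  simp only [map_smul, map_sum, smul_apply, smul_eq_mul]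
  exact Finset.sum_congr rfl fun j _ => by ring

variable (V : Type*) [NormedAddCommGroup V] [NormedSpace ℝ V] in
/-- The projection `(x, y) ↦ x`. -/
def fstTS : TS V →L[ℝ] V := (ContinuousLinearMap.fst ℝ V V).comp
  (toTS V).symm.toContinuousLinearEquiv.toContinuousLinearMap

section

variable {V : Type*} [NormedAddCommGroup V] [NormedSpace ℝ V]

@[simp] theorem fstTS_hor (a : V) : fstTS V (hor a) = a := rfl
@[simp] theorem fstTS_ver (a : V) : fstTS V (ver a) = 0 := rfl

theorem hor_add_ver (p : TS V) : hor (fstTS V p) + ver (sndTS V p) = p :=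
  Prod.ext (add_zero _) (zero_add _)

/-- A function of `(x, y)` as a function on `TS V`. -/
def unc {R : Type*} (f : V → V → R) (p : TS V) : R := f (fstTS V p) (sndTS V p)

end

variable {U : Set (TS (Vec n))}

theorem dX_eq {f : Vec n → Vec n → ℝ} {p : TS (Vec n)} (hf : HasFDerivAt (unc f) (d1 (unc f) p) p)
    (i : Fin n) : dX i f (fstTS _ p) (sndTS _ p) = d1 (unc f) p (hor (basisVec i)) := by
  have h1 : HasFDerivAt (fun x' => hor x' + ver (sndTS _ p)) hor (fstTS _ p) :=
    hor.hasFDerivAt.add_const _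
  have hf' : HasFDerivAt (unc f) (d1 (unc f) p) (hor (fstTS _ p) + ver (sndTS _ p)) := by
    rwa [hor_add_ver]
  have h2 := hf'.comp (fstTS _ p) h1
  have h3 : unc f ∘ (fun x' => hor x' + ver (sndTS _ p)) = fun x' => f x' (sndTS _ p) := by
    ext x'; simp [unc]
  rw [h3] at h2
  rw [dX, h2.fderiv]; rfl

theorem dY_eq {f : Vec n → Vec n → ℝ} {p : TS (Vec n)} (hf : HasFDerivAt (unc f) (d1 (unc f) p) p)
    (i : Fin n) : dY i f (fstTS _ p) (sndTS _ p) = d1 (unc f) p (ver (basisVec i)) := by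
  have h1 : HasFDerivAt (fun y' => hor (fstTS _ p) + ver y') ver (sndTS _ p) :=
    ver.hasFDerivAt.const_add _
  have hf' : HasFDerivAt (unc f) (d1 (unc f) p) (hor (fstTS _ p) + ver (sndTS _ p)) := by
    rwa [hor_add_ver]
  have h2 := hf'.comp (sndTS _ p) h1
  have h3 : unc f ∘ (fun y' => hor (fstTS _ p) + ver y') = fun y' => f (fstTS _ p) y' := by
    ext x'; simp [unc]
  rw [h3] at h2
  rw [dY, h2.fderiv]; rfl

theorem contDiffOn_dX {f : Vec n → Vec n → ℝ} (hU : IsOpen U) (hf : ContDiffOn ℝ ∞ (unc f) U)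
    (i : Fin n) : ContDiffOn ℝ ∞ (unc (dX i f)) U :=
  ((contDiffOn_d1 hf hU).clm_apply contDiffOn_const).congr
    fun _ hp => dX_eq (hasFDerivAt_d0 hf hU hp) i

theorem contDiffOn_dY {f : Vec n → Vec n → ℝ} (hU : IsOpen U) (hf : ContDiffOn ℝ ∞ (unc f) U)
    (i : Fin n) : ContDiffOn ℝ ∞ (unc (dY i f)) U :=
  ((contDiffOn_d1 hf hU).clm_apply contDiffOn_const).congr
    fun _ hp => dY_eq (hasFDerivAt_d0 hf hU hp) i

theorem d1_dY {f : Vec n → Vec n → ℝ} (hU : IsOpen U) (hf : ContDiffOn ℝ ∞ (unc f) U)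
    {p : TS (Vec n)} (hp : p ∈ U) (i : Fin n) (ξ : TS (Vec n)) :
    d1 (unc (dY i f)) p ξ = d2 (unc f) p ξ (ver (basisVec i)) := by
  have h1 := (hasFDerivAt_d1 hf hU hp).clm_apply (hasFDerivAt_const (ver (basisVec i)) p)
  have := DFunLike.congr_fun (fderiv_unique_of_eqOn hU hp
    (hasFDerivAt_d0 (contDiffOn_dY hU hf i) hU hp) h1
    fun q hq => dY_eq (hasFDerivAt_d0 hf hU hq) i) ξ
  simpa using this

/-- The energy `L² / 2`. -/
def energy (L : Vec n → Vec n → ℝ) (p : TS (Vec n)) : ℝ := (1 / 2 : ℝ) * unc L p ^ 2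

/-- The spray as a vector field. -/
def sprayVec (L : Vec n → Vec n → ℝ) (p : TS (Vec n)) : Vec n :=
  WithLp.toLp 2 fun i => spray L i (fstTS _ p) (sndTS _ p)

/-- The horizontal coefficients of the Cartan connection as a bilinear map. -/
def cartanVec (L : Vec n → Vec n → ℝ) (p : TS (Vec n)) (b c : Vec n) : Vec n :=
  WithLp.toLp 2 fun i => ∑ j, ∑ k, cartanF L i j k (fstTS _ p) (sndTS _ p) * b j * c k

/-- A Finsler metric function in a coordinate system. -/
structure IsFinslerCoord (L : Vec n → Vec n → ℝ) (U : Set (TS (Vec n))) : Prop where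
  isOpen : IsOpen U
  smooth : ContDiffOn ℝ ∞ (unc L) U
  homog : ∀ p ∈ U, d1 (unc L) p (ver (sndTS _ p)) = unc L p
  posDef : ∀ p ∈ U, (metric L (fstTS _ p) (sndTS _ p)).PosDef

theorem energy_add_energy (L : Vec n → Vec n → ℝ) (p : TS (Vec n)) :
    energy L p + energy L p = unc L p * unc L p := by
  simp only [energy]; ring

theorem contDiffOn_energy {L : Vec n → Vec n → ℝ} (hL : ContDiffOn ℝ ∞ (unc L) U) :
    ContDiffOn ℝ ∞ (energy L) U :=
  contDiffOn_const.mul (hL.pow 2)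

theorem metric_eq {L : Vec n → Vec n → ℝ} (hU : IsOpen U) (hL : ContDiffOn ℝ ∞ (unc L) U)
    {p : TS (Vec n)} (hp : p ∈ U) (i j : Fin n) :
    metric L (fstTS _ p) (sndTS _ p) i j
      = d2 (energy L) p (ver (basisVec i)) (ver (basisVec j)) := by
  set f : Vec n → Vec n → ℝ := fun x y => L x y ^ 2 with hf
  have hf' : ContDiffOn ℝ ∞ (unc f) U := hL.pow 2
  have h1 : metric L (fstTS _ p) (sndTS _ p) i j
      = (1 / 2 : ℝ) * dY i (dY j f) (fstTS _ p) (sndTS _ p) := rfl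
  rw [h1, dY_eq (hasFDerivAt_d0 (contDiffOn_dY hU hf' j) hU hp) i, d1_dY hU hf' hp]
  have h2 : ∀ q ∈ U, unc f q = unc L q * unc L q := fun q _ => sq _
  rw [d2_congr hU h2 hp, d2_mul hU hL hL hp,
    d2_energy hU hL (fun q _ => energy_add_energy L q) hp]
  ring

namespace IsFinslerCoord

variable {L : Vec n → Vec n → ℝ} (h : IsFinslerCoord L U)

include h

theorem isEnergy : IsEnergy (energy L) U where
  isOpen := h.isOpen
  smooth := contDiffOn_energy h.smooth
  homog p hp := by
    rw [d1_energy h.isOpen h.smooth (fun q _ => energy_add_energy L q) hp, h.homog p hp, energy]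
    ring
  posDef p hp a ha := by
    have h1 := (h.posDef p hp).dotProduct_mulVec_pos (x := a.ofLp) (by simpa using ha)
    rw [bilin_eq_sum]
    simp only [dotProduct, Matrix.mulVec, Pi.star_apply, star_trivial, Finset.mul_sum,
      metric_eq h.isOpen h.smooth hp] at h1
    refine h1.trans_eq (Finset.sum_congr rfl fun i _ => Finset.sum_congr rfl fun j _ => by ring)

theorem contDiffOn_metric (i j : Fin n) :
    ContDiffOn ℝ ∞ (unc fun x y => metric L x y i j) U :=
  (((contDiffOn_d2 (contDiffOn_energy h.smooth) h.isOpen).clm_apply contDiffOn_const).clm_apply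
    contDiffOn_const).congr fun _ hp => metric_eq h.isOpen h.smooth hp i j

theorem contDiffOn_metricInv (i j : Fin n) :
    ContDiffOn ℝ ∞ (unc fun x y => metricInv L x y i j) U :=
  contDiffOn_matrix_inv (M := fun p : TS (Vec n) => metric L (fstTS _ p) (sndTS _ p))
    (fun i j => h.contDiffOn_metric i j) (fun p hp => (h.posDef p hp).isUnit) i j

theorem contDiffOn_spray (i : Fin n) : ContDiffOn ℝ ∞ (unc (spray L i)) U := by
  have hy (j : Fin n) : ContDiffOn ℝ ∞ (fun p : TS (Vec n) => sndTS _ p j) U :=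
    ((EuclideanSpace.proj (𝕜 := ℝ) j).comp (sndTS (Vec n))).contDiff.contDiffOn
  refine contDiffOn_const.mul (ContDiffOn.sum fun j _ => ContDiffOn.sum fun k _ =>
    ((ContDiffOn.sum fun r _ => ?_).mul (hy j)).mul (hy k))
  exact (h.contDiffOn_metricInv i r).mul (contDiffOn_const.mul
    (((contDiffOn_dX h.isOpen (h.contDiffOn_metric r k) j).add
      (contDiffOn_dX h.isOpen (h.contDiffOn_metric r j) k)).sub
      (contDiffOn_dX h.isOpen (h.contDiffOn_metric j k) r)))

theorem contDiffOn_sprayVec : ContDiffOn ℝ ∞ (sprayVec L) U :=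
  contDiffOn_euclidean.2 fun i => h.contDiffOn_spray i

variable {p : TS (Vec n)} (hp : p ∈ U)

include hp

/-- This removes the inverse metric from every vector defined by raising an index. -/
theorem metric_raise (a : Vec n) (w : Fin n → ℝ) :
    d2 (energy L) p (ver a) (ver (WithLp.toLp 2 fun i =>
      ∑ r, metricInv L (fstTS _ p) (sndTS _ p) i r * w r)) = ∑ r, a r * w r := by
  rw [bilin_eq_sum]
  simp only [← metric_eq h.isOpen h.smooth hp]
  have h1 : (metric L (fstTS _ p) (sndTS _ p)).mulVec
      ((metricInv L (fstTS _ p) (sndTS _ p)).mulVec w) = w := by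
    rw [Matrix.mulVec_mulVec, metricInv, Matrix.mul_nonsing_inv _
      ((Matrix.isUnit_iff_isUnit_det _).1 (h.posDef p hp).isUnit), Matrix.one_mulVec]
  refine Finset.sum_congr rfl fun i _ => ?_
  conv_rhs => rw [← h1]
  simp only [Matrix.mulVec, dotProduct, Finset.mul_sum]
  exact Finset.sum_congr rfl fun j _ => Finset.sum_congr rfl fun k _ => by ring

theorem metric_raise_basis (r : Fin n) (w : Fin n → ℝ) :
    d2 (energy L) p (ver (basisVec r)) (ver (WithLp.toLp 2 fun i =>
      ∑ r, metricInv L (fstTS _ p) (sndTS _ p) i r * w r)) = w r := by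
  rw [h.metric_raise hp]
  simp [basisVec]

theorem nonlin_eq (i j : Fin n) : nonlin L i j (fstTS _ p) (sndTS _ p)
    = fderiv ℝ (sprayVec L) p (ver (basisVec j)) i := by
  have h1 := hasFDerivAt_of_contDiffOn h.contDiffOn_sprayVec h.isOpen hp
  have h2 : HasFDerivAt (unc (spray L i))
      ((EuclideanSpace.proj (𝕜 := ℝ) i).comp (fderiv ℝ (sprayVec L) p)) p :=
    (EuclideanSpace.proj (𝕜 := ℝ) i).hasFDerivAt.comp p h1
  rw [nonlin, dY_eq (hasFDerivAt_d0 (h.contDiffOn_spray i) h.isOpen hp), d1, h2.fderiv]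
  rfl

theorem delta_eq {f : Vec n → Vec n → ℝ} (hf : ContDiffOn ℝ ∞ (unc f) U) (j : Fin n) :
    delta L j f (fstTS _ p) (sndTS _ p) = d1 (unc f) p
      (hor (basisVec j) - ver (fderiv ℝ (sprayVec L) p (ver (basisVec j)))) := by
  have h1 := hasFDerivAt_d0 hf h.isOpen hp
  have h2 := clm_apply_eq_sum ((d1 (unc f) p).comp ver)
    (fderiv ℝ (sprayVec L) p (ver (basisVec j)))
  simp only [ContinuousLinearMap.comp_apply, smul_eq_mul] at h2
  rw [delta, dX_eq h1, map_sub, h2]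
  simp only [dY_eq h1, h.nonlin_eq hp]

theorem d1_metric (i j : Fin n) (ξ : TS (Vec n)) : d1 (unc fun x y => metric L x y i j) p ξ
    = d3 (energy L) p ξ (ver (basisVec i)) (ver (basisVec j)) := by
  have h1 := ((hasFDerivAt_d2 (contDiffOn_energy h.smooth) h.isOpen hp).clm_apply
    (hasFDerivAt_const (ver (basisVec i)) p)).clm_apply (hasFDerivAt_const (ver (basisVec j)) p)
  have := DFunLike.congr_fun (fderiv_unique_of_eqOn h.isOpen hp
    (hasFDerivAt_d0 (h.contDiffOn_metric i j) h.isOpen hp) h1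
    fun q hq => metric_eq h.isOpen h.smooth hq i j) ξ
  simpa using this

theorem cartan_eq (i j k : Fin n) : cartan L i j k (fstTS _ p) (sndTS _ p) = (1 / 2 : ℝ)
    * d3 (energy L) p (ver (basisVec k)) (ver (basisVec i)) (ver (basisVec j)) := by
  rw [cartan, dY_eq (hasFDerivAt_d0 (h.contDiffOn_metric i j) h.isOpen hp), h.d1_metric hp]

/-- After lowering the index, two of the three Christoffel terms coincide when contracted with `y^j
y^k`. Euler's relation then replaces the contracted third derivatives of the energy by lower ones.
-/
theorem sprayVec_eq (a : Vec n) : 2 * d2 (energy L) p (ver a) (ver (sprayVec L p)) =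
    d2 (energy L) p (hor (sndTS _ p)) (ver a) - d1 (energy L) p (hor a) := by
  have e := h.isEnergy
  suffices hs : (2 : ℝ) • ((d2 (energy L) p).flip (ver (sprayVec L p))).comp ver =
      (d2 (energy L) p (hor (sndTS _ p))).comp ver - (d1 (energy L) p).comp hor by
    simpa using DFunLike.congr_fun hs a
  refine clm_ext_basis fun r => ?_
  set y := sndTS (Vec n) p with hy
  have h1 : sprayVec L p = WithLp.toLp 2 fun i =>
      ∑ r, metricInv L (fstTS _ p) (sndTS _ p) i r * ((1 / 2 : ℝ) * ∑ j, ∑ k, (1 / 2 : ℝ) *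
        (d3 (energy L) p (hor (basisVec j)) (ver (basisVec r)) (ver (basisVec k))
        + d3 (energy L) p (hor (basisVec k)) (ver (basisVec r)) (ver (basisVec j))
        - d3 (energy L) p (hor (basisVec r)) (ver (basisVec j)) (ver (basisVec k)))
        * y j * y k) := by
    have hd (i j k : Fin n) := dX_eq (hasFDerivAt_d0 (h.contDiffOn_metric j k) h.isOpen hp) i
    unfold sprayVec
    congr 1
    funext i
    simp only [spray, hd, h.d1_metric hp, Finset.mul_sum, Finset.sum_mul]
    conv_rhs => rw [Finset.sum_comm]
    refine Finset.sum_congr rfl fun j _ => ?_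
    conv_rhs => rw [Finset.sum_comm]
    exact Finset.sum_congr rfl fun k _ => Finset.sum_congr rfl fun r _ => by ring
  have h2 := h.metric_raise_basis hp r fun r => (1 / 2 : ℝ) * ∑ j, ∑ k, (1 / 2 : ℝ) *
        (d3 (energy L) p (hor (basisVec j)) (ver (basisVec r)) (ver (basisVec k))
        + d3 (energy L) p (hor (basisVec k)) (ver (basisVec r)) (ver (basisVec j))
        - d3 (energy L) p (hor (basisVec r)) (ver (basisVec j)) (ver (basisVec k)))
        * y j * y k
  rw [← h1] at h2
  have h3 := trilin_eq_sum_mid (d3 (energy L) p) hor ver y y (ver (basisVec r))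
  have h4 := bilin_eq_sum (d3 (energy L) p (hor (basisVec r))) ver ver y y
  have h5 : ∑ j, ∑ k, (1 / 2 : ℝ) *
        (d3 (energy L) p (hor (basisVec j)) (ver (basisVec r)) (ver (basisVec k))
        + d3 (energy L) p (hor (basisVec k)) (ver (basisVec r)) (ver (basisVec j))
        - d3 (energy L) p (hor (basisVec r)) (ver (basisVec j)) (ver (basisVec k)))
        * y j * y k = d3 (energy L) p (hor y) (ver (basisVec r)) (ver y)
          - (1 / 2) * d3 (energy L) p (hor (basisVec r)) (ver y) (ver y) := by
    have h6 := h3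
    rw [Finset.sum_comm] at h6
    have h7 : d3 (energy L) p (hor y) (ver (basisVec r)) (ver y)
        - (1 / 2) * d3 (energy L) p (hor (basisVec r)) (ver y) (ver y) =
        (1 / 2) * d3 (energy L) p (hor y) (ver (basisVec r)) (ver y)
        + (1 / 2) * d3 (energy L) p (hor y) (ver (basisVec r)) (ver y)
        - (1 / 2) * d3 (energy L) p (hor (basisVec r)) (ver y) (ver y) := by ring
    rw [h7]
    nth_rewrite 1 [h3]
    rw [h6, h4]
    simp only [Finset.mul_sum, ← Finset.sum_add_distrib, ← Finset.sum_sub_distrib]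
    exact Finset.sum_congr rfl fun j _ => Finset.sum_congr rfl fun k _ => by ring
  rw [e.d3_hor_ver_self hp, e.d3_hor_ver_self hp, e.d2_hor_ver_self hp] at h5
  rw [h5] at h2
  simp only [smul_apply, sub_apply, ContinuousLinearMap.comp_apply,
    ContinuousLinearMap.flip_apply, smul_eq_mul]
  rw [h2]
  ring

theorem cartanVec_eq (a b c : Vec n) :
    2 * d2 (energy L) p (ver a) (ver (cartanVec L p b c)) =
      d3 (energy L) p (hor b - ver (fderiv ℝ (sprayVec L) p (ver b))) (ver a) (ver c)
        + d3 (energy L) p (hor c - ver (fderiv ℝ (sprayVec L) p (ver c))) (ver a) (ver b)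
        - d3 (energy L) p (hor a - ver (fderiv ℝ (sprayVec L) p (ver a))) (ver b) (ver c) := by
  set δ : Vec n →L[ℝ] TS (Vec n) := hor - ver.comp ((fderiv ℝ (sprayVec L) p).comp ver) with hδ
  have hδ' (v : Vec n) : hor v - ver (fderiv ℝ (sprayVec L) p (ver v)) = δ v := rfl
  simp only [hδ']
  have e := h.isEnergy
  suffices hs : (2 : ℝ) • ((d2 (energy L) p).flip (ver (cartanVec L p b c))).comp ver =
      (d3 (energy L) p (δ b)).flip (ver c) ∘L ver + (d3 (energy L) p (δ c)).flip (ver b) ∘L ver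
        - (((d3 (energy L) p).flip (ver b)).flip (ver c)).comp δ by
    simpa using DFunLike.congr_fun hs a
  refine clm_ext_basis fun r => ?_
  have h1 : cartanVec L p b c = WithLp.toLp 2 fun i =>
      ∑ r, metricInv L (fstTS _ p) (sndTS _ p) i r * (∑ j, ∑ k, (1 / 2 : ℝ) *
        (d3 (energy L) p (δ (basisVec j)) (ver (basisVec r)) (ver (basisVec k))
        + d3 (energy L) p (δ (basisVec k)) (ver (basisVec r)) (ver (basisVec j))
        - d3 (energy L) p (δ (basisVec r)) (ver (basisVec j)) (ver (basisVec k)))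
        * b j * c k) := by
    unfold cartanVec
    congr 1
    funext i
    simp only [cartanF, h.delta_eq hp (h.contDiffOn_metric _ _), h.d1_metric hp, hδ',
      Finset.mul_sum, Finset.sum_mul]
    conv_rhs => rw [Finset.sum_comm]
    refine Finset.sum_congr rfl fun j _ => ?_
    conv_rhs => rw [Finset.sum_comm]
    exact Finset.sum_congr rfl fun k _ => Finset.sum_congr rfl fun r _ => by ring
  have h2 := h.metric_raise_basis hp r fun r => ∑ j, ∑ k, (1 / 2 : ℝ) *
        (d3 (energy L) p (δ (basisVec j)) (ver (basisVec r)) (ver (basisVec k))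
        + d3 (energy L) p (δ (basisVec k)) (ver (basisVec r)) (ver (basisVec j))
        - d3 (energy L) p (δ (basisVec r)) (ver (basisVec j)) (ver (basisVec k)))
        * b j * c k
  rw [← h1] at h2
  simp only [smul_apply, sub_apply, add_apply, ContinuousLinearMap.comp_apply,
    ContinuousLinearMap.flip_apply, smul_eq_mul]
  have h3 := trilin_eq_sum_mid (d3 (energy L) p) δ ver c b (ver (basisVec r))
  rw [Finset.sum_comm] at h3
  rw [h2, h3, trilin_eq_sum_mid (d3 (energy L) p) δ ver b c,
    bilin_eq_sum (d3 (energy L) p (δ (basisVec r)))]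
  simp only [Finset.mul_sum, ← Finset.sum_add_distrib, ← Finset.sum_sub_distrib]
  exact Finset.sum_congr rfl fun j _ => Finset.sum_congr rfl fun k _ => by ring

omit hp in
theorem isCartanSpray : IsCartanSpray (energy L) U (sprayVec L) (cartanVec L) where
  toIsEnergy := h.isEnergy
  smooth_spray := h.contDiffOn_sprayVec
  spray_eq _ hp a := h.sprayVec_eq hp a
  cartan_eq _ hp a b c := h.cartanVec_eq hp a b c

/-- The vector `C^i_jk b^j c^k` in terms of the third derivative of the energy. -/
theorem cartanUp_raise (a b c : Vec n) : 2 * d2 (energy L) p (ver a) (ver (WithLp.toLp 2 fun i =>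
      ∑ j, ∑ k, cartanUp L i j k (fstTS _ p) (sndTS _ p) * b j * c k)) =
    d3 (energy L) p (ver a) (ver b) (ver c) := by
  have e := h.isEnergy
  have h1 : (fun i => ∑ j, ∑ k, cartanUp L i j k (fstTS _ p) (sndTS _ p) * b j * c k) = fun i =>
      ∑ r, metricInv L (fstTS _ p) (sndTS _ p) i r *
        (∑ j, ∑ k, cartan L r j k (fstTS _ p) (sndTS _ p) * b j * c k) := by
    funext i
    simp only [cartanUp, Finset.mul_sum, Finset.sum_mul]
    conv_rhs => rw [Finset.sum_comm]
    refine Finset.sum_congr rfl fun j _ => ?_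
    conv_rhs => rw [Finset.sum_comm]
    exact Finset.sum_congr rfl fun k _ => Finset.sum_congr rfl fun r _ => by ring
  rw [h1, h.metric_raise hp, trilin_eq_sum, Finset.mul_sum]
  refine Finset.sum_congr rfl fun r _ => ?_
  simp only [Finset.mul_sum]
  refine Finset.sum_congr rfl fun j _ => Finset.sum_congr rfl fun k _ => ?_
  rw [h.cartan_eq hp, d3_comm e.smooth e.isOpen hp, d3_comm_last e.smooth e.isOpen hp _ (ver _)]
  ring

end IsFinslerCoord

end Coordinates

/-! ### Induced metric, projections and induced connection in coordinates. -/

section HypersurfaceCoordinates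

variable {m n : ℕ}

theorem sum_comm₄ {ι κ : Type*} [Fintype ι] [Fintype κ] (f : ι → ι → κ → κ → ℝ) :
    ∑ a, ∑ b, ∑ c, ∑ d, f a b c d = ∑ c, ∑ d, ∑ a, ∑ b, f a b c d := by
  have h1 (a : ι) : ∑ b, ∑ c, ∑ d, f a b c d = ∑ c, ∑ d, ∑ b, f a b c d := by
    rw [Finset.sum_comm]
    exact Finset.sum_congr rfl fun c _ => Finset.sum_comm
  simp only [h1]
  rw [Finset.sum_comm]
  exact Finset.sum_congr rfl fun c _ => Finset.sum_comm

/-- The tangential part of a vector, in the coordinates of the hypersurface. -/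
def projVec (L : Vec n → Vec n → ℝ) (X : Vec m → Vec n) (q : Vec m × Vec m) (t : Vec n) : Vec m :=
  WithLp.toLp 2 fun α => ∑ i, projInv L X α i q.1 q.2 * t i

/-- The vector `B^i_0α + G^i_j B^j_α`, contracted with `a^α`. -/
def supportVec (L : Vec n → Vec n → ℝ) (X : Vec m → Vec n) (q : Vec m × Vec m) (a : Vec m) :
    Vec n :=
  fderiv ℝ (fderiv ℝ X) q.1 a q.2
    + fderiv ℝ (sprayVec L) (liftMap X q) (ver (fderiv ℝ X q.1 a))

@[simp] theorem fstTS_liftMap (X : Vec m → Vec n) (q : Vec m × Vec m) :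
    fstTS _ (liftMap X q) = X q.1 := by
  simp [liftMap]

variable {L : Vec n → Vec n → ℝ} {U : Set (TS (Vec n))} {X : Vec m → Vec n} {O : Set (Vec m)}
  (h : IsFinslerCoord L U) (i : IsImmersedHypersurface X O)

section Immersion

include i

theorem projB2_eq {u : Vec m} (hu : u ∈ O) (j : Fin n) (α β : Fin m) :
    projB2 X j α β u = fderiv ℝ (fderiv ℝ X) u (basisVec β) (basisVec α) j := by
  have h1 := (i.hasFDerivAt_fderiv hu).clm_apply (hasFDerivAt_const (basisVec α) u)
  have h2 : HasFDerivAt (projB X j α) _ u :=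
    (EuclideanSpace.proj (𝕜 := ℝ) j).hasFDerivAt.comp u h1
  rw [projB2, h2.fderiv]
  simp

theorem contDiffOn_projB (j : Fin n) (α : Fin m) : ContDiffOn ℝ ∞ (projB X j α) O :=
  (EuclideanSpace.proj (𝕜 := ℝ) j).contDiff.comp_contDiffOn
    ((contDiffOn_fderiv i.smooth i.isOpen).clm_apply contDiffOn_const)

theorem contDiffOn_projB2 (j : Fin n) (α β : Fin m) : ContDiffOn ℝ ∞ (projB2 X j α β) O :=
  (contDiffOn_fderiv (contDiffOn_projB i j α) i.isOpen).clm_apply contDiffOn_const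

end Immersion

section Induced

include h i

variable {q : Vec m × Vec m} (hq : q ∈ liftDomain U X O)

omit h in
theorem contDiffOn_comp_liftMap {f : Vec n → Vec n → ℝ} (hf : ContDiffOn ℝ ∞ (unc f) U) :
    ContDiffOn ℝ ∞ (fun q : Vec m × Vec m => f (X q.1) (push X q.1 q.2)) (liftDomain U X O) := by
  have h1 : ContDiffOn ℝ ∞ (liftMap X) (liftDomain U X O) :=
    i.contDiffOn_liftMap.mono fun q hq => ⟨hq.1, trivial⟩
  refine (hf.comp h1 fun q hq => hq.2).congr fun q _ => ?_
  simp [unc, push]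

/-- The lift is affine in `v`, so second fibre derivatives pull back without additional terms. -/
theorem inducedMetric_eq (hq : q ∈ liftDomain U X O) (α β : Fin m) :
    metric (inducedL L X) q.1 q.2 α β = d2 (energy L) (liftMap X q)
      (ver (fderiv ℝ X q.1 (basisVec α))) (ver (fderiv ℝ X q.1 (basisVec β))) := by
  set f : Vec n → Vec n → ℝ := fun x y => L x y ^ 2 with hf
  have hf' : ContDiffOn ℝ ∞ (unc f) U := h.smooth.pow 2
  obtain ⟨u, v⟩ := q
  have hl (v' : Vec m) : HasFDerivAt (fun w => liftMap X (u, w)) (ver.comp (fderiv ℝ X u)) v' :=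
    (ver.comp (fderiv ℝ X u)).hasFDerivAt.const_add (hor (X u))
  have h1 : ∀ v', (u, v') ∈ liftDomain U X O → dY β (fun u v => inducedL L X u v ^ 2) u v'
      = d1 (unc f) (liftMap X (u, v')) (ver (fderiv ℝ X u (basisVec β))) := by
    intro v' hv'
    have h2 := (hasFDerivAt_d0 hf' h.isOpen hv'.2).comp v' (hl v')
    have h3 : unc f ∘ (fun w => liftMap X (u, w)) = fun v' => inducedL L X u v' ^ 2 := by
      ext w; simp [unc, hf, inducedL, push]
    rw [h3] at h2
    rw [dY, h2.fderiv]; rfl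
  have h2 : ∀ᶠ v' in 𝓝 v, dY β (fun u v => inducedL L X u v ^ 2) u v'
      = d1 (unc f) (liftMap X (u, v')) (ver (fderiv ℝ X u (basisVec β))) := by
    have hc : ContinuousAt (fun v' : Vec m => (u, v')) v := by fun_prop
    filter_upwards [hc.preimage_mem_nhds ((i.isOpen_liftDomain h.isOpen).mem_nhds hq)] with v' hv'
    exact h1 v' hv'
  have hd := (hasFDerivAt_d1 hf' h.isOpen hq.2).clm_apply
    (hasFDerivAt_const (ver (fderiv ℝ X u (basisVec β))) _)
  have h3 := hd.comp v (hl v)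
  have h4 := h3.congr_of_eventuallyEq h2
  have h5 : metric (inducedL L X) u v α β
      = (1 / 2 : ℝ) * dY α (dY β fun u v => inducedL L X u v ^ 2) u v := rfl
  rw [h5, dY, h4.fderiv]
  have h6 : ∀ q ∈ U, unc f q = unc L q * unc L q := fun q _ => sq _
  have h7 (ξ η : TS (Vec n)) : d2 (unc f) (liftMap X (u, v)) ξ η
      = 2 * d2 (energy L) (liftMap X (u, v)) ξ η := by
    rw [d2_congr h.isOpen h6 hq.2, d2_mul h.isOpen h.smooth h.smooth hq.2,
      d2_energy h.isOpen h.smooth (fun q _ => energy_add_energy L q) hq.2]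
    ring
  simp [h7]

theorem inducedMetric_mulVec (hq : q ∈ liftDomain U X O) (c : Vec m) (β : Fin m) :
    (metric (inducedL L X) q.1 q.2).mulVec c.ofLp β = d2 (energy L) (liftMap X q)
      (ver (fderiv ℝ X q.1 (basisVec β))) (ver (fderiv ℝ X q.1 c)) := by
  have h1 := clm_apply_eq_sum ((d2 (energy L) (liftMap X q)
    (ver (fderiv ℝ X q.1 (basisVec β)))).comp (ver.comp (fderiv ℝ X q.1))) c
  simp only [ContinuousLinearMap.comp_apply, smul_eq_mul] at h1
  rw [h1, Matrix.mulVec, dotProduct]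
  simp only [inducedMetric_eq h i hq]
  exact Finset.sum_congr rfl fun _ _ => mul_comm _ _

/-- An injective differential pulls a positive definite form back to a nondegenerate one. -/
theorem isUnit_inducedMetric (hq : q ∈ liftDomain U X O) :
    IsUnit (metric (inducedL L X) q.1 q.2) := by
  rw [← Matrix.mulVec_injective_iff_isUnit]
  refine (injective_iff_map_eq_zero (metric (inducedL L X) q.1 q.2).mulVecLin).2 fun c hc => ?_
  by_contra hne
  set c' : Vec m := WithLp.toLp 2 c with hc'
  have hB : fderiv ℝ X q.1 c' ≠ 0 := fun h0 => hne <| by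
    have := i.injective _ hq.1 (h0.trans (map_zero _).symm)
    simpa [hc'] using this
  have h1 := h.isEnergy.posDef _ hq.2 _ hB
  have h2 : ∀ β, d2 (energy L) (liftMap X q) (ver (fderiv ℝ X q.1 (basisVec β)))
      (ver (fderiv ℝ X q.1 c')) = 0 := fun β => by
    rw [← inducedMetric_mulVec h i hq]
    exact congrFun hc β
  have h3 := clm_apply_eq_sum (((d2 (energy L) (liftMap X q)).flip
    (ver (fderiv ℝ X q.1 c'))).comp (ver.comp (fderiv ℝ X q.1))) c'
  simp [h2] at h3
  exact h1.ne' h3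

omit i in
theorem projVec_eq (hq : q ∈ liftDomain U X O) (t : Vec n) : (projVec L X q t).ofLp =
    (metricInv (inducedL L X) q.1 q.2).mulVec fun β =>
      d2 (energy L) (liftMap X q) (ver (fderiv ℝ X q.1 (basisVec β))) (ver t) := by
  funext α
  simp only [projVec, projInv, Matrix.mulVec, dotProduct]
  have h1 (β : Fin m) : d2 (energy L) (liftMap X q) (ver (fderiv ℝ X q.1 (basisVec β))) (ver t)
      = ∑ k, (∑ j, metric L (X q.1) (push X q.1 q.2) k j * projB X j β q.1) * t k := by
    rw [d2_comm h.isEnergy.smooth h.isOpen hq.2, bilin_eq_sum]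
    refine Finset.sum_congr rfl fun k _ => ?_
    rw [Finset.sum_mul]
    refine Finset.sum_congr rfl fun j _ => ?_
    rw [← metric_eq h.isOpen h.smooth hq.2]
    simp only [fstTS_liftMap, sndTS_liftMap, push, projB]
    ring
  simp only [h1, Finset.mul_sum, Finset.sum_mul]
  rw [Finset.sum_comm]
  exact Finset.sum_congr rfl fun β _ => Finset.sum_congr rfl fun k _ =>
    Finset.sum_congr rfl fun j _ => by ring

theorem metric_projVec (hq : q ∈ liftDomain U X O) (t : Vec n) (a : Vec m) :
    d2 (energy L) (liftMap X q) (ver (fderiv ℝ X q.1 a))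
      (ver (fderiv ℝ X q.1 (projVec L X q t))) =
    d2 (energy L) (liftMap X q) (ver (fderiv ℝ X q.1 a)) (ver t) := by
  suffices hs : (((d2 (energy L) (liftMap X q)).flip
      (ver (fderiv ℝ X q.1 (projVec L X q t)))).comp (ver.comp (fderiv ℝ X q.1))) =
      (((d2 (energy L) (liftMap X q)).flip (ver t)).comp (ver.comp (fderiv ℝ X q.1))) from
    DFunLike.congr_fun hs a
  refine clm_ext_basis fun β => ?_
  have h1 := inducedMetric_mulVec h i hq (projVec L X q t) β
  rw [projVec_eq h hq, Matrix.mulVec_mulVec, metricInv, Matrix.mul_nonsing_inv _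
    ((Matrix.isUnit_iff_isUnit_det _).1 (isUnit_inducedMetric h i hq)), Matrix.one_mulVec] at h1
  exact h1.symm

theorem projVec_tangent (hq : q ∈ liftDomain U X O) (c : Vec m) :
    projVec L X q (fderiv ℝ X q.1 c) = c := by
  apply WithLp.ofLp_injective
  rw [projVec_eq h hq]
  have h1 := funext (inducedMetric_mulVec h i hq c)
  rw [← h1, Matrix.mulVec_mulVec, metricInv, Matrix.nonsing_inv_mul _
    ((Matrix.isUnit_iff_isUnit_det _).1 (isUnit_inducedMetric h i hq)), Matrix.one_mulVec]

theorem isNormal_sub_projVec (hq : q ∈ liftDomain U X O) (t : Vec n) :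
    IsNormal (energy L) X q (t - fderiv ℝ X q.1 (projVec L X q t)) := fun a => by
  rw [d2_comm h.isEnergy.smooth h.isOpen hq.2, map_sub ver, map_sub, metric_projVec h i hq,
    sub_self]

theorem contDiffOn_inducedMetricInv (α β : Fin m) :
    ContDiffOn ℝ ∞ (fun q : Vec m × Vec m => metricInv (inducedL L X) q.1 q.2 α β)
      (liftDomain U X O) := by
  refine contDiffOn_matrix_inv (M := fun q : Vec m × Vec m => metric (inducedL L X) q.1 q.2)
    (fun α β => ?_) (fun q hq => isUnit_inducedMetric h i hq) α β
  have h1 : ContDiffOn ℝ ∞ (liftMap X) (liftDomain U X O) :=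
    i.contDiffOn_liftMap.mono fun q hq => ⟨hq.1, trivial⟩
  have h2 : ContDiffOn ℝ ∞ (fun q => d2 (energy L) (liftMap X q)) (liftDomain U X O) :=
    (contDiffOn_d2 h.isEnergy.smooth h.isOpen).comp h1 fun q hq => hq.2
  have h3 (a : Vec m) : ContDiffOn ℝ ∞ (fun q : Vec m × Vec m => ver (fderiv ℝ X q.1 a))
      (liftDomain U X O) :=
    ver.contDiff.comp_contDiffOn (((contDiffOn_fderiv i.smooth i.isOpen).comp contDiffOn_fst
      fun q hq => hq.1).clm_apply contDiffOn_const)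
  exact ((h2.clm_apply (h3 _)).clm_apply (h3 _)).congr fun q hq => inducedMetric_eq h i hq α β

omit h in
theorem contDiffOn_projB_fst (j : Fin n) (α : Fin m) :
    ContDiffOn ℝ ∞ (fun q : Vec m × Vec m => projB X j α q.1) (liftDomain U X O) :=
  (contDiffOn_projB i j α).comp contDiffOn_fst fun _ hq => hq.1

omit h in
theorem contDiffOn_projB2_fst (j : Fin n) (α β : Fin m) :
    ContDiffOn ℝ ∞ (fun q : Vec m × Vec m => projB2 X j α β q.1) (liftDomain U X O) :=
  (contDiffOn_projB2 i j α β).comp contDiffOn_fst fun _ hq => hq.1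

theorem contDiffOn_projInv (α : Fin m) (j : Fin n) :
    ContDiffOn ℝ ∞ (fun q : Vec m × Vec m => projInv L X α j q.1 q.2) (liftDomain U X O) :=
  ContDiffOn.sum fun β _ => ContDiffOn.sum fun k _ =>
    ((contDiffOn_inducedMetricInv h i α β).mul
      (contDiffOn_comp_liftMap i (h.contDiffOn_metric j k))).mul (contDiffOn_projB_fst i k β)

theorem contDiffOn_projVec (t : Vec n) :
    ContDiffOn ℝ ∞ (fun q : Vec m × Vec m => projVec L X q t) (liftDomain U X O) :=
  contDiffOn_euclidean.2 fun α => by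
    simp only [projVec]
    exact ContDiffOn.sum fun j _ => (contDiffOn_projInv h i α j).mul contDiffOn_const

/-- `unitNormal` is chosen pointwise and may jump in sign. A smooth field is obtained by removing
from the constant vector `N` its tangential part at each point. -/
theorem hasNormalFields : HasNormalFields (energy L) U X O := by
  intro q hq N hN
  have hΩ := i.isOpen_liftDomain h.isOpen
  refine ⟨fun r => N - fderiv ℝ X r.1 (projVec L X r N), ?_, ?_, ?_⟩
  · have h1 : ContDiffOn ℝ ∞ (fun r : Vec m × Vec m => fderiv ℝ X r.1) (liftDomain U X O) :=
      (contDiffOn_fderiv i.smooth i.isOpen).comp contDiffOn_fst fun q hq => hq.1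
    exact (contDiffOn_const.sub (h1.clm_apply (contDiffOn_projVec h i N))).contDiffAt
      (hΩ.mem_nhds hq)
  · filter_upwards [hΩ.mem_nhds hq] with r hr
    exact isNormal_sub_projVec h i hr N
  · have h1 : projVec L X q N = 0 := by
      apply WithLp.ofLp_injective
      rw [projVec_eq h hq]
      have h2 : (fun β => d2 (energy L) (liftMap X q) (ver (fderiv ℝ X q.1 (basisVec β)))
          (ver N)) = 0 := by
        funext β
        rw [d2_comm h.isEnergy.smooth h.isOpen hq.2]
        exact hN _
      rw [h2, Matrix.mulVec_zero]
      rfl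
    simp [h1]

omit i in
theorem isUnitNormal_iff (hq : q ∈ liftDomain U X O) (N : Vec n) : IsUnitNormal L X q.1 q.2 N ↔
    IsNormal (energy L) X q N ∧ d2 (energy L) (liftMap X q) (ver N) (ver N) = 1 := by
  have h1 (a b : Vec n) : d2 (energy L) (liftMap X q) (ver a) (ver b)
      = ∑ j, ∑ k, metric L (X q.1) (push X q.1 q.2) j k * a j * b k := by
    rw [bilin_eq_sum]
    simp only [← metric_eq h.isOpen h.smooth hq.2, fstTS_liftMap, sndTS_liftMap, push]
  have h2 : IsNormal (energy L) X q N ↔ ∀ α, d2 (energy L) (liftMap X q)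
      (ver (fderiv ℝ X q.1 (basisVec α))) (ver N) = 0 := by
    constructor
    · intro hN α
      rw [d2_comm h.isEnergy.smooth h.isOpen hq.2]
      exact hN _
    · intro hN a
      rw [d2_comm h.isEnergy.smooth h.isOpen hq.2]
      have h3 := clm_apply_eq_sum (((d2 (energy L) (liftMap X q)).flip (ver N)).comp
        (ver.comp (fderiv ℝ X q.1))) a
      simpa [hN] using h3
  rw [h2]
  simp only [IsUnitNormal, h1]
  rfl

theorem unitNormal_spec (hq : q ∈ liftDomain U X O) :
    IsNormal (energy L) X q (unitNormal L X q.1 q.2) ∧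
      d2 (energy L) (liftMap X q) (ver (unitNormal L X q.1 q.2))
        (ver (unitNormal L X q.1 q.2)) = 1 := by
  obtain ⟨N, hN⟩ := exists_unit_isNormal h.isCartanSpray i hq
  have h1 : ∃ N, IsUnitNormal L X q.1 q.2 N := ⟨N, (isUnitNormal_iff h hq N).2 hN⟩
  rw [← isUnitNormal_iff h hq, unitNormal, dif_pos h1]
  exact h1.choose_spec

theorem unitNormal_ne_zero (hq : q ∈ liftDomain U X O) : unitNormal L X q.1 q.2 ≠ 0 := fun h0 => by
  have := (unitNormal_spec h i hq).2
  simp [h0] at this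

omit i in
theorem secondV_eq (hq : q ∈ liftDomain U X O) (α β : Fin m) :
    secondV L X α β q.1 q.2 = (1 / 2 : ℝ) * d3 (energy L) (liftMap X q)
      (ver (unitNormal L X q.1 q.2)) (ver (fderiv ℝ X q.1 (basisVec α)))
        (ver (fderiv ℝ X q.1 (basisVec β))) := by
  have s := h.isEnergy.smooth
  have o := h.isOpen
  rw [d3_comm s o hq.2, d3_comm_last s o hq.2, trilin_eq_sum, secondV, Finset.mul_sum]
  refine Finset.sum_congr rfl fun j _ => ?_
  rw [Finset.mul_sum]
  refine Finset.sum_congr rfl fun k _ => ?_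
  rw [Finset.mul_sum]
  refine Finset.sum_congr rfl fun l _ => ?_
  have := h.cartan_eq hq.2 j k l
  rw [fstTS_liftMap, sndTS_liftMap] at this
  rw [push, this, d3_comm s o hq.2, d3_comm_last s o hq.2 _ (ver (basisVec l))]
  simp only [projB]
  ring

theorem secondVTensorVanishes
    (hM : ∀ q ∈ liftDomain U X O, ∀ α β, secondV L X α β q.1 q.2 = 0) :
    SecondVTensorVanishes (energy L) U X O := by
  intro q hq N hN a b
  obtain ⟨hu, -⟩ := unitNormal_spec h i hq
  obtain ⟨c, rfl⟩ := hu.exists_smul_eq h.isCartanSpray i hq (unitNormal_ne_zero h i hq) hN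
  have h1 := bilin_eq_sum (d3 (energy L) (liftMap X q) (ver (unitNormal L X q.1 q.2)))
    (ver.comp (fderiv ℝ X q.1)) (ver.comp (fderiv ℝ X q.1)) a b
  have h2 (α β : Fin m) : d3 (energy L) (liftMap X q) (ver (unitNormal L X q.1 q.2))
      (ver (fderiv ℝ X q.1 (basisVec α))) (ver (fderiv ℝ X q.1 (basisVec β))) = 0 := by
    have := hM q hq α β
    rw [secondV_eq h hq] at this
    linarith
  simp [h2] at h1
  simp [h1]

theorem SecondVTensorVanishes.secondV (M : SecondVTensorVanishes (energy L) U X O)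
    (hq : q ∈ liftDomain U X O) (α β : Fin m) : secondV L X α β q.1 q.2 = 0 := by
  rw [secondV_eq h hq, M q hq _ (unitNormal_spec h i hq).1, mul_zero]

theorem dSupport_eq (hq : q ∈ liftDomain U X O) (j : Fin n) (β : Fin m) :
    dSupport L X j β q.1 q.2 = supportVec L X q (basisVec β) j := by
  have h1 := clm_apply_eq_sum (fderiv ℝ (fderiv ℝ X) q.1 (basisVec β)) q.2
  have h2 := clm_apply_eq_sum ((fderiv ℝ (sprayVec L) (liftMap X q)).comp ver)
    (fderiv ℝ X q.1 (basisVec β))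
  simp only [ContinuousLinearMap.comp_apply] at h2
  rw [dSupport, supportVec, h1, h2]
  have h3 (k : Fin n) := h.nonlin_eq hq.2 j k
  simp only [fstTS_liftMap, sndTS_liftMap] at h3
  simp only [projB2_eq i hq.1, push, h3, PiLp.add_apply, WithLp.ofLp_sum, Finset.sum_apply,
    PiLp.smul_apply, smul_eq_mul, projB]
  congr 1 <;> exact Finset.sum_congr rfl fun _ _ => mul_comm _ _

theorem normalCurv_eq (hq : q ∈ liftDomain U X O) (γ : Fin m) :
    normalCurv L X γ q.1 q.2 = d2 (energy L) (liftMap X q) (ver (unitNormal L X q.1 q.2))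
      (ver (supportVec L X q (basisVec γ))) := by
  rw [d2_comm h.isEnergy.smooth h.isOpen hq.2, bilin_eq_sum, normalCurv]
  simp only [normalCo, ← dSupport_eq h i hq, ← metric_eq h.isOpen h.smooth hq.2, fstTS_liftMap,
    sndTS_liftMap, push, Finset.sum_mul]
  exact Finset.sum_congr rfl fun j _ => Finset.sum_congr rfl fun k _ => by ring

/-- `N (N · t)` is the normal part of `t`. -/
theorem unitNormal_smul (hq : q ∈ liftDomain U X O) (t : Vec n) :
    d2 (energy L) (liftMap X q) (ver (unitNormal L X q.1 q.2)) (ver t) • unitNormal L X q.1 q.2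
      = t - fderiv ℝ X q.1 (projVec L X q t) := by
  obtain ⟨hu, hu1⟩ := unitNormal_spec h i hq
  obtain ⟨c, hc⟩ := hu.exists_smul_eq h.isCartanSpray i hq (unitNormal_ne_zero h i hq)
    (isNormal_sub_projVec h i hq t)
  have h1 : d2 (energy L) (liftMap X q) (ver (unitNormal L X q.1 q.2))
      (ver (t - fderiv ℝ X q.1 (projVec L X q t))) = c := by
    rw [hc]; simp [hu1]
  rw [map_sub ver, map_sub, hu, sub_zero] at h1
  rw [h1, hc]

/-- The induced nonlinear term is the tangential part of the ambient one. If the latter is already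
tangential, the induced equation for `v` determines the ambient equation for `y`. -/
theorem inducedG_eq (hq : q ∈ liftDomain U X O) (a : Vec m) (α : Fin m) :
    ∑ β, inducedG L X α β q.1 q.2 * a β = projVec L X q (supportVec L X q a) α := by
  have h1 : supportVec L X q a = ∑ β, a β • supportVec L X q (basisVec β) := by
    have := clm_apply_eq_sum ((fderiv ℝ (fderiv ℝ X) q.1).flip q.2
      + (fderiv ℝ (sprayVec L) (liftMap X q)).comp (ver.comp (fderiv ℝ X q.1))) a
    exact this
  simp only [h1, projVec, inducedG, dSupport_eq h i hq, WithLp.ofLp_sum, Finset.sum_apply,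
    Finset.mul_sum, Finset.sum_mul, PiLp.smul_apply, smul_eq_mul]
  rw [Finset.sum_comm]
  exact Finset.sum_congr rfl fun j _ => Finset.sum_congr rfl fun k _ => by ring

/-- The extra term `M^α_β H_γ` disappears with `M`, and only the tangential part of the ambient
acceleration remains. -/
theorem inducedF_eq (M : SecondVTensorVanishes (energy L) U X O) (hq : q ∈ liftDomain U X O)
    (a : Vec m) (α : Fin m) :
    ∑ β, ∑ γ, inducedF L X α β γ q.1 q.2 * a β * a γ = projVec L X q
      (fderiv ℝ (fderiv ℝ X) q.1 a a
        + cartanVec L (liftMap X q) (fderiv ℝ X q.1 a) (fderiv ℝ X q.1 a)) α := by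
  have h1 (j : Fin n) : fderiv ℝ (fderiv ℝ X) q.1 a a j
      = ∑ β, ∑ γ, projB2 X j β γ q.1 * a β * a γ := by
    rw [clm_apply_eq_sum (fderiv ℝ (fderiv ℝ X) q.1) a]
    simp only [sum_apply, smul_apply, clm_apply_eq_sum (fderiv ℝ (fderiv ℝ X) q.1 _) a,
      WithLp.ofLp_sum, Finset.sum_apply, PiLp.smul_apply, smul_eq_mul, Finset.mul_sum,
      projB2_eq i hq.1]
    rw [Finset.sum_comm]
    exact Finset.sum_congr rfl fun j _ => Finset.sum_congr rfl fun k _ => by ring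
  have h2 (j : Fin n) : (fderiv ℝ X q.1 a) j = ∑ β, projB X j β q.1 * a β := by
    rw [clm_apply_eq_sum (fderiv ℝ X q.1) a]
    simp only [WithLp.ofLp_sum, Finset.sum_apply, PiLp.smul_apply, smul_eq_mul, projB]
    exact Finset.sum_congr rfl fun j _ => mul_comm _ _
  have h3 (j : Fin n) : (fderiv ℝ (fderiv ℝ X) q.1 a a
        + cartanVec L (liftMap X q) (fderiv ℝ X q.1 a) (fderiv ℝ X q.1 a)) j =
      ∑ β, ∑ γ, (projB2 X j β γ q.1 + ∑ k, ∑ l, cartanF L j k l (X q.1) (push X q.1 q.2)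
        * projB X k β q.1 * projB X l γ q.1) * a β * a γ := by
    simp only [PiLp.add_apply, h1, cartanVec, h2, fstTS_liftMap, sndTS_liftMap, push, add_mul,
      Finset.sum_add_distrib, Finset.sum_mul, Finset.mul_sum]
    congr 1
    rw [sum_comm₄, Finset.sum_comm]
    refine Finset.sum_congr rfl fun k _ => Finset.sum_congr rfl fun l _ => ?_
    exact Finset.sum_congr rfl fun β _ => Finset.sum_congr rfl fun γ _ => by ring
  simp only [projVec, h3, inducedF, M.secondV h i hq, mul_zero, Finset.sum_const_zero, zero_mul,
    add_zero, Finset.mul_sum, Finset.sum_mul]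
  conv_rhs => rw [Finset.sum_comm]
  refine Finset.sum_congr rfl fun j _ => ?_
  conv_rhs => rw [Finset.sum_comm]
  exact Finset.sum_congr rfl fun k _ => Finset.sum_congr rfl fun r _ => by ring

end Induced

end HypersurfaceCoordinates

/-! ### Hyperplanes of the second and third kind in terms of `H` and `M`. -/

section SecondThirdKind

variable {m n : ℕ} {L : Vec n → Vec n → ℝ} {U : Set (TS (Vec n))} {X : Vec m → Vec n}
  {O : Set (Vec m)} (h : IsFinslerCoord L U) (i : IsImmersedHypersurface X O)

include h

theorem IsFinslerCoord.sum_nonlin {p : TS (Vec n)} (hp : p ∈ U) (j : Fin n) (a : Vec n) :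
    ∑ k, nonlin L j k (fstTS _ p) (sndTS _ p) * a k = fderiv ℝ (sprayVec L) p (ver a) j := by
  have h2 := clm_apply_eq_sum ((fderiv ℝ (sprayVec L) p).comp ver) a
  simp only [ContinuousLinearMap.comp_apply] at h2
  rw [h2]
  simp only [h.nonlin_eq hp, WithLp.ofLp_sum, Finset.sum_apply, PiLp.smul_apply, smul_eq_mul]
  exact Finset.sum_congr rfl fun _ _ => mul_comm _ _

include i

/-- If the normal curvature vector and the second fundamental `v`-tensor vanish, the `h`-paths of
the hypersurface are `h`-paths of the ambient space. -/
theorem hPathsAreHPaths (H : NormalCurvatureVanishes U (sprayVec L) X O)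
    (M : SecondVTensorVanishes (energy L) U X O) : HPathsAreHPaths L X (liftDomain U X O) := by
  intro a b u v hΩ hpath t ht
  obtain ⟨du, ddu, dv, e1, e2⟩ := hpath t ht
  have hq := hΩ t ht
  have hx : deriv (fun s => X (u s)) =ᶠ[𝓝 t] fun s => fderiv ℝ X (u s) (deriv u s) := by
    filter_upwards [Ioo_mem_nhds ht.1 ht.2] with s hs
    exact (i.hasDerivAt_comp (hΩ s hs).1 (hpath s hs).1.hasDerivAt).deriv
  have hx' := (i.hasDerivAt_push hq.1 du.hasDerivAt ddu.hasDerivAt).congr_of_eventuallyEq hx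
  have hy := i.hasDerivAt_push hq.1 du.hasDerivAt dv.hasDerivAt
  have hxt := hx.eq_of_nhds
  refine ⟨(i.hasDerivAt_comp hq.1 du.hasDerivAt).differentiableAt, hx'.differentiableAt,
    hy.differentiableAt, fun j => ?_, fun j => ?_⟩
  · obtain ⟨c, hc⟩ := second_add_cartan_mem_range h.isCartanSpray i (hasNormalFields h i) H M hq
      (deriv u t) (deriv u t)
    -- The acceleration term equals `B c` exactly, so projecting it loses nothing: the induced
    -- equation is `u'' = -c`, and applying `B` gives the ambient one.
    have hu'' : deriv (deriv u) t = -c := by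
      ext α
      have h1 := e1 α
      have h2 := inducedF_eq h i M hq (deriv u t) α
      simp only at h2 hc
      rw [h2, ← hc, ContinuousLinearMap.coe_coe] at h1
      have h3 := projVec_tangent h i hq c
      simp only at h3
      rw [h3] at h1
      simpa using eq_neg_of_add_eq_zero_left h1
    have h4 : fderiv ℝ (fderiv ℝ X) (u t) (deriv u t) (deriv u t)
        + fderiv ℝ X (u t) (deriv (deriv u) t)
        + cartanVec L (liftMap X (u t, v t)) (fderiv ℝ X (u t) (deriv u t))
          (fderiv ℝ X (u t) (deriv u t)) = 0 := by
      simp only [ContinuousLinearMap.coe_coe] at hc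
      rw [hu'', map_neg, hc]
      abel
    have h5 := congrArg (fun w : Vec n => w j) h4
    rw [hx'.deriv, hxt]
    simpa [cartanVec, push] using h5
  · obtain ⟨c, hc⟩ := H _ hq (deriv u t)
    have hv' : deriv v t = -c := by
      ext α
      have h1 := e2 α
      have h2 := inducedG_eq h i hq (deriv u t) α
      simp only [supportVec] at h2 hc
      rw [h2, ← hc, ContinuousLinearMap.coe_coe] at h1
      have h3 := projVec_tangent h i hq c
      simp only at h3
      rw [h3] at h1
      simpa using eq_neg_of_add_eq_zero_left h1
    have h4 : fderiv ℝ (fderiv ℝ X) (u t) (deriv u t) (v t) + fderiv ℝ X (u t) (deriv v t)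
        + fderiv ℝ (sprayVec L) (liftMap X (u t, v t)) (ver (fderiv ℝ X (u t) (deriv u t))) = 0 := by
      simp only [ContinuousLinearMap.coe_coe] at hc
      rw [hv', map_neg, hc]
      abel
    have h5 := congrArg (fun w : Vec n => w j) h4
    have h6 := h.sum_nonlin hq.2 j (fderiv ℝ X (u t) (deriv u t))
    simp only [fstTS_liftMap, sndTS_liftMap] at h6
    simp only [push]
    rw [hy.deriv, hxt, h6]
    exact h5

/-- The terms of the covariant derivative of a normal vector field along a curve. -/
theorem normal_covariant_eq {u v : ℝ → Vec m} {N : Vec n} {t : ℝ} {u' v' : Vec m} {N' : Vec n}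
    (hq : (u t, v t) ∈ liftDomain U X O) (hu : HasDerivAt u u' t) (hv : HasDerivAt v v' t)
    (j : Fin n) :
    N' j + ∑ k, ∑ l, cartanF L j k l (X (u t)) (push X (u t) (v t)) * N k
            * deriv (fun s => X (u s)) t l
        + ∑ k, ∑ l, cartanUp L j k l (X (u t)) (push X (u t) (v t)) * N k
            * (deriv (fun s => push X (u s) (v s)) t l
              + ∑ r, nonlin L l r (X (u t)) (push X (u t) (v t))
                  * deriv (fun s => X (u s)) t r)
      = (N' + cartanVec L (liftMap X (u t, v t)) N (fderiv ℝ X (u t) u') + WithLp.toLp 2 fun i =>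
        ∑ k, ∑ l, cartanUp L i k l (fstTS _ (liftMap X (u t, v t))) (sndTS _ (liftMap X (u t, v t)))
        * N k * (fderiv ℝ (fderiv ℝ X) (u t) u' (v t) + fderiv ℝ X (u t) v'
          + fderiv ℝ (sprayVec L) (liftMap X (u t, v t)) (ver (fderiv ℝ X (u t) u'))) l) j := by
  have hx := (i.hasDerivAt_comp hq.1 hu).deriv
  have hy := (i.hasDerivAt_push hq.1 hu hv).deriv
  have h6 (l : Fin n) := h.sum_nonlin hq.2 l (fderiv ℝ X (u t) u')
  simp only [fstTS_liftMap, sndTS_liftMap] at h6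
  simp only [push]
  rw [hx, hy]
  simp only [h6]
  simp [cartanVec]

theorem normalIsParallel (H : NormalCurvatureVanishes U (sprayVec L) X O)
    (M : SecondVTensorVanishes (energy L) U X O) : NormalIsParallel L X (liftDomain U X O) := by
  intro a b u v N hc t ht j
  obtain ⟨hq, -, du, dv, dN⟩ := hc t ht
  rw [normal_covariant_eq h i hq du.hasDerivAt dv.hasDerivAt, normal_parallel h.isCartanSpray i
    (hasNormalFields h i) H M hq du.hasDerivAt dv.hasDerivAt dN.hasDerivAt _
    (fun a => h.cartanUp_raise hq.2 a _ _)]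
  · rfl
  · filter_upwards [Ioo_mem_nhds ht.1 ht.2] with s hs
    exact (isUnitNormal_iff h (hc s hs).1 _).1 (hc s hs).2.1

/-- Parallelism is tested on unit normal fields along affine curves, which realise every velocity of
supporting elements. -/
theorem vanishes_of_normalIsParallel (hpar : NormalIsParallel L X (liftDomain U X O)) :
    NormalCurvatureVanishes U (sprayVec L) X O ∧ SecondVTensorVanishes (energy L) U X O := by
  refine curvature_vanishes_of_parallel h.isCartanSpray i fun q hq N hN hN1 a c => ?_
  obtain ⟨u, v, Nc, h0, hN0, hu, hv, hev⟩ :=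
    exists_unit_normal_curve h.isCartanSpray i (hasNormalFields h i) hq hN hN1 a c
  obtain ⟨ε, hε, hball⟩ := Metric.eventually_nhds_iff.1 hev
  have hN' := hev.self_of_nhds.2.2.2.2.2.hasDerivAt
  have hq' : (u 0, v 0) ∈ liftDomain U X O := h0 ▸ hq
  refine ⟨u, v, Nc, deriv Nc 0, _, h0, hN0, hu, hv, hN', hev.mono fun s hs => hs.2.1,
    fun d => h.cartanUp_raise hq.2 d _ _, ?_⟩
  ext j
  have h1 := hpar (-ε) ε u v Nc (fun t ht => ?_) 0 ⟨neg_lt_zero.2 hε, hε⟩ j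
  · rw [normal_covariant_eq h i hq' hu hv] at h1
    subst h0 hN0
    exact h1
  · obtain ⟨k1, k2, k3, k4, k5, k6⟩ := hball (y := t) (by simpa [abs_lt] using ht)
    exact ⟨k1, (isUnitNormal_iff h k1 _).2 ⟨k2, k3⟩, k4, k5, k6⟩

end SecondThirdKind

/-! ### Existence of induced `h`-paths, and vanishing of `H` for the second kind. -/

section InducedPaths

variable {m n : ℕ} {L : Vec n → Vec n → ℝ} {U : Set (TS (Vec n))} {X : Vec m → Vec n}
  {O : Set (Vec m)} (h : IsFinslerCoord L U) (i : IsImmersedHypersurface X O)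

include h

theorem IsFinslerCoord.contDiffOn_nonlin (j k : Fin n) : ContDiffOn ℝ ∞ (unc (nonlin L j k)) U :=
  contDiffOn_dY h.isOpen (h.contDiffOn_spray j) k

theorem IsFinslerCoord.contDiffOn_delta {f : Vec n → Vec n → ℝ} (hf : ContDiffOn ℝ ∞ (unc f) U)
    (j : Fin n) : ContDiffOn ℝ ∞ (unc (delta L j f)) U :=
  (contDiffOn_dX h.isOpen hf j).sub (ContDiffOn.sum fun k _ =>
    (h.contDiffOn_nonlin k j).mul (contDiffOn_dY h.isOpen hf k))

theorem IsFinslerCoord.contDiffOn_cartanF (j k l : Fin n) :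
    ContDiffOn ℝ ∞ (unc (cartanF L j k l)) U := by
  have h1 (r : Fin n) := (h.contDiffOn_metricInv j r).mul
    ((contDiffOn_const (c := (1 / 2 : ℝ))).mul
    (((h.contDiffOn_delta (h.contDiffOn_metric r l) k).add
      (h.contDiffOn_delta (h.contDiffOn_metric r k) l)).sub
      (h.contDiffOn_delta (h.contDiffOn_metric k l) r)))
  exact (ContDiffOn.sum (s := Finset.univ) fun r _ => h1 r).congr fun _ _ => rfl

include i

theorem contDiffOn_dSupport (j : Fin n) (β : Fin m) :
    ContDiffOn ℝ ∞ (fun q : Vec m × Vec m => dSupport L X j β q.1 q.2) (liftDomain U X O) := by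
  have h1 (α : Fin m) : ContDiff ℝ ∞ (fun q : Vec m × Vec m => q.2 α) :=
    (EuclideanSpace.proj (𝕜 := ℝ) α).contDiff.comp contDiff_snd
  exact (ContDiffOn.sum fun α _ => (contDiffOn_projB2_fst i j α β).mul (h1 α).contDiffOn).add
    (ContDiffOn.sum fun k _ => (contDiffOn_comp_liftMap i (h.contDiffOn_nonlin j k)).mul
      (contDiffOn_projB_fst i k β))

theorem contDiffOn_inducedG (α β : Fin m) :
    ContDiffOn ℝ ∞ (fun q : Vec m × Vec m => inducedG L X α β q.1 q.2) (liftDomain U X O) :=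
  ContDiffOn.sum fun j _ => (contDiffOn_projInv h i α j).mul (contDiffOn_dSupport h i j β)

/-- The product is even in the unit normal, hence expressible by the normal part of `supportVec`.
This makes `inducedF` smooth although `unitNormal` need not be continuous. -/
theorem secondV_mul_normalCurv {q : Vec m × Vec m} (hq : q ∈ liftDomain U X O) (α β γ : Fin m) :
    secondV L X α β q.1 q.2 * normalCurv L X γ q.1 q.2 = (1 / 2 : ℝ) * d3 (energy L) (liftMap X q)
      (ver (supportVec L X q (basisVec γ)
        - fderiv ℝ X q.1 (projVec L X q (supportVec L X q (basisVec γ)))))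
      (ver (fderiv ℝ X q.1 (basisVec α))) (ver (fderiv ℝ X q.1 (basisVec β))) := by
  rw [secondV_eq h hq, normalCurv_eq h i hq, ← unitNormal_smul h i hq]
  simp only [map_smul, smul_apply, smul_eq_mul]
  ring

theorem contDiffOn_secondV_mul_normalCurv (α β γ : Fin m) : ContDiffOn ℝ ∞
    (fun q : Vec m × Vec m => secondV L X α β q.1 q.2 * normalCurv L X γ q.1 q.2)
    (liftDomain U X O) := by
  have hl : ContDiffOn ℝ ∞ (liftMap X) (liftDomain U X O) :=
    i.contDiffOn_liftMap.mono fun q hq => ⟨hq.1, trivial⟩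
  have hd : ContDiffOn ℝ ∞ (fun q => d3 (energy L) (liftMap X q)) (liftDomain U X O) :=
    (contDiffOn_d3 h.isEnergy.smooth h.isOpen).comp hl fun q hq => hq.2
  have hB : ContDiffOn ℝ ∞ (fun q : Vec m × Vec m => fderiv ℝ X q.1) (liftDomain U X O) :=
    (contDiffOn_fderiv i.smooth i.isOpen).comp contDiffOn_fst fun q hq => hq.1
  have hs : ContDiffOn ℝ ∞ (fun q => supportVec L X q (basisVec γ)) (liftDomain U X O) :=
    contDiffOn_euclidean.2 fun j =>
      (contDiffOn_dSupport h i j γ).congr fun q hq => (dSupport_eq h i hq j γ).symm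
  have hp : ContDiffOn ℝ ∞ (fun q => projVec L X q (supportVec L X q (basisVec γ)))
      (liftDomain U X O) := contDiffOn_euclidean.2 fun ε => by
    simp only [projVec]
    exact ContDiffOn.sum fun j _ => (contDiffOn_projInv h i ε j).mul (contDiffOn_euclidean.1 hs j)
  have hv (a : Vec m) : ContDiffOn ℝ ∞ (fun q : Vec m × Vec m => ver (fderiv ℝ X q.1 a))
      (liftDomain U X O) := ver.contDiff.comp_contDiffOn (hB.clm_apply contDiffOn_const)
  have ht := ver.contDiff.comp_contDiffOn (n := ∞) (hs.sub (hB.clm_apply hp))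
  exact (contDiffOn_const.mul (((hd.clm_apply ht).clm_apply (hv (basisVec α))).clm_apply
    (hv (basisVec β)))).congr fun q hq => secondV_mul_normalCurv h i hq α β γ

theorem contDiffOn_inducedF (α β γ : Fin m) :
    ContDiffOn ℝ ∞ (fun q : Vec m × Vec m => inducedF L X α β γ q.1 q.2) (liftDomain U X O) := by
  have h1 : ContDiffOn ℝ ∞ (fun q : Vec m × Vec m =>
      ∑ j, projInv L X α j q.1 q.2 * (projB2 X j β γ q.1
        + ∑ k, ∑ l, cartanF L j k l (X q.1) (push X q.1 q.2) * projB X k β q.1 * projB X l γ q.1))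
      (liftDomain U X O) :=
    ContDiffOn.sum fun j _ => (contDiffOn_projInv h i α j).mul ((contDiffOn_projB2_fst i j β γ).add
      (ContDiffOn.sum fun k _ => ContDiffOn.sum fun l _ =>
        ((contDiffOn_comp_liftMap i (h.contDiffOn_cartanF j k l)).mul
          (contDiffOn_projB_fst i k β)).mul (contDiffOn_projB_fst i l γ)))
  have h2 : ContDiffOn ℝ ∞ (fun q : Vec m × Vec m =>
      ∑ δ, metricInv (inducedL L X) q.1 q.2 α δ
        * (secondV L X δ β q.1 q.2 * normalCurv L X γ q.1 q.2)) (liftDomain U X O) :=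
    ContDiffOn.sum fun δ _ => (contDiffOn_inducedMetricInv h i α δ).mul
      (contDiffOn_secondV_mul_normalCurv h i δ β γ)
  refine (h1.add h2).congr fun q _ => ?_
  simp only [inducedF, Finset.sum_mul, mul_assoc]

/-- Through every supporting element there passes an `h`-path of the hypersurface in every
direction. -/
theorem exists_induced_hPath {q : Vec m × Vec m} (hq : q ∈ liftDomain U X O) (w : Vec m) :
    ∃ ε > (0 : ℝ), ∃ u v : ℝ → Vec m, (u 0, v 0) = q ∧ deriv u 0 = w ∧
      (∀ t ∈ Set.Ioo (-ε) ε, (u t, v t) ∈ liftDomain U X O) ∧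
      IsHPath (inducedF L X) (inducedG L X) u v (Set.Ioo (-ε) ε) := by
  have hΩ := i.isOpen_liftDomain h.isOpen
  -- The `h`-path equations as a first-order autonomous system for `(u, v, u')`.
  set f : Vec m × Vec m × Vec m → Vec m × Vec m × Vec m := fun z => (z.2.2,
    WithLp.toLp 2 fun α => -∑ β, inducedG L X α β z.1 z.2.1 * z.2.2 β,
    WithLp.toLp 2 fun α => -∑ β, ∑ γ, inducedF L X α β γ z.1 z.2.1 * z.2.2 β * z.2.2 γ) with hf
  have hπ : ContDiffAt ℝ 1 (fun z : Vec m × Vec m × Vec m => (z.1, z.2.1)) (q.1, q.2, w) :=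
    (contDiff_fst.prodMk (contDiff_fst.comp contDiff_snd)).contDiffAt
  have hw (α : Fin m) : ContDiffAt ℝ 1 (fun z : Vec m × Vec m × Vec m => z.2.2 α) (q.1, q.2, w) :=
    ((EuclideanSpace.proj (𝕜 := ℝ) α).contDiff.comp
      (contDiff_snd.comp contDiff_snd)).contDiffAt
  have hc {g : Vec m × Vec m → ℝ} (hg : ContDiffOn ℝ ∞ g (liftDomain U X O)) :
      ContDiffAt ℝ 1 (fun z : Vec m × Vec m × Vec m => g (z.1, z.2.1)) (q.1, q.2, w) :=
    ContDiffAt.comp (g := g) (q.1, q.2, w)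
      ((hg.contDiffAt (hΩ.mem_nhds hq)).of_le (by exact_mod_cast le_top)) hπ
  have hsm : ContDiffAt ℝ 1 f (q.1, q.2, w) := by
    refine (contDiff_snd.comp contDiff_snd).contDiffAt.prodMk (ContDiffAt.prodMk ?_ ?_)
    · exact contDiffAt_euclidean.2 fun α => (ContDiffAt.sum fun β _ =>
        (hc (contDiffOn_inducedG h i α β)).mul (hw β)).neg
    · exact contDiffAt_euclidean.2 fun α => (ContDiffAt.sum fun β _ => ContDiffAt.sum fun γ _ =>
        ((hc (contDiffOn_inducedF h i α β γ)).mul (hw β)).mul (hw γ)).neg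
  obtain ⟨z, hz0, ε, hε, hz⟩ :=
    hsm.exists_forall_mem_closedBall_exists_eq_forall_mem_Ioo_hasDerivAt₀ 0
  rw [zero_sub, zero_add] at hz
  have hz0' := hz 0 ⟨neg_lt_zero.2 hε, hε⟩
  have hmem : ∀ᶠ t in 𝓝 (0 : ℝ), ((z t).1, (z t).2.1) ∈ liftDomain U X O := by
    have hcont : ContinuousAt (fun t => ((z t).1, (z t).2.1)) 0 :=
      hz0'.continuousAt.fst.prodMk hz0'.continuousAt.snd.fst
    refine hcont.eventually_mem (hΩ.mem_nhds ?_)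
    rw [hz0]; exact hq
  obtain ⟨δ, hδ, hball⟩ := Metric.eventually_nhds_iff.1 hmem
  have hu : ∀ t ∈ Set.Ioo (-ε) ε, HasDerivAt (fun t => (z t).1) (z t).2.2 t := fun t ht =>
    (hz t ht).fst
  have hv : ∀ t ∈ Set.Ioo (-ε) ε, HasDerivAt (fun t => (z t).2.1) (f (z t)).2.1 t := fun t ht =>
    (hz t ht).snd.fst
  have hw : ∀ t ∈ Set.Ioo (-ε) ε, HasDerivAt (fun t => (z t).2.2) (f (z t)).2.2 t := fun t ht =>
    (hz t ht).snd.snd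
  refine ⟨min ε δ, lt_min hε hδ, fun t => (z t).1, fun t => (z t).2.1, ?_, ?_, fun t ht => ?_,
    fun t ht => ?_⟩
  · simp only [hz0]
  · rw [(hu 0 ⟨neg_lt_zero.2 hε, hε⟩).deriv, hz0]
  · exact hball (by
      rw [Real.dist_eq, sub_zero, abs_lt]
      exact ⟨(neg_le_neg (min_le_right _ _)).trans_lt ht.1, ht.2.trans_le (min_le_right _ _)⟩)
  · have ht' : t ∈ Set.Ioo (-ε) ε :=
      ⟨(neg_le_neg (min_le_left _ _)).trans_lt ht.1, ht.2.trans_le (min_le_left _ _)⟩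
    have hev : deriv (fun t => (z t).1) =ᶠ[𝓝 t] fun t => (z t).2.2 := by
      filter_upwards [Ioo_mem_nhds ht'.1 ht'.2] with s hs
      exact (hu s hs).deriv
    have hw' := (hw t ht').congr_of_eventuallyEq hev
    refine ⟨(hu t ht').differentiableAt, hw'.differentiableAt, (hv t ht').differentiableAt,
      fun α => ?_, fun α => ?_⟩
    · rw [hw'.deriv, hev.eq_of_nhds]
      simp [hf]
    · rw [(hv t ht').deriv, hev.eq_of_nhds]
      simp [hf]

/-- If the `h`-paths of the hypersurface are `h`-paths of the ambient space, the normal curvature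
vector vanishes. -/
theorem normalCurvatureVanishes_of_hPaths (hp : HPathsAreHPaths L X (liftDomain U X O)) :
    NormalCurvatureVanishes U (sprayVec L) X O := by
  intro q hq w
  obtain ⟨ε, hε, u, v, h0, hw, hΩ, hpath⟩ := exists_induced_hPath h i hq w
  have h0ε : (0 : ℝ) ∈ Set.Ioo (-ε) ε := ⟨neg_lt_zero.2 hε, hε⟩
  obtain ⟨-, -, -, -, h2⟩ := hp _ _ u v hΩ hpath 0 h0ε
  obtain ⟨du, -, dv, -⟩ := hpath 0 h0ε
  have hq' := hΩ 0 h0ε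
  -- The ambient equation for `y` reads `B_0w + B v' + G(B w) = 0`, so the curvature vector is `-B
  -- v'`.
  refine ⟨-deriv v 0, ?_⟩
  rw [map_neg, neg_eq_iff_add_eq_zero, ContinuousLinearMap.coe_coe]
  ext j
  have h3 := h2 j
  have h6 := h.sum_nonlin hq'.2 j (fderiv ℝ X (u 0) (deriv u 0))
  simp only [fstTS_liftMap, sndTS_liftMap] at h6
  simp only [push] at h3
  rw [(i.hasDerivAt_comp hq'.1 du.hasDerivAt).deriv,
    (i.hasDerivAt_push hq'.1 du.hasDerivAt dv.hasDerivAt).deriv, h6, hw] at h3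
  subst h0
  simp only [PiLp.add_apply, PiLp.zero_apply] at h3 ⊢
  linarith

end InducedPaths

/-! ### Gradient `h`-vectors and the function `β`. -/

section HVector

variable {n : ℕ} {L K : Vec n → Vec n → ℝ} {b : Fin n → Vec n → Vec n → ℝ} {ρ : TS (Vec n) → ℝ}
  {U : Set (TS (Vec n))}

/-- The function `β = b_i(x,y) yⁱ`. -/
def covFun (b : Fin n → Vec n → Vec n → ℝ) (p : TS (Vec n)) : ℝ :=
  ∑ i, unc (b i) p * sndTS _ p i

/-- A gradient `h`-vector in a coordinate system. -/
structure IsGradientHVector (L : Vec n → Vec n → ℝ) (b : Fin n → Vec n → Vec n → ℝ)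
    (ρ : TS (Vec n) → ℝ) (U : Set (TS (Vec n))) : Prop where
  smooth : ∀ i, ContDiffOn ℝ ∞ (unc (b i)) U
  vCov_eq_zero : ∀ p ∈ U, ∀ i j, vCov L b i j (fstTS _ p) (sndTS _ p) = 0
  scalar : ∀ p ∈ U, ∀ i j, unc L p * ∑ h, cartanUp L h i j (fstTS _ p) (sndTS _ p) * unc (b h) p
    = ρ p * angular L i j (fstTS _ p) (sndTS _ p)
  gradient : ∀ p ∈ U, ∀ i j,
    hCov L b i j (fstTS _ p) (sndTS _ p) = hCov L b j i (fstTS _ p) (sndTS _ p)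

namespace IsFinslerCoord

variable (h : IsFinslerCoord L U) {p : TS (Vec n)} (hp : p ∈ U)

include h hp

theorem d2_ver_self (a : Vec n) : d2 (unc L) p (ver a) (ver (sndTS _ p)) = 0 := by
  have hl : HasFDerivAt (fun q : TS (Vec n) => ver (sndTS _ q)) (ver.comp (sndTS (Vec n))) p :=
    (ver.comp (sndTS (Vec n))).hasFDerivAt
  have h1 := (hasFDerivAt_d1 h.smooth h.isOpen hp).clm_apply hl
  have := DFunLike.congr_fun (fderiv_unique_of_eqOn h.isOpen hp h1
    (hasFDerivAt_d0 h.smooth h.isOpen hp) h.homog) (ver a)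
  simpa using this

theorem cartanF_symm (i j k : Fin n) : cartanF L i j k (fstTS _ p) (sndTS _ p)
    = cartanF L i k j (fstTS _ p) (sndTS _ p) := by
  have := congrArg (fun w : Vec n => w i)
    (h.isCartanSpray.cartan_symm hp (basisVec j) (basisVec k))
  simpa [cartanVec, basisVec] using this

end IsFinslerCoord

theorem contDiffOn_covFun (hb : ∀ i, ContDiffOn ℝ ∞ (unc (b i)) U) :
    ContDiffOn ℝ ∞ (covFun b) U :=
  ContDiffOn.sum fun i _ => (hb i).mul
    ((EuclideanSpace.proj (𝕜 := ℝ) i).comp (sndTS (Vec n))).contDiff.contDiffOn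

namespace IsGradientHVector

variable (h : IsFinslerCoord L U) (hb : IsGradientHVector L b ρ U) (hpos : ∀ p ∈ U, 0 < unc L p)
  {p : TS (Vec n)} (hp : p ∈ U)

include h hb hp

section

include hpos

/-- From `b_i|_j = 0` one has `∂̇_j b_i = C^r_ij b_r`, which is `ρ h_ij / L = ρ ∂̇_i ∂̇_j L`. -/
theorem d1_component (i : Fin n) (a : Vec n) :
    d1 (unc (b i)) p (ver a) = ρ p * d2 (unc L) p (ver (basisVec i)) (ver a) := by
  suffices hs : (d1 (unc (b i)) p).comp ver
      = ρ p • (d2 (unc L) p (ver (basisVec i))).comp ver from DFunLike.congr_fun hs a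
  refine clm_ext_basis fun j => ?_
  have h1 := hb.vCov_eq_zero p hp i j
  have h2 := hb.scalar p hp i j
  rw [vCov, dY_eq (hasFDerivAt_d0 (hb.smooth i) h.isOpen hp)] at h1
  rw [angular, dY_eq (hasFDerivAt_d0 (contDiffOn_dY h.isOpen h.smooth j) h.isOpen hp),
    d1_dY h.isOpen h.smooth hp] at h2
  simp only [ContinuousLinearMap.comp_apply, smul_apply, smul_eq_mul]
  refine mul_left_cancel₀ (hpos p hp).ne' ?_
  rw [sub_eq_zero.1 h1]
  refine h2.trans ?_
  simp only [unc]
  ring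

end

theorem d1_covFun_apply (ξ : TS (Vec n)) : d1 (covFun b) p ξ
    = ∑ i, (d1 (unc (b i)) p ξ * sndTS _ p i + unc (b i) p * sndTS _ ξ i) := by
  have h1 (i : Fin n) : HasFDerivAt (fun p : TS (Vec n) => sndTS _ p i)
      ((EuclideanSpace.proj (𝕜 := ℝ) i).comp (sndTS (Vec n))) p :=
    ((EuclideanSpace.proj (𝕜 := ℝ) i).comp (sndTS (Vec n))).hasFDerivAt
  have h2 : HasFDerivAt (covFun b) _ p := HasFDerivAt.fun_sum (u := Finset.univ) fun i _ =>
    (hasFDerivAt_d0 (hb.smooth i) h.isOpen hp).mul (h1 i)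
  rw [d1, h2.fderiv]
  simp only [sum_apply, add_apply, smul_apply, smul_eq_mul, ContinuousLinearMap.comp_apply,
    PiLp.proj_apply]
  exact Finset.sum_congr rfl fun i _ => by ring

include hpos

/-- The fibre derivative of `b_i` contributes nothing: it is `ρ ∂̇∂̇L`, which vanishes when
contracted with `y`. -/
theorem d1_covFun_ver (a : Vec n) : d1 (covFun b) p (ver a) = ∑ i, unc (b i) p * a i := by
  rw [hb.d1_covFun_apply h hp, Finset.sum_add_distrib]
  have h1 := clm_apply_eq_sum (((d2 (unc L) p).flip (ver a)).comp ver) (sndTS _ p)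
  simp only [ContinuousLinearMap.comp_apply, ContinuousLinearMap.flip_apply, smul_eq_mul] at h1
  have h2 : ∑ i, d1 (unc (b i)) p (ver a) * sndTS _ p i = 0 := by
    simp only [hb.d1_component h hpos hp]
    calc _ = ρ p * ∑ i, sndTS _ p i * d2 (unc L) p (ver (basisVec i)) (ver a) := by
          rw [Finset.mul_sum]; exact Finset.sum_congr rfl fun _ _ => by ring
      _ = 0 := by
          rw [← h1, d2_comm h.smooth h.isOpen hp, h.d2_ver_self hp, mul_zero]
  rw [h2, zero_add]
  simp

theorem d2_covFun_ver (ξ : TS (Vec n)) (a : Vec n) :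
    d2 (covFun b) p ξ (ver a) = ∑ i, d1 (unc (b i)) p ξ * a i := by
  have h1 := (hasFDerivAt_d1 (contDiffOn_covFun hb.smooth) h.isOpen hp).clm_apply
    (hasFDerivAt_const (ver a) p)
  have h2 : HasFDerivAt (fun p => ∑ i, unc (b i) p * a i) _ p :=
    HasFDerivAt.fun_sum (u := Finset.univ) fun i _ =>
      (hasFDerivAt_d0 (hb.smooth i) h.isOpen hp).mul_const (a i)
  have := DFunLike.congr_fun (fderiv_unique_of_eqOn h.isOpen hp h1 h2
    fun q hq => hb.d1_covFun_ver h hpos hq a) ξ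
  simp only [add_apply, ContinuousLinearMap.comp_apply, ContinuousLinearMap.flip_apply, zero_apply,
    map_zero, zero_add, sum_apply, smul_apply, smul_eq_mul] at this
  rw [this]
  exact Finset.sum_congr rfl fun _ _ => mul_comm _ _

theorem d2_covFun_ver_ver (a c : Vec n) :
    d2 (covFun b) p (ver a) (ver c) = ρ p * d2 (unc L) p (ver a) (ver c) := by
  rw [hb.d2_covFun_ver h hpos hp, d2_comm h.smooth h.isOpen hp]
  have h1 := clm_apply_eq_sum (((d2 (unc L) p).flip (ver a)).comp ver) c
  simp only [ContinuousLinearMap.comp_apply, ContinuousLinearMap.flip_apply, smul_eq_mul] at h1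
  rw [h1, Finset.mul_sum]
  simp only [hb.d1_component h hpos hp]
  exact Finset.sum_congr rfl fun _ _ => by ring

/-- `β` satisfies the Euler-Lagrange equations along the spray. -/
theorem two_mul_d2_covFun_spray (c : Vec n) : 2 * d2 (covFun b) p (ver c) (ver (sprayVec L p)) =
    d2 (covFun b) p (hor (sndTS _ p)) (ver c) - d1 (covFun b) p (hor c) := by
  set T : Vec n →L[ℝ] TS (Vec n) :=
    hor - ver.comp ((fderiv ℝ (sprayVec L) p).comp ver) with hT
  -- The term with `F` in `b_{i|j}` is symmetric, so the gradient condition is `δ_j b_i = δ_i b_j`.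
  have h1 (i j : Fin n) : d2 (covFun b) p (T (basisVec j)) (ver (basisVec i))
      = d2 (covFun b) p (T (basisVec i)) (ver (basisVec j)) := by
    have h2 := hb.gradient p hp i j
    simp only [hCov, h.cartanF_symm hp _ i j, sub_left_inj, h.delta_eq hp (hb.smooth _)] at h2
    rw [hb.d2_covFun_ver h hpos hp, hb.d2_covFun_ver h hpos hp]
    simpa [basisVec, hT] using h2
  have h3 (a c : Vec n) : d2 (covFun b) p (T a) (ver c) = d2 (covFun b) p (T c) (ver a) := by
    rw [bilin_eq_sum, bilin_eq_sum _ _ _ c a, Finset.sum_comm]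
    exact Finset.sum_congr rfl fun i _ => Finset.sum_congr rfl fun j _ => by rw [h1]; ring
  -- Contraction with `y`: `T y` is the spray direction `hor y - 2 ver G`, and the vertical part of
  -- `T c` is lost because `∂̇∂̇β(·, y) = 0`.
  have h4 := h3 (sndTS _ p) c
  have h5 : d2 (covFun b) p (hor c) (ver (sndTS _ p)) = d1 (covFun b) p (hor c) := by
    rw [hb.d2_covFun_ver h hpos hp, hb.d1_covFun_apply h hp]
    simp
  simp only [hT, sub_apply, ContinuousLinearMap.comp_apply, map_sub,
    h.isCartanSpray.fderiv_spray_self hp, map_smul, smul_apply, smul_eq_mul, h5,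
    hb.d2_covFun_ver_ver h hpos hp _ (sndTS _ p), h.d2_ver_self hp, mul_zero, sub_zero] at h4
  rw [d2_comm (contDiffOn_covFun hb.smooth) h.isOpen hp]
  linarith

end IsGradientHVector

section Kropina

variable {m : ℕ} {X : Vec m → Vec n} {O : Set (Vec m)} (h : IsFinslerCoord L U)
  (h' : IsFinslerCoord K U) (hb : IsGradientHVector L b ρ U) (hL : ∀ p ∈ U, 0 < unc L p)
  (hβ : ∀ p ∈ U, 0 < covFun b p) (hK : ∀ p ∈ U, unc K p * covFun b p = unc L p * unc L p)
  (i : IsImmersedHypersurface X O)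
  (ht : ∀ q ∈ liftDomain U X O,
    ∑ j, b j (X q.1) (push X q.1 q.2) * unitNormal L X q.1 q.2 j = 0)

include h h' hb hL hβ hK i ht

/-- Tangentiality of `b` enters as `∂̇β(N) = b_i Nⁱ = 0`, first for the unit normal and then for its
multiples. -/
theorem kropina_normal_coord {q : Vec m × Vec m} (hq : q ∈ liftDomain U X O) {N : Vec n}
    (hN : IsNormal (energy L) X q N) : IsNormal (energy K) X q N ∧
      d2 (energy L) (liftMap X q) (ver N)
        (ver (sprayVec K (liftMap X q) - sprayVec L (liftMap X q))) = 0 := by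
  refine kropina_normal h.isCartanSpray h'.isCartanSpray h.smooth (contDiffOn_covFun hb.smooth)
    h'.smooth hL hβ hK (fun p _ => energy_add_energy L p) (fun p _ => energy_add_energy K p)
    (fun p hp => hb.d2_covFun_ver_ver h hL hp)
    (fun p hp => hb.two_mul_d2_covFun_spray h hL hp) hq hN ?_
  obtain ⟨c, rfl⟩ := (unitNormal_spec h i hq).1.exists_smul_eq h.isCartanSpray i hq
    (unitNormal_ne_zero h i hq) hN
  have h1 := ht q hq
  rw [map_smul, map_smul, hb.d1_covFun_ver h hL hq.2]
  simp only [unc, fstTS_liftMap, sndTS_liftMap]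
  simp only [push] at h1
  rw [h1, smul_zero]

theorem kropina_vanishes (H : NormalCurvatureVanishes U (sprayVec L) X O)
    (M : SecondVTensorVanishes (energy L) U X O) :
    NormalCurvatureVanishes U (sprayVec K) X O ∧ SecondVTensorVanishes (energy K) U X O :=
  have k := fun {q : Vec m × Vec m} (hq : q ∈ liftDomain U X O) {N : Vec n}
    (hN : IsNormal (energy L) X q N) => kropina_normal_coord h h' hb hL hβ hK i ht hq hN
  ⟨H.transfer h.isCartanSpray h'.isCartanSpray i fun _ hq _ hN => (k hq hN).2,
    M.transfer h.isCartanSpray h'.isCartanSpray i (hasNormalFields h i)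
      fun _ hq _ hN => (k hq hN).1⟩

theorem kropina_hPathsAreHPaths (hp : HPathsAreHPaths L X (liftDomain U X O))
    (hM : ∀ q ∈ liftDomain U X O, ∀ α β, secondV L X α β q.1 q.2 = 0) :
    HPathsAreHPaths K X (liftDomain U X O) :=
  have k := kropina_vanishes h h' hb hL hβ hK i ht (normalCurvatureVanishes_of_hPaths h i hp)
    (secondVTensorVanishes h i hM)
  hPathsAreHPaths h' i k.1 k.2

theorem kropina_normalIsParallel (hp : NormalIsParallel L X (liftDomain U X O)) :
    NormalIsParallel K X (liftDomain U X O) :=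
  have k₀ := vanishes_of_normalIsParallel h i hp
  have k := kropina_vanishes h h' hb hL hβ hK i ht k₀.1 k₀.2
  normalIsParallel h' i k.1 k.2

end Kropina

end HVector

/-! ### Passage from the manifold to charts. -/

section Charts

variable {n : ℕ} {M : Type*} [TopologicalSpace M] [ChartedSpace (Vec n) M]

theorem mdifferentiable_of_mem_maximalAtlas {φ : OpenPartialHomeomorph M (Vec n)}
    (hφ : φ ∈ IsManifold.maximalAtlas (𝓡 n) ∞ M) : φ.MDifferentiable (𝓡 n) (𝓡 n) :=
  ⟨(contMDiffOn_of_mem_maximalAtlas hφ).mdifferentiableOn (by simp),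
    (contMDiffOn_symm_of_mem_maximalAtlas hφ).mdifferentiableOn (by simp)⟩

theorem coordPoint_smul (φ : OpenPartialHomeomorph M (Vec n)) (x y : Vec n) (c : ℝ) :
    coordPoint φ x (c • y) = ⟨(coordPoint φ x y).proj, c • (coordPoint φ x y).snd⟩ :=
  congrArg (fun w => (⟨φ.symm x, w⟩ : TangentBundle (𝓡 n) M))
    ((mfderiv (𝓡 n) (𝓡 n) φ.symm x).map_smul c y)

/-- The coordinate expression of a set of tangent vectors as a subset of `TS`. -/
def coordSet (φ : OpenPartialHomeomorph M (Vec n)) (D : Set (TangentBundle (𝓡 n) M)) :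
    Set (TS (Vec n)) :=
  {p | (fstTS _ p, sndTS _ p) ∈ coordDomain φ D}

theorem contDiffOn_unc {φ : OpenPartialHomeomorph M (Vec n)} {D : Set (TangentBundle (𝓡 n) M)}
    {f : Vec n → Vec n → ℝ}
    (hf : ContDiffOn ℝ ∞ (fun p : Vec n × Vec n => f p.1 p.2) (coordDomain φ D)) :
    ContDiffOn ℝ ∞ (unc f) (coordSet φ D) :=
  hf.comp (g := fun p : Vec n × Vec n => f p.1 p.2)
    (f := fun p : TS (Vec n) => (fstTS _ p, sndTS _ p))
    ((fstTS (Vec n)).prod (sndTS (Vec n))).contDiff.contDiffOn fun _ hp => hp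

theorem covFun_coordCov (φ : OpenPartialHomeomorph M (Vec n))
    (b : (p : TangentBundle (𝓡 n) M) → TangentSpace (𝓡 n) p.proj →L[ℝ] ℝ) (p : TS (Vec n)) :
    covFun (coordCov φ b) p = b (coordPoint φ (fstTS _ p) (sndTS _ p))
      (coordPoint φ (fstTS _ p) (sndTS _ p)).snd := by
  have h1 := clm_apply_eq_sum (((b (coordPoint φ (fstTS _ p) (sndTS _ p))).comp
    (mfderiv (𝓡 n) (𝓡 n) φ.symm (fstTS _ p)) : Vec n →L[ℝ] ℝ)) (sndTS _ p)
  refine Eq.trans ?_ h1.symm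
  exact Finset.sum_congr rfl fun i _ => mul_comm _ _

variable [IsManifold (𝓡 n) ∞ M]

/-- `coordPoint φ` is the tangent map of the inverse chart, which is continuous over the open
target. -/
theorem isOpen_coordDomain {φ : OpenPartialHomeomorph M (Vec n)}
    (hφ : φ ∈ IsManifold.maximalAtlas (𝓡 n) ∞ M) {D : Set (TangentBundle (𝓡 n) M)}
    (hD : IsOpen D) : IsOpen (coordDomain φ D) := by
  have : IsManifold (𝓡 n) 1 M := IsManifold.of_le (n := ∞) (by simp)
  have h1 : ContinuousOn (tangentMapWithin (𝓡 n) (𝓡 n) φ.symm φ.target) _ :=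
    (contMDiffOn_symm_of_mem_maximalAtlas hφ).continuousOn_tangentMapWithin (by simp)
      φ.open_target.uniqueMDiffOn
  have h2 : Continuous fun p : Vec n × Vec n =>
      ((⟨p.1, p.2⟩ : TangentBundle (𝓡 n) (Vec n))) :=
    (tangentBundleModelSpaceHomeomorph (𝓡 n)).symm.continuous
  have h3 : ContinuousOn (fun p : Vec n × Vec n => coordPoint φ p.1 p.2)
      (φ.target ×ˢ Set.univ) := by
    refine (h1.comp (g := tangentMapWithin (𝓡 n) (𝓡 n) φ.symm φ.target) h2.continuousOn
      (s := φ.target ×ˢ Set.univ) fun p hp => hp.1).congr fun p hp => ?_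
    exact (tangentMapWithin_eq_tangentMap (p := (⟨p.1, p.2⟩ : TangentBundle (𝓡 n) (Vec n)))
      (φ.open_target.uniqueMDiffOn _ hp.1)
      ((mdifferentiable_of_mem_maximalAtlas hφ).mdifferentiableAt_symm hp.1)).symm
  have h4 := h3.isOpen_inter_preimage (φ.open_target.prod isOpen_univ) hD
  convert h4 using 1
  ext p
  simp [coordDomain]

variable {D : Set (TangentBundle (𝓡 n) M)} {L : TangentBundle (𝓡 n) M → ℝ}

/-- The coordinate expression of a Finsler metric. -/
theorem IsFinslerMetric.isFinslerCoord (hL : IsFinslerMetric D L)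
    {φ : OpenPartialHomeomorph M (Vec n)} (hφ : φ ∈ IsManifold.maximalAtlas (𝓡 n) ∞ M) :
    IsFinslerCoord (coordFun φ L) (coordSet φ D) := by
  have ho : IsOpen (coordSet φ D) := (isOpen_coordDomain hφ hL.isOpen).preimage
    ((fstTS (Vec n)).prod (sndTS (Vec n))).continuous
  have hs := contDiffOn_unc (hL.smooth φ hφ)
  refine ⟨ho, hs, fun p hp => ?_, fun p hp => hL.posDef φ hφ _ _ hp⟩
  -- Euler's relation is the derivative of homogeneity at `c = 1` along the ray `(x, c y)`.
  have hc : HasDerivAt (fun c : ℝ => p + (c - 1) • ver (sndTS _ p)) (ver (sndTS _ p)) 1 := by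
    simpa using (((hasDerivAt_id (1 : ℝ)).sub_const 1).smul_const (ver (sndTS _ p))).const_add p
  have h0 : HasFDerivAt (unc (coordFun φ L)) (d1 (unc (coordFun φ L)) p)
      (p + ((1 : ℝ) - 1) • ver (sndTS _ p)) := by
    simpa using hasFDerivAt_d0 hs ho hp
  have h1 := h0.comp_hasDerivAt (1 : ℝ) hc
  have h2 : HasDerivAt (fun c : ℝ => c * unc (coordFun φ L) p) (unc (coordFun φ L) p) 1 := by
    simpa using (hasDerivAt_id (1 : ℝ)).mul_const (unc (coordFun φ L) p)
  refine h1.unique (h2.congr_of_eventuallyEq ?_)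
  filter_upwards [Ioi_mem_nhds (zero_lt_one : (0 : ℝ) < 1)] with c hc
  have e1 : fstTS _ (p + (c - 1) • ver (sndTS _ p)) = fstTS _ p := by
    rw [map_add, map_smul]
    have : fstTS _ (ver (sndTS _ p)) = (0 : Vec n) := rfl
    rw [this, smul_zero, add_zero]
  have e2 : sndTS _ (p + (c - 1) • ver (sndTS _ p)) = c • sndTS _ p := by
    rw [map_add, map_smul, sndTS_ver, sub_smul, one_smul, add_sub_cancel]
  simp only [Function.comp_apply, unc, e1, e2, coordFun, coordPoint_smul]
  exact hL.homog _ hp.2 c hc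

end Charts

/-! ### Immersed hypersurfaces in charts. -/

section Immersions

variable {m n : ℕ} {M : Type*} [TopologicalSpace M] [ChartedSpace (Vec n) M]
  {S : Type*} [TopologicalSpace S] [ChartedSpace (Vec m) S]

/-- The coordinates of the points of the hypersurface in the domain of a chart. -/
def coordOpen (φ : OpenPartialHomeomorph M (Vec n)) (ψ : OpenPartialHomeomorph S (Vec m))
    (ι : S → M) : Set (Vec m) :=
  ψ.target ∩ (fun u => ι (ψ.symm u)) ⁻¹' φ.source

omit [ChartedSpace (Vec m) S] in
theorem hypDomain_eq (φ : OpenPartialHomeomorph M (Vec n)) (ψ : OpenPartialHomeomorph S (Vec m))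
    (D : Set (TangentBundle (𝓡 n) M)) (ι : S → M) : hypDomain φ ψ D ι
      = liftDomain (coordSet φ D) (coordMap φ ψ ι) (coordOpen φ ψ ι) := by
  ext q
  simp only [hypDomain, liftDomain, coordSet, coordOpen, Set.mem_ofPred_eq, fstTS_liftMap,
    sndTS_liftMap, push, Set.mem_inter_iff, Set.mem_preimage, and_assoc]

theorem isImmersedHypersurface_coordMap (hmn : n = m + 1) {ι : S → M}
    (hι : ContMDiff (𝓡 m) (𝓡 n) ∞ ι)
    (hι' : ∀ s, Function.Injective (mfderiv (𝓡 m) (𝓡 n) ι s))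
    {φ : OpenPartialHomeomorph M (Vec n)} (hφ : φ ∈ IsManifold.maximalAtlas (𝓡 n) ∞ M)
    {ψ : OpenPartialHomeomorph S (Vec m)} (hψ : ψ ∈ IsManifold.maximalAtlas (𝓡 m) ∞ S) :
    IsImmersedHypersurface (coordMap φ ψ ι) (coordOpen φ ψ ι) where
  isOpen := (hι.continuous.comp_continuousOn ψ.continuousOn_symm).isOpen_inter_preimage
    ψ.open_target φ.open_source
  smooth := by
    have h1 : ContMDiffOn (𝓡 m) (𝓡 n) ∞ (fun u => ι (ψ.symm u)) ψ.target :=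
      hι.comp_contMDiffOn (contMDiffOn_symm_of_mem_maximalAtlas hψ)
    exact ((contMDiffOn_of_mem_maximalAtlas hφ).comp (h1.mono Set.inter_subset_left)
      Set.inter_subset_right).contDiffOn
  injective u hu := by
    have dφ := mdifferentiable_of_mem_maximalAtlas hφ
    have dψ := mdifferentiable_of_mem_maximalAtlas hψ
    have h1 : HasMFDerivAt (𝓡 m) (𝓡 m) ψ.symm u _ :=
      (dψ.mdifferentiableAt_symm hu.1).hasMFDerivAt
    have h2 : HasMFDerivAt (𝓡 m) (𝓡 n) ι (ψ.symm u) _ :=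
      ((hι.mdifferentiable (by simp)) (ψ.symm u)).hasMFDerivAt
    have h3 : HasMFDerivAt (𝓡 n) (𝓡 n) φ (ι (ψ.symm u)) _ :=
      (dφ.mdifferentiableAt hu.2).hasMFDerivAt
    have h4 : HasMFDerivAt (𝓡 m) (𝓡 n) (coordMap φ ψ ι) u _ :=
      HasMFDerivAt.comp u h3 (HasMFDerivAt.comp u h2 h1)
    rw [← mfderiv_eq_fderiv, h4.mfderiv]
    exact (dφ.mfderiv_injective hu.2).comp ((hι' _).comp (dψ.symm.mfderiv_injective hu.1))
  finrank_eq := by simp [hmn]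

end Immersions

/-! ### The Kropina change in charts. -/

section Kropina

variable {n : ℕ} {M : Type*} [TopologicalSpace M] [ChartedSpace (Vec n) M]
  {D : Set (TangentBundle (𝓡 n) M)} {L : TangentBundle (𝓡 n) M → ℝ}
  {b : (p : TangentBundle (𝓡 n) M) → TangentSpace (𝓡 n) p.proj →L[ℝ] ℝ}

theorem IsHVector.exists_isGradientHVector (hb : IsHVector D L b) (hg : IsGradient D L b)
    {φ : OpenPartialHomeomorph M (Vec n)} (hφ : φ ∈ IsManifold.maximalAtlas (𝓡 n) ∞ M) :
    ∃ ρ, IsGradientHVector (coordFun φ L) (coordCov φ b) ρ (coordSet φ D) := by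
  obtain ⟨ρ, -, hρ⟩ := hb.exists_scalar
  exact ⟨unc (coordFun φ ρ), fun i => contDiffOn_unc (hb.smooth φ hφ i),
    fun p hp => hb.vCov_eq_zero φ hφ _ _ hp, fun p hp => hρ φ hφ _ _ hp,
    fun p hp => hg φ hφ _ _ hp⟩

variable [IsManifold (𝓡 n) ∞ M]

/-- Positivity of the Kropina metric `L²/β` forces `β > 0`. -/
theorem coordCov_pos (hL : IsFinslerMetric D L) (hK : IsFinslerMetric D (kropina L b))
    {φ : OpenPartialHomeomorph M (Vec n)} {p : TS (Vec n)} (hp : p ∈ coordSet φ D) :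
    0 < covFun (coordCov φ b) p := by
  rw [covFun_coordCov]
  exact (div_pos_iff_of_pos_left (pow_pos (hL.pos _ hp.2) 2)).1 (hK.pos _ hp.2)

theorem kropina_mul_covFun (hL : IsFinslerMetric D L) (hK : IsFinslerMetric D (kropina L b))
    {φ : OpenPartialHomeomorph M (Vec n)} {p : TS (Vec n)} (hp : p ∈ coordSet φ D) :
    unc (coordFun φ (kropina L b)) p * covFun (coordCov φ b) p
      = unc (coordFun φ L) p * unc (coordFun φ L) p := by
  have h1 := (coordCov_pos hL hK hp).ne'
  rw [covFun_coordCov] at h1 ⊢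
  rw [unc, coordFun, kropina, div_mul_cancel₀ _ h1, sq]
  rfl

end Kropina

end FinslerHyp

end

/-! ### The theorem on manifolds, chart by chart. -/

theorem mainTheorem4 {m : ℕ}
    {M : Type*} [TopologicalSpace M] [ChartedSpace (FinslerHyp.Vec (m + 1)) M]
    [IsManifold (𝓡 (m + 1)) ∞ M]
    {S : Type*} [TopologicalSpace S] [ChartedSpace (FinslerHyp.Vec m) S]
    [IsManifold (𝓡 m) ∞ S]
    (D : Set (TangentBundle (𝓡 (m + 1)) M)) (L : TangentBundle (𝓡 (m + 1)) M → ℝ)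
    (b : (p : TangentBundle (𝓡 (m + 1)) M) → TangentSpace (𝓡 (m + 1)) p.proj →L[ℝ] ℝ)
    (ι : S → M)
    (hL : FinslerHyp.IsFinslerMetric D L)
    (hb : FinslerHyp.IsHVector D L b)
    (hK : FinslerHyp.IsFinslerMetric D (FinslerHyp.kropina L b))
    (hι : ContMDiff (𝓡 m) (𝓡 (m + 1)) ∞ ι)
    (hι' : ∀ s, Function.Injective (mfderiv (𝓡 m) (𝓡 (m + 1)) ι s))
    (hgrad : FinslerHyp.IsGradient D L b)
    (htan : FinslerHyp.IsTangential (m := m) D L ι b)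
    (hland : FinslerHyp.IsLandsberg D L) :
    (FinslerHyp.IsHyperplaneSecondKind (m := m) D L ι → FinslerHyp.SecondVVanishes (m := m) D L ι →
      FinslerHyp.IsHyperplaneSecondKind (m := m) D (FinslerHyp.kropina L b) ι) ∧
    (FinslerHyp.IsHyperplaneThirdKind (m := m) D L ι →
      FinslerHyp.IsHyperplaneThirdKind (m := m) D (FinslerHyp.kropina L b) ι) := by
  constructor
  · intro h2 hM φ hφ ψ hψ
    obtain ⟨ρ, hb'⟩ := hb.exists_isGradientHVector hgrad hφ
    have i := FinslerHyp.isImmersedHypersurface_coordMap rfl hι hι' hφ hψ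
    have hp := h2 φ hφ ψ hψ
    have ht := htan φ hφ ψ hψ
    have hM' := hM φ hφ ψ hψ
    rw [FinslerHyp.hypDomain_eq] at hp ht hM' ⊢
    exact FinslerHyp.kropina_hPathsAreHPaths (hL.isFinslerCoord hφ) (hK.isFinslerCoord hφ) hb'
      (fun p hp => hL.pos _ hp.2) (fun p hp => FinslerHyp.coordCov_pos hL hK hp)
      (fun p hp => FinslerHyp.kropina_mul_covFun hL hK hp) i (fun q hq => ht _ _ hq) hp
      (fun q hq => hM' _ _ hq)
  · intro h3 φ hφ ψ hψ
    obtain ⟨ρ, hb'⟩ := hb.exists_isGradientHVector hgrad hφ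
    have i := FinslerHyp.isImmersedHypersurface_coordMap rfl hι hι' hφ hψ
    have hp := h3 φ hφ ψ hψ
    have ht := htan φ hφ ψ hψ
    rw [FinslerHyp.hypDomain_eq] at hp ht ⊢
    exact FinslerHyp.kropina_normalIsParallel (hL.isFinslerCoord hφ) (hK.isFinslerCoord hφ) hb'
      (fun p hp => hL.pos _ hp.2) (fun p hp => FinslerHyp.coordCov_pos hL hK hp)
      (fun p hp => FinslerHyp.kropina_mul_covFun hL hK hp) i (fun q hq => ht _ _ hq) hp
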